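/- Let $E$ be a measurable space, $n\ge 1$, and let $\mu_1,\dots,\mu_n$ be probability measures on $E$. For each $1\le k\le n$ let $(P_k^t)_{t\ge 0}$ be a Markov semigroup that is reversible with respect to $\mu_k$ and strongly continuous on $L^2(\mu_k)$, with $L^2(\mu_k)$-generator $\mathscr L_k$, and let $t_k\ge 0$. Sequential Monte Carlo (SMC) with $N$ particles: draw $\xi_1^{(1)},\dots,\xi_1^{(N)}$ independently from $\mu_1$. For $k=1,\dots,n-1$, draw independently $N$ indices from $\{1,\dots,N\}$, where $i$ has probability $\bar g_{k,k+1}(\xi_k^{(i)})/\sum_{j}\bar g_{k,k+1}(\xi_k^{(j)})$ with $\bar g_{k,k+1}=\frac{d\mu_{k+1}}{d\mu_k}$ (uniform probabilities if the denominator is $0$), and move each selected particle independently by one step of the Markov kernel $P_{k+1}^{t_{k+1}}$; this gives $\xi_{k+1}^{(1)},\dots,\xi_{k+1}^{(N)}$. Let $\eta_n^N(f)=\frac1N\sum_{i=1}^N f(\xi_n^{(i)})$ and $\mu(f)=\int f\,d\mu$. Assume the following. 1. $\mu_k=\sum_{i=1}^{M_k}w_k^{(i)}\mu_k^{(i)}$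 for probability measures $\mu_k^{(i)}$ and weights $w_k^{(i)}>0$ with $\sum_{i} w_k^{(i)}=1$, for $1\le k\le n$. 2. There is $\gamma\ge 1$ such that, for $1\le k<n$, $\mu_{k+1}\ll\mu_k$ and $\frac{d\mu_{k+1}}{d\mu_k}\le\gamma$ almost everywhere. 3. For all $k,i$ there is a Markov semigroup with stationary distribution $\mu_k^{(i)}$, strongly continuous on $L^2(\mu_k^{(i)})$, with generator $\mathscr L_{ki}$ and Dirichlet form $\mathscr E_{ki}(f,f)=-\langle f,\mathscr L_{ki}f\rangle_{\mu_k^{(i)}}$ (extended to all of $L^2(\mu_k^{(i)})$, with values in $[0,\infty]$, as its lower semicontinuous envelope), such that $\sum_{i=1}^{M_k}w_k^{(i)}\mathscr E_{ki}(f,f)\le-\langle f,\mathscr L_kf\rangle_{\mu_k}$ for all $f$ in the domain of $\mathscr L_k$. 4. There are constants $c_{ki}>0$ such that $\mathrm{Ent}_{\mu_k^{(i)}}(f^2)\le c_{ki}\,\mathscr E_{ki}(f,f)$ for all $f$ in the domain of $\mathscr L_{ki}$, where $\mathrm{Ent}_\mu(h)=\mu(h\log h)-\mu(h)\log\mu(h)$.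 Put $C_k^*=\max_i c_{ki}$, $M=\max_k M_k$, $w^*=\min_{k,i}w_k^{(i)}$ and $\beta=1+\max_k\sum_{i=1}^{M_k}\frac1{w_k^{(i)}}$. Let $f:E\to\mathbb R$ be bounded and measurable, and let $\epsilon>0$. Then $\mathbb E\big[(\eta_n^N(f)-\mu_n(f))^2\big]\le\epsilon$ holds in each of the following two cases. (Simplified bound) If $$N\ge n\cdot\max\Big\{\frac{4\gamma M}{w^*\epsilon}\big(1+3\|f-\mu_n(f)\|_{\sup}^2\big),\ \frac{128\,\gamma^{35/8}M^{7/4}}{(w^*)^{15/8}}\Big\}$$ and $t_k\ge 2C_k^*\gamma^7$ for all $1\le k\le n$. (Complete bound) If, for some $p=2^\kappa$ with an integer $\kappa>1$ and some $0<\alpha<\gamma^{-(2p-2)}$, $$N\ge\max\Big\{\frac n\epsilon\cdot\frac{\gamma\beta}{1-\alpha}\big(1+\|f\|_{L^p(\mu_n)}^2+2\|f-\mu_n(f)\|_{\sup}^2\big),\ 2n(3+\gamma)\gamma^{\frac{2p-1}{2p}}\delta(2p)^2\frac1{(w^*)^{1/(2p)}}\Big\}$$ and $t_k\ge\frac{C_k^*}2\max\Big\{\frac\gamma\alpha,\log\frac{p-1}{p/2-1}\Big\}$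 for all $1\le k\le n$. Here $\delta(1)=1$ and $\delta(2q)=\delta(q)\Big(\frac{\beta\gamma^{2q-2}}{1-\alpha\gamma^{2q-2}}\Big)^{1/(2q)}$ for $q=1,2,4,\dots,p$. -/

import Mathlib

open MeasureTheory ProbabilityTheory Filter Topology
open scoped NNReal ENNReal

section Semigroups

variable {E : Type*} [MeasurableSpace E]

/-- A time-homogeneous Markov semigroup on `E`: Markov kernels `P_t`, `t ≥ 0`, with `P_0 = id` and
the Chapman-Kolmogorov property. -/
structure MarkovSemigroup (E : Type*) [MeasurableSpace E] where
  kernel : ℝ≥0 → Kernel E E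
  markov : ∀ t, IsMarkovKernel (kernel t)
  zero : kernel 0 = Kernel.id
  add : ∀ s t, kernel (s + t) = (kernel t) ∘ₖ (kernel s)

instance (P : MarkovSemigroup E) (t : ℝ≥0) : IsMarkovKernel (P.kernel t) := P.markov t

/-- The action `P_t f (x) = ∫ f(y) P_t(x, dy)` on functions. -/
noncomputable def MarkovSemigroup.act (P : MarkovSemigroup E) (t : ℝ≥0) (f : E → ℝ) (x : E) : ℝ :=
  ∫ y, f y ∂(P.kernel t x)

/-- `μ` is a stationary distribution of the semigroup, and the semigroup is strongly continuous
on `L²(μ)` (so that it has a densely defined generator there). -/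
structure MarkovSemigroup.HasStationary (P : MarkovSemigroup E) (μ : Measure E) : Prop where
  invariant : ∀ t, (P.kernel t).Invariant μ
  continuous : ∀ f : E → ℝ, MemLp f 2 μ →
    Tendsto (fun t : ℝ≥0 => eLpNorm (fun x => P.act t f x - f x) 2 μ) (𝓝 0) (𝓝 0)

/-- `f` lies in the domain of the `L²(μ)`-generator `𝓛` of the semigroup and `𝓛 f = g`, i.e.
`(P_t f - f) / t → g` in `L²(μ)` as `t ↓ 0`. -/
def MarkovSemigroup.IsGen (P : MarkovSemigroup E) (μ : Measure E) (f g : E → ℝ) : Prop :=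
  MemLp f 2 μ ∧ MemLp g 2 μ ∧
    Tendsto (fun t : ℝ≥0 => eLpNorm (fun x => (P.act t f x - f x) / (t : ℝ) - g x) 2 μ)
      (𝓝[>] 0) (𝓝 0)

/-- The (closed) Dirichlet form `𝓔(f, f) ∈ [0, ∞]` of the semigroup in `L²(μ)`: the
lower semicontinuous envelope in `L²(μ)` of `u ↦ -⟨u, 𝓛 u⟩_μ`, `u ∈ dom 𝓛`. It allows one to speak
of `-⟨f, 𝓛 f⟩_μ` for `f` in the form domain that are not in the domain of `𝓛`. -/
noncomputable def MarkovSemigroup.dirichlet (P : MarkovSemigroup E) (μ : Measure E)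
    (f : E → ℝ) : ℝ≥0∞ :=
  ⨆ (δ : ℝ≥0∞) (_ : 0 < δ),
    ⨅ (u : E → ℝ) (v : E → ℝ) (_ : P.IsGen μ u v) (_ : eLpNorm (fun x => u x - f x) 2 μ < δ),
      ENNReal.ofReal (-∫ x, u x * v x ∂μ)

/-- The entropy `Ent_μ(h) = μ(h log h) - μ(h) log μ(h)`. -/
noncomputable def entropyOf (μ : Measure E) (h : E → ℝ) : ℝ :=
  ∫ x, h x * Real.log (h x) ∂μ - (∫ x, h x ∂μ) * Real.log (∫ x, h x ∂μ)

/-- The log-Sobolev inequality `Ent_μ(f²) ≤ c 𝓔(f, f)`, `𝓔(f, f) = -⟨f, 𝓛 f⟩_μ`, for all `f` in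
the domain of the generator (finiteness of the entropy is part of the inequality). -/
def MarkovSemigroup.LogSobolev (P : MarkovSemigroup E) (μ : Measure E) (c : ℝ) : Prop :=
  ∀ f g : E → ℝ, P.IsGen μ f g →
    Integrable (fun x => f x ^ 2 * Real.log (f x ^ 2)) μ ∧
      entropyOf μ (fun x => f x ^ 2) ≤ c * (-∫ x, f x * g x ∂μ)

end Semigroups

section Algorithm

variable {E : Type*} [MeasurableSpace E]

/-- The density ratio `dμ'/dμ` as a nonnegative real function. -/
noncomputable def densityRatio (μ' μ : Measure E) (x : E) : ℝ≥0 := (μ'.rnDeriv μ x).toNNReal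

/-- The normalized weights of the particles `x₁, …, x_N`. If all the unnormalized weights vanish,
the quotient is meaningless, and uniform weights are used by convention. -/
noncomputable def smcWeight (μ' μ : Measure E) {N : ℕ} (x : Fin N → E) (i : Fin N) : ℝ≥0 :=
  if ∑ j, densityRatio μ' μ (x j) = 0 then (N : ℝ≥0)⁻¹
  else densityRatio μ' μ (x i) / ∑ j, densityRatio μ' μ (x j)

lemma measurable_smcWeight (μ' μ : Measure E) {N : ℕ} (i : Fin N) :
    Measurable (fun x : Fin N → E => smcWeight μ' μ x i) := by
  have h : ∀ j : Fin N, Measurable (fun x : Fin N → E => densityRatio μ' μ (x j)) := fun j =>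
    ((Measure.measurable_rnDeriv μ' μ).comp (measurable_pi_apply j)).ennreal_toNNReal
  have hs : Measurable (fun x : Fin N → E => ∑ j, densityRatio μ' μ (x j)) :=
    Finset.measurable_sum _ fun j _ => h j
  unfold smcWeight
  exact Measurable.ite (hs (measurableSet_singleton 0)) measurable_const ((h i).div hs)

lemma sum_smcWeight (μ' μ : Measure E) {N : ℕ} (hN : N ≠ 0) (x : Fin N → E) :
    ∑ i, smcWeight μ' μ x i = 1 := by
  unfold smcWeight
  split_ifs with h
  · simp [hN]
  · rw [← Finset.sum_div, div_self h]

/-- Multinomial resampling: `N` independent indices `a 1, …, a N` are drawn with probabilities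
given by the weights, and the new particles are `x (a 1), …, x (a N)`. -/
noncomputable def resampleKernel (μ' μ : Measure E) (N : ℕ) :
    Kernel (Fin N → E) (Fin N → E) where
  toFun x := ∑ a : Fin N → Fin N,
    ((∏ i, smcWeight μ' μ x (a i) : ℝ≥0) : ℝ≥0∞) • Measure.dirac (fun i => x (a i))
  measurable' := by
    refine Measure.measurable_of_measurable_coe _ fun s hs => ?_
    simp only [Measure.coe_finsetSum, Finset.sum_apply, Measure.smul_apply, smul_eq_mul]
    refine Finset.measurable_sum _ fun a _ => Measurable.mul ?_ ?_
    · exact (Finset.measurable_prod _ fun i _ => measurable_smcWeight μ' μ (a i)).coe_nnreal_ennreal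
    · exact (Measure.measurable_coe hs).comp
        (Measure.measurable_dirac.comp (measurable_pi_lambda _ fun i => measurable_pi_apply (a i)))

/-- Each particle makes an independent move according to the Markov kernel `K`. -/
noncomputable def moveKernel (K : Kernel E E) [IsMarkovKernel K] (N : ℕ) :
    Kernel (Fin N → E) (Fin N → E) where
  toFun x := Measure.pi fun i => K (x i)
  measurable' := by
    refine Measurable.measure_of_isPiSystem_of_isProbabilityMeasure generateFrom_pi.symm
      isPiSystem_pi ?_
    rintro _ ⟨s, hs, rfl⟩
    simp only [Measure.pi_pi]
    exact Finset.measurable_prod _ fun i _ =>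
      (K.measurable_coe (hs i (Set.mem_univ i))).comp (measurable_pi_apply i)

/-- The joint law of the `N` particles of Sequential Monte Carlo at level `k = 1, 2, …`, for the
distributions `μ 1, μ 2, …` and the Markov kernels `P_k^{t_k}`: the particles of level `1` are
independent samples from `μ 1`; level `k + 1` arises from level `k` by multinomial resampling
with weights proportional to `dμ_{k+1}/dμ_k`, followed by independent moves with `P_{k+1}`.
(There is no level `0`; the value there is not used.) -/
noncomputable def smcLaw (μ : ℕ → Measure E) (P : ℕ → MarkovSemigroup E) (t : ℕ → ℝ≥0) (N : ℕ) :
    ℕ → Measure (Fin N → E)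
  | 0 => 0
  | 1 => Measure.pi fun _ => μ 1
  | k + 2 => ((smcLaw μ P t N (k + 1)).bind (resampleKernel (μ (k + 2)) (μ (k + 1)) N)).bind
      (moveKernel ((P (k + 2)).kernel (t (k + 2))) N)

/-- The mean squared error `𝔼[(η_n^N(f) - μ_n(f))²]` of the Monte Carlo estimate
`η_n^N(f) = (1/N) ∑ f(ξ_n^{(i)})` from the particles at level `n`. -/
noncomputable def smcMSE (μ : ℕ → Measure E) (P : ℕ → MarkovSemigroup E) (t : ℕ → ℝ≥0)
    (N n : ℕ) (f : E → ℝ) : ℝ :=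
  ∫ ξ, ((1 / (N : ℝ)) * ∑ i, f (ξ i) - ∫ x, f x ∂(μ n)) ^ 2 ∂(smcLaw μ P t N n)

end Algorithm

/-- The standing assumption, for levels `k = 1, …, n`. At level `k` the distribution `μ k` is a
mixture with `m k` components `ν k i` and weights `w k i`, the smoothing kernels come from the
semigroup `P k`, the component `ν k i` carries a semigroup `Q k i`, and `c k i` are the local
log-Sobolev constants. -/
structure SMCAssumption {E : Type*} [MeasurableSpace E] (n : ℕ) (μ : ℕ → Measure E)
    (P : ℕ → MarkovSemigroup E) (m : ℕ → ℕ) (w : (k : ℕ) → Fin (m k) → ℝ)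
    (ν : (k : ℕ) → Fin (m k) → Measure E) (Q : (k : ℕ) → Fin (m k) → MarkovSemigroup E)
    (c : (k : ℕ) → Fin (m k) → ℝ) (γ : ℝ) : Prop where
  /-- `P k` is a reversible Markov semigroup with stationary distribution `μ k`. -/
  stationary : ∀ k ∈ Set.Icc 1 n, (P k).HasStationary (μ k)
  reversible : ∀ k ∈ Set.Icc 1 n, ∀ s, ((P k).kernel s).IsReversible (μ k)
  /-- `μ k` is a mixture of probability measures with positive weights. -/
  component_prob : ∀ k ∈ Set.Icc 1 n, ∀ i, IsProbabilityMeasure (ν k i)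
  weight_pos : ∀ k ∈ Set.Icc 1 n, ∀ i, 0 < w k i
  weight_sum : ∀ k ∈ Set.Icc 1 n, ∑ i, w k i = 1
  mixture : ∀ k ∈ Set.Icc 1 n, μ k = ∑ i, ENNReal.ofReal (w k i) • ν k i
  /-- The density ratios of consecutive distributions exist and are bounded by `γ`. (`γ ≥ 1` is
  automatic for `n ≥ 2`.) -/
  one_le_ratio : 1 ≤ γ
  abs_cont : ∀ k, 1 ≤ k → k < n → μ (k + 1) ≪ μ k
  ratio_le : ∀ k, 1 ≤ k → k < n →
    ∀ᵐ x ∂(μ k), (μ (k + 1)).rnDeriv (μ k) x ≤ ENNReal.ofReal γ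
  /-- `⟨f, 𝓛_k f⟩_{μ_k} ≤ ∑ i, w_k^{(i)} ⟨f, 𝓛_{ki} f⟩_{μ_k^{(i)}}` for `f` in the domain of
  `𝓛_k`, written with the opposite sign, where `𝓛_{ki}` generates a Markov semigroup with
  stationary distribution `μ_k^{(i)}`. -/
  component_stationary : ∀ k ∈ Set.Icc 1 n, ∀ i, (Q k i).HasStationary (ν k i)
  decomposition : ∀ k ∈ Set.Icc 1 n, ∀ f g : E → ℝ, (P k).IsGen (μ k) f g →
    ∑ i, ENNReal.ofReal (w k i) * (Q k i).dirichlet (ν k i) f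
      ≤ ENNReal.ofReal (-∫ x, f x * g x ∂(μ k))
  /-- Local log-Sobolev inequalities. -/
  lsi_const_pos : ∀ k ∈ Set.Icc 1 n, ∀ i, 0 < c k i
  log_sobolev : ∀ k ∈ Set.Icc 1 n, ∀ i, (Q k i).LogSobolev (ν k i) (c k i)

/-- `smcDelta α β γ j` is the number `δ(2^j)` defined by `δ(1) = 1` and
`δ(2p) = δ(p) (β γ^{2p-2} / (1 - α γ^{2p-2}))^{1/(2p)}`. -/
noncomputable def smcDelta (α β γ : ℝ) : ℕ → ℝ
  | 0 => 1
  | j + 1 => smcDelta α β γ j *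
      (β * γ ^ (2 * 2 ^ j - 2) / (1 - α * γ ^ (2 * 2 ^ j - 2))) ^ (1 / (2 * 2 ^ j : ℝ))

/-!
The error of the particle approximation is controlled through second moments of the *unnormalized*
estimate, and these through the `L²` and `L⁴` norms of compositions `Q_{i,k} = q_i ⋯ q_{k-1}` of the
transfer operators `q_k u = (dμ_{k+1}/dμ_k) · P_{k+1}^{t_{k+1}} u`.

*Functional inequalities at one level.* Let `E_h(v) = h⁻¹ ∫ v (v - P_h v) dμ`. The averages
`h⁻¹ ∫₀ʰ P_s v ds` lie in the domain of the generator and have Dirichlet form at most `E_h(v)`.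
Together with the decomposition of the Dirichlet form, the log-Sobolev inequalities on the
components and the lower semicontinuity of the entropy (from the Gibbs variational principle) this
gives `∑ w_i Ent_{ν_i}(v²) ≤ C · liminf E_h(v)` for `v` bounded and bounded away from `0`
(`MixtureLevel.sum_entropyOf_le`). There are two consequences. Linearizing at `1` yields a
Poincaré inequality on each component, hence `‖P_t u‖₂² ≤ (α/γ) ‖u‖₂² + b ‖u‖₁²`; a density ratio
bounded by `γ` costs a factor `γ`, so that `q_k` still contracts up to an `L¹` norm, and the bounds for
`Q_{i,k}` are uniform in `i` and `k`. And since
`Ent_μ(v²) ≤ ∑ w_i Ent_{ν_i}(v²) + log(1/w_min) ∫ v²`, Gross' argument for a defective log-Sobolev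
inequality gives `∫ (P_t u)⁴ ≤ (1/w_min) (∫ u²)²` (`MixtureLevel.integral_act_pow_four_le`).

*Particles.* Let `η_k` be the empirical mean at level `k` and `z_k` the product of
`η_j(dμ_{j+1}/dμ_j)` over `j < k`. Then `z_k η_k(u)` is an unbiased estimate of `μ_k(u)`, and the second
moments `𝔼[z_k² η_k(u) η_k(v)]` satisfy an exact linear recursion in `k`. It expands them
(`SMCSequence.secondMoment_le`) into `μ_k(u) μ_k(v)` plus
`N⁻¹ ∑_{i ≤ k} 𝔼[z_i² η_i(Q_{i,k} u · Q_{i,k} v)]`, up to powers of `1 - 1/N`, and the norm bounds for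
`Q_{i,k}` allow one to replace `𝔼[z_i² η_i(h)]` by `μ_i(h)` at the price of a small multiple of the
`L²` norm of `h`. Every real `z` satisfies `1 ≤ (5/2) z² + (5/3) (z - 1)²`; therefore, with
`u = f - μ_n(f)`, the mean squared error is at most
`(5/2) 𝔼[z_n² η_n(u)²] + (5/3) (sup |u|)² 𝔼[(z_n - 1)²]`, and the expansion bounds both expectations.

The argument needs only the exponent `p = 4`. The bound on `N` for a larger `p` implies the one for
`p = 4`, because `δ(2p)² / w_min^{1/(2p)}` is nondecreasing in `p`.
-/

set_option linter.unusedSectionVars false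

/-! ### Markov kernels acting on square-integrable functions -/

section KernelAction

variable {E : Type*} [MeasurableSpace E] {κ : Kernel E E} [IsMarkovKernel κ] {μ : Measure E}
  [IsProbabilityMeasure μ]

lemma compProd_snd_measurePreserving (h : κ.Invariant μ) :
    MeasurePreserving (Prod.snd : E × E → E) (μ ⊗ₘ κ) μ :=
  ⟨measurable_snd, by
    have := Measure.snd_compProd μ κ
    rw [Measure.snd] at this
    rw [this]; exact h⟩

lemma compProd_fst_measurePreserving :
    MeasurePreserving (Prod.fst : E × E → E) (μ ⊗ₘ κ) μ :=
  ⟨measurable_fst, by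
    have := Measure.fst_compProd μ κ
    rwa [Measure.fst] at this⟩

/-- Detailed balance: the joint law of two consecutive states of the stationary chain is
symmetric. -/
lemma compProd_swap_measurePreserving (h : κ.IsReversible μ) :
    MeasurePreserving (Prod.swap : E × E → E × E) (μ ⊗ₘ κ) (μ ⊗ₘ κ) := by
  refine ⟨measurable_swap, ?_⟩
  refine ext_of_generate_finite _ generateFrom_prod.symm isPiSystem_prod ?_ ?_
  · rintro _ ⟨s, hs, t, ht, rfl⟩
    rw [Measure.map_apply measurable_swap (hs.prod ht), Set.preimage_swap_prod,
      Measure.compProd_apply_prod ht hs, Measure.compProd_apply_prod hs ht]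
    exact h ht hs
  · rw [Measure.map_apply measurable_swap MeasurableSet.univ, Set.preimage_univ]

lemma ae_kernel_ae_of_ae (h : κ.Invariant μ) {p : E → Prop} (hp : ∀ᵐ x ∂μ, p x) :
    ∀ᵐ x ∂μ, ∀ᵐ y ∂(κ x), p y := by
  have h1 : ∀ᵐ x ∂(κ ∘ₘ μ), p x := by
    have : κ ∘ₘ μ = μ := h
    rwa [this]
  exact Measure.ae_ae_of_ae_comp h1

lemma integral_kernel_congr_ae (h : κ.Invariant μ) {f g : E → ℝ} (hfg : f =ᵐ[μ] g) :
    (fun x => ∫ y, f y ∂(κ x)) =ᵐ[μ] fun x => ∫ y, g y ∂(κ x) := by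
  filter_upwards [ae_kernel_ae_of_ae h hfg] with x hx
  exact integral_congr_ae hx

lemma ae_integrable_kernel (h : κ.Invariant μ) {f : E → ℝ} (hf : Integrable f μ) :
    ∀ᵐ x ∂μ, Integrable f (κ x) := by
  refine Measure.ae_integrable_of_integrable_comp ?_
  have : κ ∘ₘ μ = μ := h
  rwa [this]

lemma aestronglyMeasurable_integral_kernel (h : κ.Invariant μ) {f : E → ℝ}
    (hf : AEStronglyMeasurable f μ) :
    AEStronglyMeasurable (fun x => ∫ y, f y ∂(κ x)) μ := by
  obtain ⟨g, hg, hfg⟩ := hf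
  refine AEStronglyMeasurable.congr ?_ (integral_kernel_congr_ae h hfg).symm
  exact (StronglyMeasurable.integral_kernel hg).aestronglyMeasurable

lemma eLpNorm_integral_kernel_le (h : κ.Invariant μ) {f : E → ℝ} (hf : MemLp f 2 μ) :
    eLpNorm (fun x => ∫ y, f y ∂(κ x)) 2 μ ≤ eLpNorm f 2 μ := by
  have h2 : (2 : ℝ≥0∞) ≠ 0 := by norm_num
  have h2' : (2 : ℝ≥0∞) ≠ ∞ := by norm_num
  have key : ∀ᵐ x ∂μ, ‖∫ y, f y ∂(κ x)‖ₑ ^ (2 : ℝ) ≤ ∫⁻ y, ‖f y‖ₑ ^ (2 : ℝ) ∂(κ x) := by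
    filter_upwards [ae_integrable_kernel h (hf.integrable (by norm_num))] with x hx
    have h1 : ‖∫ y, f y ∂(κ x)‖ₑ ≤ eLpNorm f 2 (κ x) := by
      refine (enorm_integral_le_lintegral_enorm f).trans ?_
      rw [← eLpNorm_one_eq_lintegral_enorm]
      exact eLpNorm_le_eLpNorm_of_exponent_le (by norm_num) hx.aestronglyMeasurable
    calc ‖∫ y, f y ∂(κ x)‖ₑ ^ (2 : ℝ) ≤ (eLpNorm f 2 (κ x)) ^ (2 : ℝ) := by gcongr
      _ = ∫⁻ y, ‖f y‖ₑ ^ (2 : ℝ) ∂(κ x) := by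
        rw [eLpNorm_eq_lintegral_rpow_enorm_toReal h2 h2', ← ENNReal.rpow_mul]
        simp
  rw [eLpNorm_eq_lintegral_rpow_enorm_toReal h2 h2', eLpNorm_eq_lintegral_rpow_enorm_toReal h2 h2']
  refine ENNReal.rpow_le_rpow ?_ (by positivity)
  simp only [ENNReal.toReal_ofNat]
  calc ∫⁻ x, ‖∫ y, f y ∂(κ x)‖ₑ ^ (2 : ℝ) ∂μ ≤ ∫⁻ x, ∫⁻ y, ‖f y‖ₑ ^ (2 : ℝ) ∂(κ x) ∂μ :=
        lintegral_mono_ae key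
    _ = ∫⁻ y, ‖f y‖ₑ ^ (2 : ℝ) ∂(κ ∘ₘ μ) := by
      rw [Measure.lintegral_bind κ.aemeasurable]
      have : κ ∘ₘ μ = μ := h
      rw [this]
      exact hf.aestronglyMeasurable.enorm.pow_const _
    _ = ∫⁻ y, ‖f y‖ₑ ^ (2 : ℝ) ∂μ := by
      have : κ ∘ₘ μ = μ := h
      rw [this]

lemma memLp_integral_kernel (h : κ.Invariant μ) {f : E → ℝ} (hf : MemLp f 2 μ) :
    MemLp (fun x => ∫ y, f y ∂(κ x)) 2 μ :=
  ⟨aestronglyMeasurable_integral_kernel h hf.aestronglyMeasurable,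
    (eLpNorm_integral_kernel_le h hf).trans_lt hf.eLpNorm_lt_top⟩

lemma integrable_mul_compProd (h : κ.Invariant μ) {f g : E → ℝ} (hf : MemLp f 2 μ)
    (hg : MemLp g 2 μ) : Integrable (fun p : E × E => f p.1 * g p.2) (μ ⊗ₘ κ) :=
  MemLp.integrable_mul (p := 2) (q := 2)
    (hf.comp_measurePreserving compProd_fst_measurePreserving)
    (hg.comp_measurePreserving (compProd_snd_measurePreserving h))

lemma integral_mul_integral_kernel (h : κ.Invariant μ) {f g : E → ℝ} (hf : MemLp f 2 μ)
    (hg : MemLp g 2 μ) :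
    ∫ x, f x * ∫ y, g y ∂(κ x) ∂μ = ∫ p : E × E, f p.1 * g p.2 ∂(μ ⊗ₘ κ) := by
  rw [Measure.integral_compProd (integrable_mul_compProd h hf hg)]
  simp_rw [integral_const_mul]

/-- Reversible kernels are self-adjoint on `L²`. -/
lemma integral_mul_integral_kernel_comm (h : κ.IsReversible μ) {f g : E → ℝ} (hf : MemLp f 2 μ)
    (hg : MemLp g 2 μ) :
    ∫ x, f x * ∫ y, g y ∂(κ x) ∂μ = ∫ x, (∫ y, f y ∂(κ x)) * g x ∂μ := by
  have hi := h.invariant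
  rw [integral_mul_integral_kernel hi hf hg]
  have h1 : ∫ x, (∫ y, f y ∂(κ x)) * g x ∂μ = ∫ x, g x * ∫ y, f y ∂(κ x) ∂μ := by
    simp_rw [mul_comm]
  rw [h1, integral_mul_integral_kernel hi hg hf,
    ← (compProd_swap_measurePreserving h).integral_comp MeasurableEquiv.prodComm.measurableEmbedding]
  simp [mul_comm]

lemma integral_integral_kernel (h : κ.Invariant μ) {f : E → ℝ} (hf : Integrable f μ) :
    ∫ x, ∫ y, f y ∂(κ x) ∂μ = ∫ x, f x ∂μ := by
  have h1 : Integrable (fun p : E × E => f p.2) (μ ⊗ₘ κ) :=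
    (compProd_snd_measurePreserving h).integrable_comp_of_integrable hf
  have h2 := Measure.integral_compProd h1
  rw [← h2]
  have h3 := integral_map (μ := μ ⊗ₘ κ) (φ := Prod.snd) measurable_snd.aemeasurable (f := f)
    (by rw [(compProd_snd_measurePreserving h).map_eq]; exact hf.aestronglyMeasurable)
  rw [(compProd_snd_measurePreserving h).map_eq] at h3
  exact h3.symm

end KernelAction

/-! ### Symmetric contraction semigroups on a Hilbert space -/

section HilbertSemigroup

open scoped InnerProductSpace

/-- A strongly continuous semigroup of symmetric contractions on a real Hilbert space. -/
structure IsSymmSemigroup {H : Type*} [NormedAddCommGroup H] [InnerProductSpace ℝ H]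
    (T : ℝ≥0 → H →L[ℝ] H) : Prop where
  zero : ∀ v, T 0 v = v
  add : ∀ s t v, T (s + t) v = T s (T t v)
  contraction : ∀ t v, ‖T t v‖ ≤ ‖v‖
  symm : ∀ t u v, ⟪T t u, v⟫_ℝ = ⟪u, T t v⟫_ℝ
  tendsto_zero : ∀ v, Tendsto (fun t => T t v) (𝓝 0) (𝓝 v)

/-- The time average `h⁻¹ ∫₀ʰ T_s v ds` of an orbit. It lies in the domain of the generator. -/
noncomputable def orbitAverage {H : Type*} [NormedAddCommGroup H] [InnerProductSpace ℝ H]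
    (T : ℝ≥0 → H →L[ℝ] H) (h : ℝ) (v : H) : H :=
  h⁻¹ • ∫ s in (0 : ℝ)..h, T s.toNNReal v

variable {H : Type*} [NormedAddCommGroup H] [InnerProductSpace ℝ H] {T : ℝ≥0 → H →L[ℝ] H}

namespace IsSymmSemigroup

lemma continuous_orbit (hT : IsSymmSemigroup T) (v : H) : Continuous fun t : ℝ≥0 => T t v := by
  have key : ∀ s t : ℝ≥0, s ≤ t → dist (T s v) (T t v) ≤ dist (T (t - s) v) v := by
    intro s t hst
    have h1 : T t v = T s (T (t - s) v) := by rw [← hT.add, add_tsub_cancel_of_le hst]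
    rw [h1, dist_comm, dist_eq_norm, dist_eq_norm, ← map_sub]
    exact hT.contraction _ _
  rw [Metric.continuous_iff]
  intro t ε hε
  have h0 := hT.tendsto_zero v
  rw [Metric.tendsto_nhds_nhds] at h0
  obtain ⟨δ, hδ, h0⟩ := h0 ε hε
  refine ⟨δ, hδ, fun s hs => ?_⟩
  rcases le_total s t with hst | hst
  · refine (key s t hst).trans_lt (h0 ?_)
    rw [NNReal.dist_eq] at hs ⊢
    rw [NNReal.coe_sub hst, NNReal.coe_zero, sub_zero, abs_sub_comm]
    exact hs
  · rw [dist_comm]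
    refine (key t s hst).trans_lt (h0 ?_)
    rw [NNReal.dist_eq] at hs ⊢
    rw [NNReal.coe_sub hst, NNReal.coe_zero, sub_zero]
    exact hs

lemma continuous_orbit_real (hT : IsSymmSemigroup T) (v : H) :
    Continuous fun s : ℝ => T s.toNNReal v :=
  (hT.continuous_orbit v).comp continuous_real_toNNReal

lemma inner_sub_nonneg (hT : IsSymmSemigroup T) (h : ℝ≥0) (u : H) : 0 ≤ ⟪u, u - T h u⟫_ℝ := by
  rw [inner_sub_right, real_inner_self_eq_norm_sq]
  have := (real_inner_le_norm u (T h u)).trans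
    (mul_le_mul_of_nonneg_left (hT.contraction h u) (norm_nonneg u))
  nlinarith

lemma inner_sub_sq_le (hT : IsSymmSemigroup T) (h : ℝ≥0) (u w : H) :
    ⟪u, w - T h w⟫_ℝ ^ 2 ≤ ⟪u, u - T h u⟫_ℝ * ⟪w, w - T h w⟫_ℝ := by
  have hs : ⟪w, u - T h u⟫_ℝ = ⟪u, w - T h w⟫_ℝ := by
    rw [inner_sub_right, inner_sub_right, ← hT.symm, real_inner_comm (T h w) u, real_inner_comm]
  have h1 : ∀ x : ℝ, 0 ≤ ⟪w, w - T h w⟫_ℝ * (x * x) + (2 * ⟪u, w - T h w⟫_ℝ) * x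
      + ⟪u, u - T h u⟫_ℝ := by
    intro x
    have h2 := hT.inner_sub_nonneg h (u + x • w)
    have h3 : u + x • w - T h (u + x • w) = (u - T h u) + x • (w - T h w) := by
      rw [map_add, map_smul, smul_sub]; abel
    rw [h3, inner_add_left, inner_add_right, inner_add_right, real_inner_smul_left,
      real_inner_smul_left, real_inner_smul_right, real_inner_smul_right, hs] at h2
    linarith
  have h4 := discrim_le_zero h1
  rw [discrim] at h4
  nlinarith

/-- The energy of the orbit decreases. Writing `b s = ⟨T_s v, (1 - T_h) v⟩`, Cauchy-Schwarz for the
form of `1 - T_h` gives `b s ^ 2 ≤ b (2 s) * b 0`; as `b` is bounded, doubling `s` indefinitely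
gives `b s ≤ b 0`. -/
lemma inner_orbit_sub_le (hT : IsSymmSemigroup T) (h s : ℝ≥0) (v : H) :
    ⟪T s v, v - T h v⟫_ℝ ≤ ⟪v, v - T h v⟫_ℝ := by
  set b : ℝ≥0 → ℝ := fun s => ⟪T s v, v - T h v⟫_ℝ with hb
  have hb0 : b 0 = ⟪v, v - T h v⟫_ℝ := by simp only [hb, hT.zero]
  have hb0' : 0 ≤ b 0 := by rw [hb0]; exact hT.inner_sub_nonneg h v
  have hcomm : ∀ s, T s (v - T h v) = T s v - T h (T s v) := by
    intro s
    rw [map_sub, ← hT.add, ← hT.add, add_comm]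
  have hdbl : ∀ s, b s ^ 2 ≤ b (2 * s) * b 0 := by
    intro s
    have h1 := hT.inner_sub_sq_le h (T s v) v
    have h2 : ⟪T s v, T s v - T h (T s v)⟫_ℝ = b (2 * s) := by
      rw [← hcomm, ← hT.symm, ← hT.add, two_mul]
    rwa [h2, ← hb0] at h1
  obtain ⟨M, hM⟩ : ∃ M, ∀ s, b s ≤ M := ⟨‖v‖ * ‖v - T h v‖, fun s =>
    (real_inner_le_norm _ _).trans
      (mul_le_mul_of_nonneg_right (hT.contraction s v) (norm_nonneg _))⟩
  change b s ≤ _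
  rw [← hb0]
  by_contra! hlt
  have hpos : 0 < b 0 := by
    rcases hb0'.lt_or_eq with h1 | h1
    · exact h1
    · have h2 := hdbl s
      rw [← h1] at hlt h2
      nlinarith [sq_pos_of_pos hlt]
  set x := b s / b 0 with hx
  have hx1 : 1 < x := by rwa [hx, one_lt_div hpos]
  have hpow : ∀ k : ℕ, x ^ 2 ^ k * b 0 ≤ b (2 ^ k * s) := by
    intro k
    induction k with
    | zero => simp [hx, hpos.ne']
    | succ k ih =>
      have h1 := hdbl (2 ^ k * s)
      have h2 : 2 * (2 ^ k * s) = 2 ^ (k + 1) * s := by ring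
      rw [h2] at h1
      have h3 : (x ^ 2 ^ k * b 0) ^ 2 ≤ b (2 ^ (k + 1) * s) * b 0 :=
        (pow_le_pow_left₀ (by positivity) ih 2).trans h1
      have h4 : (x ^ 2 ^ k * b 0) ^ 2 = (x ^ 2 ^ (k + 1) * b 0) * b 0 := by
        rw [pow_succ 2 k, pow_mul]; ring
      rw [h4] at h3
      exact le_of_mul_le_mul_right h3 hpos
  obtain ⟨k, hk⟩ := pow_unbounded_of_one_lt (M / b 0) hx1
  have h1 : x ^ k ≤ x ^ 2 ^ k := pow_le_pow_right₀ hx1.le Nat.lt_two_pow_self.le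
  have h2 : M < x ^ 2 ^ k * b 0 := by
    rw [div_lt_iff₀ hpos] at hk
    exact hk.trans_le (mul_le_mul_of_nonneg_right h1 hpos.le)
  exact absurd ((hpow k).trans (hM _)) (not_le.2 h2)

/-- Smoothing of the energy: the difference quotients `h⁻¹ ⟨w, w - T_h w⟩` at `w = T_t v` are at
most `‖v‖² / (2 t)`, for steps `h = 2 t / m`. -/
lemma energy_orbit_le (hT : IsSymmSemigroup T) {t : ℝ≥0} (ht : 0 < t) {m : ℕ} (hm : 0 < m)
    (v : H) :
    ((2 * t / m : ℝ≥0) : ℝ)⁻¹ * ⟪T t v, T t v - T (2 * t / m) (T t v)⟫_ℝ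
      ≤ ‖v‖ ^ 2 / (2 * t) := by
  set h : ℝ≥0 := 2 * t / m with hh
  have hm' : (m : ℝ≥0) ≠ 0 := by exact_mod_cast hm.ne'
  have hmh : (m : ℝ≥0) * h = 2 * t := by rw [hh]; field_simp
  have hcomm : ∀ s : ℝ≥0, T s v - T h (T s v) = T s (v - T h v) := by
    intro s
    rw [map_sub, ← hT.add, ← hT.add, add_comm]
  have h1 : ⟪T t v, T t v - T h (T t v)⟫_ℝ = ⟪T (2 * t) v, v - T h v⟫_ℝ := by
    rw [hcomm, ← hT.symm, ← hT.add, two_mul]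
  set φ : ℕ → ℝ := fun k => ⟪T (k * h) v, v⟫_ℝ with hφ
  have hstep : ∀ k ∈ Finset.range m, ⟪T (2 * t) v, v - T h v⟫_ℝ ≤ φ k - φ (k + 1) := by
    intro k hk
    have hkm : k ≤ m := (Finset.mem_range.1 hk).le
    have h2 : φ k - φ (k + 1) = ⟪T (k * h) v, v - T h v⟫_ℝ := by
      simp only [hφ, inner_sub_right]
      rw [← hT.symm h, ← hT.add, Nat.cast_succ, add_mul, one_mul, add_comm]
    rw [h2]
    -- shift by half of `k h` to write both sides as energies of one orbit
    have hle : (k : ℝ≥0) * h ≤ 2 * t := by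
      rw [← hmh]; gcongr
    have hhalf : ∀ a : ℝ≥0, ⟪T a v, v - T h v⟫_ℝ
        = ⟪T (a / 2) v, T (a / 2) v - T h (T (a / 2) v)⟫_ℝ := by
      intro a
      rw [hcomm, ← hT.symm, ← hT.add, add_halves]
    have h3 : T (2 * t) v = T (2 * t - k * h) (T (k * h / 2) (T (k * h / 2) v)) := by
      rw [← hT.add, ← hT.add, add_assoc, add_halves, tsub_add_cancel_of_le hle]
    rw [hhalf (k * h)]
    have h4 : ⟪T (2 * t) v, v - T h v⟫_ℝ = ⟪T (2 * t - k * h) (T (k * h / 2) v),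
        T (k * h / 2) v - T h (T (k * h / 2) v)⟫_ℝ := by
      rw [hcomm, ← hT.symm, h3, ← hT.add, ← hT.add, ← hT.add, ← hT.add]
      congr 3
      ring
    rw [h4]
    exact hT.inner_orbit_sub_le h _ _
  have h5 := Finset.sum_le_sum hstep
  rw [Finset.sum_range_sub', Finset.sum_const, Finset.card_range, nsmul_eq_mul] at h5
  have h6 : φ 0 = ‖v‖ ^ 2 := by simp [hφ, hT.zero]
  have h7 : 0 ≤ φ m := by
    have : φ m = ⟪T (m * h / 2) v, T (m * h / 2) v⟫_ℝ := by
      simp only [hφ]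
      rw [← hT.symm, ← hT.add, add_halves]
    rw [this]
    exact real_inner_self_nonneg
  rw [h1]
  have hmpos : (0 : ℝ) < m := by exact_mod_cast hm
  have htpos : (0 : ℝ) < t := by exact_mod_cast ht
  have h8 : (h : ℝ)⁻¹ = m / (2 * t) := by
    rw [hh]; push_cast; rw [inv_div]
  rw [h8, div_mul_eq_mul_div]
  gcongr
  linarith

variable [CompleteSpace H]

lemma orbitAverage_energy_le (hT : IsSymmSemigroup T) {h : ℝ} (hh : 0 < h) (v : H) :
    -⟪orbitAverage T h v, h⁻¹ • (T h.toNNReal v - v)⟫_ℝ ≤ h⁻¹ * ⟪v, v - T h.toNNReal v⟫_ℝ := by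
  set B := v - T h.toNNReal v with hB
  have hneg : T h.toNNReal v - v = -B := by rw [hB]; abel
  rw [hneg, smul_neg, inner_neg_right, neg_neg, real_inner_smul_right]
  refine mul_le_mul_of_nonneg_left ?_ (by positivity)
  have hc := hT.continuous_orbit_real v
  rw [orbitAverage, real_inner_smul_left, real_inner_comm]
  have h1 : ⟪B, ∫ s in (0 : ℝ)..h, T s.toNNReal v⟫_ℝ = ∫ s in (0 : ℝ)..h, ⟪B, T s.toNNReal v⟫_ℝ :=
    ((innerSL ℝ B).intervalIntegral_comp_comm (hc.intervalIntegrable 0 h)).symm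
  rw [h1]
  have h2 : ∫ s in (0 : ℝ)..h, ⟪B, T s.toNNReal v⟫_ℝ ≤ ∫ _ in (0 : ℝ)..h, ⟪v, B⟫_ℝ := by
    refine intervalIntegral.integral_mono_on hh.le ?_ ?_ ?_
    · exact (continuous_const.inner hc).intervalIntegrable _ _
    · exact intervalIntegrable_const
    · intro s _
      rw [real_inner_comm]
      exact hT.inner_orbit_sub_le _ _ _
  rw [intervalIntegral.integral_const, sub_zero, smul_eq_mul] at h2
  calc h⁻¹ * ∫ s in (0 : ℝ)..h, ⟪B, T s.toNNReal v⟫_ℝ ≤ h⁻¹ * (h * ⟪v, B⟫_ℝ) := by gcongr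
    _ = ⟪v, B⟫_ℝ := by field_simp

lemma tendsto_orbitAverage (hT : IsSymmSemigroup T) (v : H) :
    Tendsto (fun h : ℝ => orbitAverage T h v) (𝓝[>] 0) (𝓝 v) := by
  have hc := hT.continuous_orbit_real v
  have h1 : HasDerivAt (fun x => ∫ s in (0 : ℝ)..x, T s.toNNReal v) (T (0 : ℝ).toNNReal v) 0 :=
    intervalIntegral.integral_hasDerivAt_right (hc.intervalIntegrable _ _)
      (hc.stronglyMeasurableAtFilter _ _) hc.continuousAt
  rw [Real.toNNReal_zero, hT.zero] at h1
  have h2 := (hasDerivAt_iff_tendsto_slope_zero.1 h1).mono_left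
    (nhdsWithin_mono 0 (fun x (hx : 0 < x) => hx.ne'))
  refine h2.congr fun h => ?_
  simp [orbitAverage]

/-- Orbit averages lie in the domain of the generator. -/
lemma tendsto_generator_orbitAverage (hT : IsSymmSemigroup T) {h : ℝ} (hh : 0 < h) (v : H) :
    Tendsto (fun t : ℝ≥0 => (t : ℝ)⁻¹ • (T t (orbitAverage T h v) - orbitAverage T h v)) (𝓝[>] 0)
      (𝓝 (h⁻¹ • (T h.toNNReal v - v))) := by
  have hc := hT.continuous_orbit_real v
  set F : ℝ → H := fun x => ∫ s in (0 : ℝ)..x, T s.toNNReal v with hF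
  have hFd : ∀ x, HasDerivAt F (T x.toNNReal v) x := fun x =>
    intervalIntegral.integral_hasDerivAt_right (hc.intervalIntegrable _ _)
      (hc.stronglyMeasurableAtFilter _ _) hc.continuousAt
  have hshift : ∀ t : ℝ≥0, T t (orbitAverage T h v) = h⁻¹ • (F (h + t) - F t) := by
    intro t
    rw [orbitAverage, map_smul]
    congr 1
    rw [← (T t).intervalIntegral_comp_comm (hc.intervalIntegrable 0 h)]
    have h1 : ∫ s in (0 : ℝ)..h, T t (T s.toNNReal v)
        = ∫ s in (0 : ℝ)..h, T (s + t).toNNReal v := by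
      refine intervalIntegral.integral_congr fun s hs => ?_
      rw [Set.uIcc_of_le hh.le] at hs
      rw [← hT.add, Real.toNNReal_add hs.1 t.coe_nonneg, Real.toNNReal_coe, add_comm]
    rw [h1, intervalIntegral.integral_comp_add_right (fun s => T s.toNNReal v), zero_add]
    exact (intervalIntegral.integral_interval_sub_left (hc.intervalIntegrable _ _)
      (hc.intervalIntegrable _ _)).symm
  have hG : HasDerivAt (fun t : ℝ => h⁻¹ • (F (h + t) - F t)) (h⁻¹ • (T h.toNNReal v - v)) 0 := by
    have h1 : HasDerivAt (fun t : ℝ => F (h + t)) (T h.toNNReal v) 0 := by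
      have := (hFd (h + 0)).comp_const_add h 0
      simpa using this
    have h2 := hFd 0
    rw [Real.toNNReal_zero, hT.zero] at h2
    exact (h1.sub h2).const_smul _
  have h3 := (hasDerivAt_iff_tendsto_slope_zero.1 hG).mono_left
    (nhdsWithin_mono 0 (fun x (hx : 0 < x) => hx.ne'))
  have h4 : Tendsto (fun t : ℝ≥0 => (t : ℝ)) (𝓝[>] 0) (𝓝[>] 0) := by
    refine tendsto_nhdsWithin_iff.2 ⟨?_, ?_⟩
    · have : Tendsto (fun t : ℝ≥0 => (t : ℝ)) (𝓝 0) (𝓝 ((0 : ℝ≥0) : ℝ)) :=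
        NNReal.continuous_coe.tendsto 0
      rw [NNReal.coe_zero] at this
      exact this.mono_left nhdsWithin_le_nhds
    · filter_upwards [self_mem_nhdsWithin] with t ht
      exact_mod_cast ht
  refine (h3.comp h4).congr fun t => ?_
  have h5 := hshift 0
  simp only [NNReal.coe_zero, hT.zero] at h5
  simp only [Function.comp, zero_add]
  rw [← hshift t, h5]

/-- Right derivative of an orbit that starts in the domain of the generator. -/
lemma hasDerivWithinAt_orbit (hT : IsSymmSemigroup T) {v g : H}
    (hg : Tendsto (fun t : ℝ≥0 => (t : ℝ)⁻¹ • (T t v - v)) (𝓝[>] 0) (𝓝 g)) {s : ℝ} (hs : 0 ≤ s) :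
    Tendsto (fun z : ℝ => (z - s)⁻¹ • (T z.toNNReal v - T s.toNNReal v)) (𝓝[>] s)
      (𝓝 (T s.toNNReal g)) := by
  have h1 : Tendsto (fun z : ℝ => (z - s).toNNReal) (𝓝[>] s) (𝓝[>] 0) := by
    refine tendsto_nhdsWithin_iff.2 ⟨?_, ?_⟩
    · have : Continuous fun z : ℝ => (z - s).toNNReal := by fun_prop
      have h2 := this.tendsto s
      simp only [sub_self, Real.toNNReal_zero] at h2
      exact h2.mono_left nhdsWithin_le_nhds
    · filter_upwards [self_mem_nhdsWithin] with z hz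
      exact Real.toNNReal_pos.2 (sub_pos.2 hz)
  have h2 := ((T s.toNNReal).continuous.tendsto g).comp (hg.comp h1)
  refine h2.congr' ?_
  filter_upwards [self_mem_nhdsWithin] with z hz
  have hz' : 0 ≤ z - s := (sub_pos.2 hz).le
  simp only [Function.comp]
  rw [map_smul, map_sub, ← hT.add, Real.coe_toNNReal _ hz', ← Real.toNNReal_add hs hz',
    add_sub_cancel]

end IsSymmSemigroup

end HilbertSemigroup

/-! ### The semigroup on `L²` -/

section L2Action

open scoped InnerProductSpace

variable {E : Type*} [MeasurableSpace E] {μ : Measure E}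

lemma inner_toLp {f g : E → ℝ} (hf : MemLp f 2 μ) (hg : MemLp g 2 μ) :
    ⟪hf.toLp f, hg.toLp g⟫_ℝ = ∫ x, f x * g x ∂μ := by
  rw [L2.inner_def]
  refine integral_congr_ae ?_
  filter_upwards [hf.coeFn_toLp, hg.coeFn_toLp] with x h1 h2
  rw [h1, h2]
  simp [mul_comm]

lemma norm_toLp_sq {f : E → ℝ} (hf : MemLp f 2 μ) : ‖hf.toLp f‖ ^ 2 = ∫ x, f x ^ 2 ∂μ := by
  rw [← real_inner_self_eq_norm_sq, inner_toLp]
  simp_rw [pow_two]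

lemma memLp_two_of_bound [IsFiniteMeasure μ] {f : E → ℝ} (hf : Measurable f) {B : ℝ}
    (hB : ∀ x, |f x| ≤ B) : MemLp f 2 μ :=
  MemLp.of_bound hf.aestronglyMeasurable B (ae_of_all _ hB)

lemma integrable_of_abs_le [IsFiniteMeasure μ] {f : E → ℝ} (hf : Measurable f) {B : ℝ}
    (hB : ∀ x, |f x| ≤ B) : Integrable f μ :=
  Integrable.of_bound hf.aestronglyMeasurable B (ae_of_all _ hB)

variable [IsProbabilityMeasure μ]

lemma integral_abs_le_of_sq {f : E → ℝ} (hf : MemLp f 2 μ) {ρ : ℝ} (hρ : 0 ≤ ρ)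
    (h : ∫ x, f x ^ 2 ∂μ ≤ ρ ^ 2) : ∫ x, |f x| ∂μ ≤ ρ := by
  have h1 : Integrable (fun x => |f x|) μ := (hf.integrable (by norm_num)).abs
  have h2 : Integrable (fun x => f x ^ 2) μ := hf.integrable_sq
  have h3 : 0 ≤ ∫ x, (|f x| - ∫ y, |f y| ∂μ) ^ 2 ∂μ := integral_nonneg fun y => sq_nonneg _
  set m := ∫ y, |f y| ∂μ with hm
  have h4 : ∫ y, (|f y| - m) ^ 2 ∂μ = ∫ y, f y ^ 2 ∂μ - m ^ 2 := by
    have : ∀ y, (|f y| - m) ^ 2 = f y ^ 2 - (2 * m) * |f y| + m ^ 2 := fun y => by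
      rw [sub_sq, sq_abs]; ring
    simp_rw [this]
    rw [integral_add (f := fun y => f y ^ 2 - 2 * m * |f y|) (h2.sub (h1.const_mul _))
      (integrable_const _), integral_sub h2 (h1.const_mul _), integral_const_mul]
    simp only [integral_const, probReal_univ, smul_eq_mul, one_mul]
    rw [← hm]
    ring
  exact abs_le_of_sq_le_sq' (by linarith) hρ |>.2

lemma integral_sq_le_of_eLpNorm {f : E → ℝ} (hf : MemLp f 2 μ) {ρ : ℝ} (hρ : 0 ≤ ρ)
    (h : eLpNorm f 2 μ ≤ ENNReal.ofReal ρ) : ∫ x, f x ^ 2 ∂μ ≤ ρ ^ 2 := by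
  rw [← norm_toLp_sq hf, Lp.norm_toLp]
  have h1 : (eLpNorm f 2 μ).toReal ≤ ρ := by
    have := ENNReal.toReal_mono ENNReal.ofReal_ne_top h
    rwa [ENNReal.toReal_ofReal hρ] at this
  exact pow_le_pow_left₀ ENNReal.toReal_nonneg h1 2

/-- The operator that a Markov kernel with invariant distribution `μ` induces on `L²(μ)`. -/
noncomputable def l2Action (κ : Kernel E E) [IsMarkovKernel κ] (h : κ.Invariant μ) :
    Lp ℝ 2 μ →L[ℝ] Lp ℝ 2 μ :=
  LinearMap.mkContinuous
    { toFun := fun u => (memLp_integral_kernel h (Lp.memLp u)).toLp _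
      map_add' := fun u v => by
        rw [← MemLp.toLp_add, MemLp.toLp_eq_toLp_iff]
        have hu := ae_integrable_kernel h ((Lp.memLp u).integrable (by norm_num))
        have hv := ae_integrable_kernel h ((Lp.memLp v).integrable (by norm_num))
        filter_upwards [integral_kernel_congr_ae h (Lp.coeFn_add u v), hu, hv] with x h1 h2 h3
        rw [h1, Pi.add_apply, ← integral_add h2 h3]
        rfl
      map_smul' := fun c u => by
        rw [RingHom.id_apply, ← MemLp.toLp_const_smul, MemLp.toLp_eq_toLp_iff]
        filter_upwards [integral_kernel_congr_ae h (Lp.coeFn_smul c u)] with x h1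
        rw [h1, Pi.smul_apply, ← integral_smul]
        rfl } 1 (fun u => by
      rw [one_mul]
      change ‖(memLp_integral_kernel h (Lp.memLp u)).toLp _‖ ≤ _
      rw [Lp.norm_toLp, Lp.norm_def]
      exact ENNReal.toReal_mono (Lp.eLpNorm_ne_top u) (eLpNorm_integral_kernel_le h (Lp.memLp u)))

variable {κ : Kernel E E} [IsMarkovKernel κ]

lemma l2Action_apply (h : κ.Invariant μ) (u : Lp ℝ 2 μ) :
    l2Action κ h u = (memLp_integral_kernel h (Lp.memLp u)).toLp _ := rfl

lemma l2Action_toLp (h : κ.Invariant μ) {f : E → ℝ} (hf : MemLp f 2 μ) :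
    l2Action κ h (hf.toLp f) = (memLp_integral_kernel h hf).toLp _ := by
  rw [l2Action_apply, MemLp.toLp_eq_toLp_iff]
  exact integral_kernel_congr_ae h hf.coeFn_toLp

lemma coeFn_l2Action_toLp (h : κ.Invariant μ) {f : E → ℝ} (hf : MemLp f 2 μ) :
    l2Action κ h (hf.toLp f) =ᵐ[μ] fun x => ∫ y, f y ∂(κ x) := by
  rw [l2Action_toLp]
  exact MemLp.coeFn_toLp _

/-- The semigroup of operators on `L²(μ)` of a Markov semigroup with stationary distribution
`μ`. -/
noncomputable def MarkovSemigroup.l2 (P : MarkovSemigroup E) (hS : P.HasStationary μ) (t : ℝ≥0) :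
    Lp ℝ 2 μ →L[ℝ] Lp ℝ 2 μ :=
  l2Action (P.kernel t) (hS.invariant t)

variable {P : MarkovSemigroup E}

lemma MarkovSemigroup.memLp_act (hS : P.HasStationary μ) (t : ℝ≥0) {f : E → ℝ} (hf : MemLp f 2 μ) :
    MemLp (P.act t f) 2 μ :=
  memLp_integral_kernel (hS.invariant t) hf

lemma MarkovSemigroup.l2_toLp (hS : P.HasStationary μ) (t : ℝ≥0) {f : E → ℝ} (hf : MemLp f 2 μ) :
    P.l2 hS t (hf.toLp f) = MemLp.toLp (P.act t f) (P.memLp_act hS t hf) :=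
  l2Action_toLp _ hf

lemma MarkovSemigroup.isSymmSemigroup (hS : P.HasStationary μ)
    (hR : ∀ s, (P.kernel s).IsReversible μ) : IsSymmSemigroup (P.l2 hS) where
  zero v := by
    rw [← Lp.toLp_coeFn v (Lp.memLp v), l2_toLp, MemLp.toLp_eq_toLp_iff]
    refine Filter.Eventually.of_forall fun x => ?_
    have h1 := Lp.stronglyMeasurable v
    simp only [MarkovSemigroup.act, P.zero, Kernel.id_apply]
    exact integral_dirac' _ _ h1
  add s t v := by
    rw [← Lp.toLp_coeFn v (Lp.memLp v), l2_toLp, l2_toLp, l2_toLp, MemLp.toLp_eq_toLp_iff]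
    have hi := ae_integrable_kernel (hS.invariant (s + t)) ((Lp.memLp v).integrable (by norm_num))
    filter_upwards [hi] with x hx
    rw [P.add] at hx
    simp only [MarkovSemigroup.act, P.add]
    exact Kernel.integral_comp hx
  contraction t v := by
    rw [MarkovSemigroup.l2, l2Action_apply, Lp.norm_toLp, Lp.norm_def]
    exact ENNReal.toReal_mono (Lp.eLpNorm_ne_top v)
      (eLpNorm_integral_kernel_le (hS.invariant t) (Lp.memLp v))
  symm t u v := by
    rw [← Lp.toLp_coeFn v (Lp.memLp v), ← Lp.toLp_coeFn u (Lp.memLp u), l2_toLp, l2_toLp,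
      inner_toLp, inner_toLp]
    exact (integral_mul_integral_kernel_comm (hR t) (Lp.memLp u) (Lp.memLp v)).symm
  tendsto_zero v := by
    rw [← Lp.toLp_coeFn v (Lp.memLp v)]
    simp_rw [l2_toLp]
    rw [Lp.tendsto_Lp_iff_tendsto_eLpNorm'']
    exact hS.continuous v (Lp.memLp v)

lemma MarkovSemigroup.isGen_of_tendsto (hS : P.HasStationary μ) {f g : E → ℝ}
    (hf : MemLp f 2 μ) (hg : MemLp g 2 μ)
    (h : Tendsto (fun t : ℝ≥0 => (t : ℝ)⁻¹ • (P.l2 hS t (hf.toLp f) - hf.toLp f)) (𝓝[>] 0)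
      (𝓝 (hg.toLp g))) : P.IsGen μ f g := by
  refine ⟨hf, hg, ?_⟩
  have h1 : ∀ t : ℝ≥0, MemLp (fun x => (P.act t f x - f x) / (t : ℝ)) 2 μ := fun t => by
    have := ((P.memLp_act hS t hf).sub hf).const_mul (t : ℝ)⁻¹
    refine this.ae_eq (ae_of_all _ fun x => ?_)
    simp [div_eq_inv_mul]
  have h2 : ∀ t : ℝ≥0, (t : ℝ)⁻¹ • (P.l2 hS t (hf.toLp f) - hf.toLp f) = (h1 t).toLp _ := by
    intro t
    rw [l2_toLp, ← MemLp.toLp_sub, ← MemLp.toLp_const_smul, MemLp.toLp_eq_toLp_iff]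
    refine ae_of_all _ fun x => ?_
    simp [div_eq_inv_mul]
  simp_rw [h2] at h
  rw [Lp.tendsto_Lp_iff_tendsto_eLpNorm''] at h
  exact h

/-- The functions in `L²` with values in `[a, b]` form an order interval, hence a closed convex
set; Markov operators and averages preserve it. -/
lemma mem_Icc_Lp_iff {a b : ℝ} {u : Lp ℝ 2 μ} :
    u ∈ Set.Icc (MemLp.toLp (fun _ => a) (memLp_const a)) (MemLp.toLp (fun _ => b) (memLp_const b))
      ↔ ∀ᵐ x ∂μ, u x ∈ Set.Icc a b := by
  rw [Set.mem_Icc, ← Lp.coeFn_le, ← Lp.coeFn_le]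
  have ha := (memLp_const (p := 2) (μ := μ) a).coeFn_toLp
  have hb := (memLp_const (p := 2) (μ := μ) b).coeFn_toLp
  constructor
  · rintro ⟨h1, h2⟩
    filter_upwards [h1, h2, ha, hb] with x h1 h2 h3 h4
    rw [h3] at h1; rw [h4] at h2
    exact ⟨h1, h2⟩
  · intro h
    constructor
    · filter_upwards [h, ha] with x h1 h2
      rw [h2]; exact h1.1
    · filter_upwards [h, hb] with x h1 h2
      rw [h2]; exact h1.2

lemma act_mem_Icc (κ : Kernel E E) [IsMarkovKernel κ] {a b : ℝ} {f : E → ℝ} (hf : Measurable f)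
    (h : ∀ x, f x ∈ Set.Icc a b) (x : E) : ∫ y, f y ∂(κ x) ∈ Set.Icc a b := by
  have hi : Integrable f (κ x) := integrable_of_abs_le (B := max |a| |b|) hf fun y =>
    abs_le_max_abs_abs (h y).1 (h y).2
  constructor
  · calc a = ∫ _, a ∂(κ x) := by simp
      _ ≤ _ := integral_mono (integrable_const a) hi fun y => (h y).1
  · calc ∫ y, f y ∂(κ x) ≤ ∫ _, b ∂(κ x) := integral_mono hi (integrable_const b) fun y => (h y).2
      _ = b := by simp

lemma orbitAverage_mem_Icc (hS : P.HasStationary μ) (hR : ∀ s, (P.kernel s).IsReversible μ)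
    {a b : ℝ} {f : E → ℝ} (hfm : Measurable f) (hf : MemLp f 2 μ) (hab : ∀ x, f x ∈ Set.Icc a b)
    {h : ℝ} (hh : 0 < h) :
    ∀ᵐ x ∂μ, orbitAverage (P.l2 hS) h (hf.toLp f) x ∈ Set.Icc a b := by
  rw [← mem_Icc_Lp_iff]
  have hT := P.isSymmSemigroup hS hR
  have hc := hT.continuous_orbit_real (hf.toLp f)
  have h1 : orbitAverage (P.l2 hS) h (hf.toLp f)
      = ⨍ s in Set.Ioc 0 h, P.l2 hS s.toNNReal (hf.toLp f) := by
    rw [orbitAverage, setAverage_eq, intervalIntegral.integral_of_le hh.le]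
    simp [hh.le]
  rw [h1]
  refine Convex.set_average_mem ?_ isClosed_Icc ?_ ?_ ?_ ?_
  · intro u hu v hv c d hc hd hcd
    rw [mem_Icc_Lp_iff] at hu hv ⊢
    filter_upwards [hu, hv, Lp.coeFn_add (c • u) (d • v), Lp.coeFn_smul c u, Lp.coeFn_smul d v]
      with x h1 h2 h3 h4 h5
    rw [h3, Pi.add_apply, h4, h5]
    exact convex_Icc a b h1 h2 hc hd hcd
  · simp [hh]
  · simp
  · refine ae_of_all _ fun s => ?_
    rw [mem_Icc_Lp_iff]
    filter_upwards [coeFn_l2Action_toLp (hS.invariant s.toNNReal) hf] with x hx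
    rw [MarkovSemigroup.l2, hx]
    exact act_mem_Icc _ hfm hab x
  · exact (hc.integrableOn_Icc).mono_set Set.Ioc_subset_Icc_self

end L2Action

/-! ### Entropy -/

section Entropy

variable {E : Type*} [MeasurableSpace E] {ν : Measure E} [IsProbabilityMeasure ν]

/-- The Gibbs variational principle: `∫ h ψ ≤ Ent(h)` for every bounded `ψ` with `∫ exp ψ ≤ 1`.
Being an upper bound for a functional that is continuous in `h`, this gives the lower
semicontinuity of entropy. -/
lemma integral_mul_le_entropyOf {h ψ : E → ℝ} (hh : ∀ x, 0 ≤ h x) (hi : Integrable h ν)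
    (hlog : Integrable (fun x => h x * Real.log (h x)) ν) (hψ : Measurable ψ) {K : ℝ}
    (hK : ∀ x, |ψ x| ≤ K) (hexp : ∫ x, Real.exp (ψ x) ∂ν ≤ 1) :
    ∫ x, h x * ψ x ∂ν ≤ entropyOf ν h := by
  rw [entropyOf]
  set M := ∫ x, h x ∂ν with hM
  have hM0 : 0 ≤ M := integral_nonneg hh
  rcases hM0.eq_or_lt with h0 | hpos
  · have h1 : h =ᵐ[ν] 0 := (integral_eq_zero_iff_of_nonneg hh hi).1 (by rw [← hM, h0])
    have h2 : ∫ x, h x * ψ x ∂ν = 0 := by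
      refine integral_eq_zero_of_ae ?_
      filter_upwards [h1] with x hx
      simp [hx]
    have h3 : ∫ x, h x * Real.log (h x) ∂ν = 0 := by
      refine integral_eq_zero_of_ae ?_
      filter_upwards [h1] with x hx
      simp [hx]
    rw [h2, h3, ← h0]; simp
  · have hψi : Integrable (fun x => h x * ψ x) ν :=
      hi.mul_bdd (c := K) hψ.aestronglyMeasurable (ae_of_all _ hK)
    have hei : Integrable (fun x => Real.exp (ψ x)) ν :=
      integrable_of_abs_le (B := Real.exp K) (Real.measurable_exp.comp hψ) fun x => by
        rw [abs_of_pos (Real.exp_pos _)]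
        exact Real.exp_le_exp.2 ((le_abs_self _).trans (hK x))
    have key : ∀ x, h x - M * Real.exp (ψ x)
        ≤ h x * Real.log (h x) - h x * ψ x - h x * Real.log M := by
      intro x
      rcases (hh x).eq_or_lt with hx | hx
      · rw [← hx]
        have := mul_pos hpos (Real.exp_pos (ψ x))
        simp only [Real.log_zero]
        linarith
      · have h1 : 0 < h x / (M * Real.exp (ψ x)) := by positivity
        have h2 := Real.one_sub_inv_le_log_of_pos h1
        rw [Real.log_div hx.ne' (by positivity), Real.log_mul hpos.ne' (by positivity),
          Real.log_exp, inv_div] at h2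
        have h3 := mul_le_mul_of_nonneg_left h2 hx.le
        have h4 : h x * (1 - M * Real.exp (ψ x) / h x) = h x - M * Real.exp (ψ x) := by
          field_simp
        rw [h4] at h3
        linarith
    have h5 := integral_mono (hi.sub (hei.const_mul M))
      ((hlog.sub hψi).sub (hi.mul_const (Real.log M))) key
    have e1 : ∫ x, h x * Real.log (h x) - h x * ψ x - h x * Real.log M ∂ν
        = ∫ x, h x * Real.log (h x) ∂ν - ∫ x, h x * ψ x ∂ν - M * Real.log M := by
      rw [integral_sub (f := fun x => h x * Real.log (h x) - h x * ψ x) (hlog.sub hψi)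
        (hi.mul_const _), integral_sub hlog hψi, integral_mul_const]
    have e2 : ∫ x, h x - M * Real.exp (ψ x) ∂ν = M - M * ∫ x, Real.exp (ψ x) ∂ν := by
      rw [integral_sub hi (hei.const_mul M), integral_const_mul]
    simp only [Pi.sub_apply] at h5
    rw [e1, e2] at h5
    nlinarith

lemma integrable_mul_log_of_mem_Icc {h : E → ℝ} (hm : Measurable h) {a b : ℝ} (ha : 0 < a)
    (hab : ∀ x, h x ∈ Set.Icc a b) : Integrable (fun x => h x * Real.log (h x)) ν := by
  refine integrable_of_abs_le (B := b * (|Real.log a| + |Real.log b|))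
    (hm.mul (Real.measurable_log.comp hm)) fun x => ?_
  have h1 := hab x
  rw [abs_mul, abs_of_pos (ha.trans_le h1.1)]
  have h2 : Real.log a ≤ Real.log (h x) := Real.log_le_log ha h1.1
  have h3 : Real.log (h x) ≤ Real.log b := Real.log_le_log (ha.trans_le h1.1) h1.2
  have h4 : |Real.log (h x)| ≤ |Real.log a| + |Real.log b| :=
    abs_le.2 ⟨by linarith [neg_abs_le (Real.log a), abs_nonneg (Real.log b)],
      by linarith [le_abs_self (Real.log b), abs_nonneg (Real.log a)]⟩
  have : 0 ≤ b := (ha.trans_le (h1.1.trans h1.2)).le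
  gcongr
  exact h1.2

lemma entropyOf_nonneg {h : E → ℝ} (hh : ∀ x, 0 ≤ h x) (hi : Integrable h ν)
    (hlog : Integrable (fun x => h x * Real.log (h x)) ν) : 0 ≤ entropyOf ν h := by
  have := integral_mul_le_entropyOf (ψ := fun _ => 0) hh hi hlog measurable_const (K := 0)
    (by simp) (by simp)
  simpa using this

lemma integral_pos_of_mem_Icc {h : E → ℝ} (hm : Measurable h) {a b : ℝ} (ha : 0 < a)
    (hab : ∀ x, h x ∈ Set.Icc a b) : 0 < ∫ x, h x ∂ν := by
  have hi : Integrable h ν := integrable_of_abs_le (B := b) hm fun x => by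
    rw [abs_of_pos (ha.trans_le (hab x).1)]; exact (hab x).2
  calc 0 < a := ha
    _ = ∫ _, a ∂ν := by simp
    _ ≤ _ := integral_mono (integrable_const a) hi fun y => (hab y).1

/-- Logarithms of normalized functions are admissible in the Gibbs variational principle. -/
lemma log_div_integral_admissible {h : E → ℝ} (hm : Measurable h) {a b : ℝ} (ha : 0 < a)
    (hab : ∀ x, h x ∈ Set.Icc a b) :
    Measurable (fun x => Real.log (h x / ∫ y, h y ∂ν)) ∧
      (∀ x, |Real.log (h x / ∫ y, h y ∂ν)| ≤ Real.log (b / a)) ∧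
      ∫ x, Real.exp (Real.log (h x / ∫ y, h y ∂ν)) ∂ν ≤ 1 := by
  have hpos : ∀ x, 0 < h x := fun x => ha.trans_le (hab x).1
  have hi : Integrable h ν := integrable_of_abs_le (B := b) hm fun x => by
    rw [abs_of_pos (hpos x)]; exact (hab x).2
  have hMpos := integral_pos_of_mem_Icc (ν := ν) hm ha hab
  set M := ∫ x, h x ∂ν with hM
  have hMa : a ≤ M := by
    calc a = ∫ _, a ∂ν := by simp
      _ ≤ _ := integral_mono (integrable_const a) hi fun y => (hab y).1
  have hMb : M ≤ b := by
    calc M ≤ ∫ _, b ∂ν := integral_mono hi (integrable_const b) fun y => (hab y).2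
      _ = b := by simp
  have hbpos : 0 < b := hMpos.trans_le hMb
  refine ⟨Real.measurable_log.comp (hm.div_const M), fun x => ?_, ?_⟩
  · have h1 := hab x
    rw [abs_le]
    constructor
    · rw [← Real.log_inv, inv_div]
      refine Real.log_le_log (by positivity) ?_
      rw [div_le_div_iff₀ hbpos hMpos]
      exact mul_le_mul h1.1 hMb hMpos.le (hpos x).le
    · refine Real.log_le_log (by have := hpos x; positivity) ?_
      rw [div_le_div_iff₀ hMpos ha]
      exact mul_le_mul h1.2 hMa ha.le hbpos.le
  · have : ∀ x, Real.exp (Real.log (h x / M)) = h x / M := fun x =>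
      Real.exp_log (div_pos (hpos x) hMpos)
    simp_rw [this]
    rw [integral_div, ← hM, div_self hMpos.ne']

/-- The optimal test function in the Gibbs variational principle for a function with values
in `[a, b]`, `a > 0`. -/
lemma exists_entropyOf_eq_integral {h : E → ℝ} (hm : Measurable h) {a b : ℝ} (ha : 0 < a)
    (hab : ∀ x, h x ∈ Set.Icc a b) :
    ∃ ψ : E → ℝ, Measurable ψ ∧ (∀ x, |ψ x| ≤ Real.log (b / a)) ∧ ∫ x, Real.exp (ψ x) ∂ν ≤ 1 ∧
      entropyOf ν h = ∫ x, h x * ψ x ∂ν := by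
  have hpos : ∀ x, 0 < h x := fun x => ha.trans_le (hab x).1
  have hi : Integrable h ν := integrable_of_abs_le (B := b) hm fun x => by
    rw [abs_of_pos (hpos x)]; exact (hab x).2
  have hMpos := integral_pos_of_mem_Icc (ν := ν) hm ha hab
  obtain ⟨h1, h2, h3⟩ := log_div_integral_admissible (ν := ν) hm ha hab
  refine ⟨_, h1, h2, h3, ?_⟩
  rw [entropyOf]
  set M := ∫ x, h x ∂ν with hM
  have : ∀ x, h x * Real.log (h x / M) = h x * Real.log (h x) - h x * Real.log M := fun x => by
    rw [Real.log_div (hpos x).ne' hMpos.ne']; ring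
  simp_rw [this]
  rw [integral_sub (integrable_mul_log_of_mem_Icc hm ha hab) (hi.mul_const _),
    integral_mul_const]

/-- The entropy of `v²` dominates the variance of `v`; test function `log (v / ∫ v)`. -/
lemma variance_le_entropyOf_sq {v : E → ℝ} (hm : Measurable v) {a b : ℝ} (ha : 0 < a)
    (hab : ∀ x, v x ∈ Set.Icc a b) :
    ∫ x, v x ^ 2 ∂ν - (∫ x, v x ∂ν) ^ 2 ≤ entropyOf ν (fun x => v x ^ 2) := by
  have hpos : ∀ x, 0 < v x := fun x => ha.trans_le (hab x).1
  have hi : Integrable v ν := integrable_of_abs_le (B := b) hm fun x => by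
    rw [abs_of_pos (hpos x)]; exact (hab x).2
  have hab2 : ∀ x, v x ^ 2 ∈ Set.Icc (a ^ 2) (b ^ 2) := fun x =>
    ⟨pow_le_pow_left₀ ha.le (hab x).1 2, pow_le_pow_left₀ (hpos x).le (hab x).2 2⟩
  have hi2 : Integrable (fun x => v x ^ 2) ν :=
    integrable_of_abs_le (B := b ^ 2) (hm.pow_const 2) fun x => by
      rw [abs_of_pos (pow_pos (hpos x) 2)]; exact (hab2 x).2
  have hlog := integrable_mul_log_of_mem_Icc (ν := ν) (hm.pow_const 2) (pow_pos ha 2) hab2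
  have hMpos := integral_pos_of_mem_Icc (ν := ν) hm ha hab
  obtain ⟨hψm, hψK, hψe⟩ := log_div_integral_admissible (ν := ν) hm ha hab
  have h1 := integral_mul_le_entropyOf (fun x => sq_nonneg (v x)) hi2 hlog hψm hψK hψe
  refine le_trans ?_ h1
  set M := ∫ x, v x ∂ν with hM
  have h2 : ∀ x, v x ^ 2 - M * v x ≤ v x ^ 2 * Real.log (v x / M) := by
    intro x
    have h3 := Real.one_sub_inv_le_log_of_pos (div_pos (hpos x) hMpos)
    rw [inv_div] at h3
    have h4 := mul_le_mul_of_nonneg_left h3 (sq_nonneg (v x))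
    have h5 : v x ^ 2 * (1 - M / v x) = v x ^ 2 - M * v x := by
      have := (hpos x).ne'
      field_simp
    rwa [h5] at h4
  have h3 := integral_mono (hi2.sub (hi.const_mul M))
    (hi2.mul_bdd (c := Real.log (b / a)) hψm.aestronglyMeasurable (ae_of_all _ hψK)) h2
  simp only [Pi.sub_apply] at h3
  rw [integral_sub hi2 (hi.const_mul M), integral_const_mul, ← hM] at h3
  rw [pow_two M]
  exact h3

/-- The log-Sobolev inequality extends from the domain of the generator to the closed form. -/
lemma MarkovSemigroup.LogSobolev.entropyOf_le_dirichlet {Q : MarkovSemigroup E} {c : ℝ}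
    (hLS : Q.LogSobolev ν c) (hc : 0 < c) {v : E → ℝ} (hm : Measurable v) {a b : ℝ} (ha : 0 < a)
    (hab : ∀ x, v x ∈ Set.Icc a b) :
    ENNReal.ofReal (entropyOf ν (fun x => v x ^ 2)) ≤ ENNReal.ofReal c * Q.dirichlet ν v := by
  by_cases htop : Q.dirichlet ν v = ∞
  · rw [htop, ENNReal.mul_top (by simpa using hc)]
    exact le_top
  have hpos : ∀ x, 0 < v x := fun x => ha.trans_le (hab x).1
  have hab2 : ∀ x, v x ^ 2 ∈ Set.Icc (a ^ 2) (b ^ 2) := fun x =>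
    ⟨pow_le_pow_left₀ ha.le (hab x).1 2, pow_le_pow_left₀ (hpos x).le (hab x).2 2⟩
  obtain ⟨ψ, hψm, hψK, hψe, hEnt⟩ :=
    exists_entropyOf_eq_integral (ν := ν) (hm.pow_const 2) (pow_pos ha 2) hab2
  set K := Real.log (b ^ 2 / a ^ 2)
  have hvb : ∀ x, |v x| ≤ b := fun x => by rw [abs_of_pos (hpos x)]; exact (hab x).2
  have hE : Nonempty E := by
    by_contra hE
    rw [not_nonempty_iff] at hE
    have := measure_univ (μ := ν)
    rw [Set.eq_empty_of_isEmpty (Set.univ : Set E)] at this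
    simp at this
  have hb : 0 ≤ b := (abs_nonneg _).trans (hvb hE.some)
  have hK0 : 0 ≤ K := (abs_nonneg _).trans (hψK hE.some)
  have hv2 : MemLp v 2 ν := memLp_two_of_bound hm hvb
  set D := (Q.dirichlet ν v).toReal with hD
  have hD0 : 0 ≤ D := ENNReal.toReal_nonneg
  have key : ∀ ρ : ℝ, 0 < ρ →
      entropyOf ν (fun x => v x ^ 2) ≤ c * (D + ρ) + K * (ρ ^ 2 + 2 * b * ρ) := by
    intro ρ hρ
    have h1 : ⨅ (u : E → ℝ) (g : E → ℝ) (_ : Q.IsGen ν u g)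
        (_ : eLpNorm (fun x => u x - v x) 2 ν < ENNReal.ofReal ρ),
        ENNReal.ofReal (-∫ x, u x * g x ∂ν) ≤ Q.dirichlet ν v := by
      rw [MarkovSemigroup.dirichlet]
      exact le_iSup₂_of_le (ENNReal.ofReal ρ) (ENNReal.ofReal_pos.2 hρ) le_rfl
    have h2 : Q.dirichlet ν v < ENNReal.ofReal (D + ρ) := by
      rw [← ENNReal.ofReal_toReal htop, ENNReal.ofReal_lt_ofReal_iff (by positivity)]
      linarith
    have h3 := h1.trans_lt h2
    simp only [iInf_lt_iff] at h3
    obtain ⟨u, g, hug, hd, h4⟩ := h3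
    have h5 : -∫ x, u x * g x ∂ν < D + ρ := (ENNReal.ofReal_lt_ofReal_iff (by positivity)).1 h4
    obtain ⟨h6, h7⟩ := hLS u g hug
    have hu2 : MemLp u 2 ν := hug.1
    have hdm : MemLp (fun x => u x - v x) 2 ν := hu2.sub hv2
    have h8 := integral_sq_le_of_eLpNorm hdm hρ.le hd.le
    have h9 := integral_abs_le_of_sq hdm hρ.le h8
    have h10 := integral_mul_le_entropyOf (fun x => sq_nonneg (u x)) hu2.integrable_sq h6 hψm hψK hψe
    have hiv : Integrable (fun x => v x ^ 2 * ψ x) ν :=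
      hv2.integrable_sq.mul_bdd (c := K) hψm.aestronglyMeasurable (ae_of_all _ hψK)
    have hiu : Integrable (fun x => u x ^ 2 * ψ x) ν :=
      hu2.integrable_sq.mul_bdd (c := K) hψm.aestronglyMeasurable (ae_of_all _ hψK)
    have hid : Integrable (fun x => |u x - v x|) ν := (hdm.integrable (by norm_num)).abs
    have h11 : ∫ x, v x ^ 2 * ψ x ∂ν - ∫ x, u x ^ 2 * ψ x ∂ν ≤ K * (ρ ^ 2 + 2 * b * ρ) := by
      rw [← integral_sub hiv hiu]
      calc ∫ x, v x ^ 2 * ψ x - u x ^ 2 * ψ x ∂ν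
          ≤ ∫ x, K * ((u x - v x) ^ 2 + 2 * b * |u x - v x|) ∂ν := by
            refine integral_mono (hiv.sub hiu)
              ((hdm.integrable_sq.add (hid.const_mul _)).const_mul _) fun x => ?_
            have e1 : v x ^ 2 * ψ x - u x ^ 2 * ψ x
                = -((u x - v x) ^ 2 + 2 * v x * (u x - v x)) * ψ x := by ring
            simp only
            rw [e1]
            refine (le_abs_self _).trans ?_
            rw [abs_mul, abs_neg, mul_comm]
            refine mul_le_mul (hψK x) ?_ (abs_nonneg _) hK0
            refine (abs_add_le _ _).trans ?_
            rw [abs_of_nonneg (sq_nonneg _), abs_mul, abs_mul, abs_two]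
            have := hvb x
            gcongr
        _ = K * (∫ x, (u x - v x) ^ 2 ∂ν + 2 * b * ∫ x, |u x - v x| ∂ν) := by
            rw [integral_const_mul, integral_add hdm.integrable_sq (hid.const_mul _),
              integral_const_mul]
        _ ≤ _ := by gcongr
    have h12 : c * (-∫ x, u x * g x ∂ν) ≤ c * (D + ρ) := mul_le_mul_of_nonneg_left h5.le hc.le
    rw [hEnt]
    linarith
  have hlim : entropyOf ν (fun x => v x ^ 2) ≤ c * D := by
    have h1 : Tendsto (fun ρ : ℝ => c * (D + ρ) + K * (ρ ^ 2 + 2 * b * ρ)) (𝓝[>] 0)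
        (𝓝 (c * (D + 0) + K * (0 ^ 2 + 2 * b * 0))) := by
      refine Tendsto.mono_left ?_ nhdsWithin_le_nhds
      exact Continuous.tendsto (by fun_prop) 0
    have h2 := ge_of_tendsto h1 (by
      filter_upwards [self_mem_nhdsWithin] with ρ hρ using key ρ hρ)
    simpa using h2
  calc ENNReal.ofReal (entropyOf ν (fun x => v x ^ 2)) ≤ ENNReal.ofReal (c * D) :=
        ENNReal.ofReal_le_ofReal hlim
    _ = ENNReal.ofReal c * Q.dirichlet ν v := by
        rw [ENNReal.ofReal_mul hc.le, ENNReal.ofReal_toReal htop]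

end Entropy

/-! ### Entropy inequality for a mixture -/

section Mixture

open scoped InnerProductSpace

/-- A reversible Markov semigroup whose stationary distribution `μ` is a mixture of distributions
`ν i` that satisfy log-Sobolev inequalities with constants at most `C`, relative to Dirichlet forms
whose mixture is dominated by the Dirichlet form of `P`. -/
structure MixtureLevel {E : Type*} [MeasurableSpace E] (P : MarkovSemigroup E) (μ : Measure E)
    {m : ℕ} (w : Fin m → ℝ) (ν : Fin m → Measure E) (C : ℝ) : Prop where
  stationary : P.HasStationary μ
  reversible : ∀ s, (P.kernel s).IsReversible μ
  weight_pos : ∀ i, 0 < w i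
  weight_sum : ∑ i, w i = 1
  mixture : μ = ∑ i, ENNReal.ofReal (w i) • ν i
  local_logSobolev : ∃ (Q : Fin m → MarkovSemigroup E) (c : Fin m → ℝ),
    (∀ i, 0 < c i ∧ c i ≤ C ∧ (Q i).LogSobolev (ν i) (c i)) ∧
      ∀ f g : E → ℝ, P.IsGen μ f g →
        ∑ i, ENNReal.ofReal (w i) * (Q i).dirichlet (ν i) f
          ≤ ENNReal.ofReal (-∫ x, f x * g x ∂μ)

variable {E : Type*} [MeasurableSpace E] {P : MarkovSemigroup E} {μ : Measure E} {m : ℕ}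
  {w : Fin m → ℝ} {ν : Fin m → Measure E} {C : ℝ}
  [IsProbabilityMeasure μ] [∀ i, IsProbabilityMeasure (ν i)]

namespace MixtureLevel

lemma const_pos (hL : MixtureLevel P μ w ν C) : 0 < C := by
  obtain ⟨Q, c, h, -⟩ := hL.local_logSobolev
  rcases Nat.eq_zero_or_pos m with rfl | hm
  · have := hL.weight_sum
    simp at this
  · exact (h ⟨0, hm⟩).1.trans_le (h ⟨0, hm⟩).2.1

lemma integrable_component (hL : MixtureLevel P μ w ν C) {φ : E → ℝ} (hφ : Integrable φ μ)
    (i : Fin m) : Integrable φ (ν i) := by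
  rw [hL.mixture, integrable_finsetSum_measure] at hφ
  have h1 := hφ i (Finset.mem_univ i)
  rwa [integrable_smul_measure (by simpa using hL.weight_pos i) ENNReal.ofReal_ne_top] at h1

lemma integral_eq (hL : MixtureLevel P μ w ν C) {φ : E → ℝ} (hφ : Integrable φ μ) :
    ∫ x, φ x ∂μ = ∑ i, w i * ∫ x, φ x ∂(ν i) := by
  have h1 := hφ
  rw [hL.mixture, integrable_finsetSum_measure] at h1
  conv_lhs => rw [hL.mixture]
  rw [integral_finsetSum_measure h1]
  refine Finset.sum_congr rfl fun i _ => ?_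
  rw [integral_smul_measure, ENNReal.toReal_ofReal (hL.weight_pos i).le, smul_eq_mul]

lemma sum_entropyOf_le_of_isGen (hL : MixtureLevel P μ w ν C) {f g : E → ℝ} (hm : Measurable f)
    {a b : ℝ} (ha : 0 < a) (hab : ∀ x, f x ∈ Set.Icc a b) (hfg : P.IsGen μ f g) {e : ℝ}
    (he0 : 0 ≤ e) (he : -∫ x, f x * g x ∂μ ≤ e) :
    ∑ i, w i * entropyOf (ν i) (fun x => f x ^ 2) ≤ C * e := by
  obtain ⟨Q, c, hc, hD⟩ := hL.local_logSobolev
  have hpos : ∀ x, 0 < f x := fun x => ha.trans_le (hab x).1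
  have hab2 : ∀ x, f x ^ 2 ∈ Set.Icc (a ^ 2) (b ^ 2) := fun x =>
    ⟨pow_le_pow_left₀ ha.le (hab x).1 2, pow_le_pow_left₀ (hpos x).le (hab x).2 2⟩
  have hnn : ∀ i, 0 ≤ entropyOf (ν i) (fun x => f x ^ 2) := fun i =>
    entropyOf_nonneg (fun x => sq_nonneg _)
      (integrable_of_abs_le (B := b ^ 2) (hm.pow_const 2) fun x => by
        rw [abs_of_pos (pow_pos (hpos x) 2)]; exact (hab2 x).2)
      (integrable_mul_log_of_mem_Icc (hm.pow_const 2) (pow_pos ha 2) hab2)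
  have h1 : ENNReal.ofReal (∑ i, w i * entropyOf (ν i) (fun x => f x ^ 2))
      ≤ ENNReal.ofReal (C * e) := by
    rw [ENNReal.ofReal_sum_of_nonneg fun i _ => mul_nonneg (hL.weight_pos i).le (hnn i)]
    calc ∑ i, ENNReal.ofReal (w i * entropyOf (ν i) (fun x => f x ^ 2))
        ≤ ∑ i, ENNReal.ofReal C * (ENNReal.ofReal (w i) * (Q i).dirichlet (ν i) f) := by
          refine Finset.sum_le_sum fun i _ => ?_
          rw [ENNReal.ofReal_mul (hL.weight_pos i).le, mul_left_comm]
          gcongr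
          refine ((hc i).2.2.entropyOf_le_dirichlet (hc i).1 hm ha hab).trans ?_
          gcongr
          exact (hc i).2.1
      _ = ENNReal.ofReal C * ∑ i, ENNReal.ofReal (w i) * (Q i).dirichlet (ν i) f := by
          rw [Finset.mul_sum]
      _ ≤ ENNReal.ofReal C * ENNReal.ofReal e := by
          gcongr
          exact (hD f g hfg).trans (ENNReal.ofReal_le_ofReal he)
      _ = ENNReal.ofReal (C * e) := by rw [ENNReal.ofReal_mul hL.const_pos.le]
  exact (ENNReal.ofReal_le_ofReal_iff (mul_nonneg hL.const_pos.le he0)).1 h1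

/-- The difference quotient `h⁻¹ ⟨v, v - P_h v⟩`; it increases to the Dirichlet form of `v` as
`h ↓ 0`. -/
noncomputable def _root_.MarkovSemigroup.energyQuotient (P : MarkovSemigroup E) (μ : Measure E)
    (h : ℝ≥0) (v : E → ℝ) : ℝ :=
  (h : ℝ)⁻¹ * ∫ x, v x * (v x - P.act h v x) ∂μ

lemma _root_.MarkovSemigroup.energyQuotient_eq_inner (hS : P.HasStationary μ) (h : ℝ≥0) {v : E → ℝ}
    (hv : MemLp v 2 μ) : P.energyQuotient μ h v
      = (h : ℝ)⁻¹ * ⟪hv.toLp v, hv.toLp v - P.l2 hS h (hv.toLp v)⟫_ℝ := by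
  rw [MarkovSemigroup.energyQuotient, MarkovSemigroup.l2_toLp, ← MemLp.toLp_sub, inner_toLp]
  rfl

/-- The average `h⁻¹ ∫₀ʰ P_s v ds` of a bounded function as a bounded function in the domain of the
generator. -/
lemma _root_.MarkovSemigroup.exists_average (hS : P.HasStationary μ)
    (hR : ∀ s, (P.kernel s).IsReversible μ) {v : E → ℝ}
    (hm : Measurable v) {a b : ℝ} (hab : ∀ x, v x ∈ Set.Icc a b) (hv : MemLp v 2 μ)
    {h : ℝ≥0} (hh : 0 < h) :
    ∃ (f g : E → ℝ) (hf : MemLp f 2 μ) (hg : MemLp g 2 μ), Measurable f ∧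
      (∀ x, f x ∈ Set.Icc a b) ∧
      hf.toLp f = orbitAverage (P.l2 hS) h (hv.toLp v) ∧
      P.IsGen μ f g ∧ -∫ x, f x * g x ∂μ ≤ P.energyQuotient μ h v ∧
      Tendsto (fun t : ℝ≥0 => (t : ℝ)⁻¹ • (P.l2 hS t (hf.toLp f) - hf.toLp f)) (𝓝[>] 0)
        (𝓝 (hg.toLp g)) := by
  have hT := P.isSymmSemigroup hS hR
  have hh' : (0 : ℝ) < h := by exact_mod_cast hh
  set A := orbitAverage (P.l2 hS) h (hv.toLp v) with hA
  have hmem := orbitAverage_mem_Icc hS hR hm hv hab hh'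
  rw [← hA] at hmem
  have hAm : Measurable A := (Lp.stronglyMeasurable A).measurable
  set f : E → ℝ := fun x => max a (min b (A x)) with hf
  have hE : Nonempty E := by
    by_contra hE
    rw [not_nonempty_iff] at hE
    have := measure_univ (μ := μ)
    rw [Set.eq_empty_of_isEmpty (Set.univ : Set E)] at this
    simp at this
  have hab' : a ≤ b := (hab hE.some).1.trans (hab hE.some).2
  have hfA : f =ᵐ[μ] A := by
    filter_upwards [hmem] with x hx
    simp only [hf]
    rw [min_eq_right hx.2, max_eq_right hx.1]
  have hf2 : MemLp f 2 μ := (Lp.memLp A).ae_eq hfA.symm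
  have hfL : hf2.toLp f = A := by
    rw [← Lp.toLp_coeFn A (Lp.memLp A), MemLp.toLp_eq_toLp_iff]
    exact hfA
  set G : Lp ℝ 2 μ := (h : ℝ)⁻¹ • (P.l2 hS h (hv.toLp v) - hv.toLp v) with hG
  have hGL : (Lp.memLp G).toLp G = G := Lp.toLp_coeFn G (Lp.memLp G)
  have hgen := hT.tendsto_generator_orbitAverage hh' (hv.toLp v)
  rw [Real.toNNReal_coe, ← hA, ← hG] at hgen
  have hgen2 : Tendsto (fun t : ℝ≥0 => (t : ℝ)⁻¹ • (P.l2 hS t (hf2.toLp f) - hf2.toLp f)) (𝓝[>] 0)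
        (𝓝 ((Lp.memLp G).toLp G)) := by
    rw [hGL, hfL]; exact hgen
  refine ⟨f, G, hf2, Lp.memLp G, measurable_const.max (measurable_const.min hAm),
    fun x => ⟨le_max_left _ _, max_le hab' (min_le_left _ _)⟩, hfL,
    P.isGen_of_tendsto hS hf2 (Lp.memLp G) hgen2, ?_, hgen2⟩
  have h1 := hT.orbitAverage_energy_le hh' (hv.toLp v)
  rw [Real.toNNReal_coe, ← hA, ← hG, ← P.energyQuotient_eq_inner, ← hfL, ← hGL, inner_toLp] at h1
  exact h1

lemma _root_.MarkovSemigroup.energyQuotient_nonneg (hS : P.HasStationary μ)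
    (hR : ∀ s, (P.kernel s).IsReversible μ) {v : E → ℝ} (hv : MemLp v 2 μ) (h : ℝ≥0) :
    0 ≤ P.energyQuotient μ h v := by
  rw [P.energyQuotient_eq_inner hS h hv]
  have := (P.isSymmSemigroup hS hR).inner_sub_nonneg h (hv.toLp v)
  positivity

/-- The averaged entropy of the components is bounded by the Dirichlet form of the mixture, where
the latter is replaced by a lower limit of difference quotients so that `v` need not be in the
domain of the generator. -/
theorem sum_entropyOf_le (hL : MixtureLevel P μ w ν C) {v : E → ℝ} (hm : Measurable v)
    {a b : ℝ} (ha : 0 < a) (hab : ∀ x, v x ∈ Set.Icc a b) {e : ℝ}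
    (he : ∃ᶠ h : ℝ≥0 in 𝓝[>] 0, P.energyQuotient μ h v ≤ e) :
    ∑ i, w i * entropyOf (ν i) (fun x => v x ^ 2) ≤ C * e := by
  have hS := hL.stationary
  have hR := hL.reversible
  have hT := P.isSymmSemigroup hS hR
  have hE : Nonempty E := by
    by_contra hE
    rw [not_nonempty_iff] at hE
    have := measure_univ (μ := μ)
    rw [Set.eq_empty_of_isEmpty (Set.univ : Set E)] at this
    simp at this
  have hpos : ∀ x, 0 < v x := fun x => ha.trans_le (hab x).1
  have hb : 0 < b := (hpos hE.some).trans_le (hab hE.some).2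
  have hvb : ∀ x, |v x| ≤ b := fun x => by rw [abs_of_pos (hpos x)]; exact (hab x).2
  have hab2 : ∀ x, v x ^ 2 ∈ Set.Icc (a ^ 2) (b ^ 2) := fun x =>
    ⟨pow_le_pow_left₀ ha.le (hab x).1 2, pow_le_pow_left₀ (hpos x).le (hab x).2 2⟩
  have hv2 : MemLp v 2 μ := memLp_two_of_bound hm hvb
  have hψ := fun i => exists_entropyOf_eq_integral (ν := ν i) (hm.pow_const 2) (pow_pos ha 2) hab2
  choose ψ hψm hψK hψe hEnt using hψ
  set K := Real.log (b ^ 2 / a ^ 2)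
  have hK0 : 0 ≤ K := by
    rcases Nat.eq_zero_or_pos m with h0 | hmpos
    · subst h0
      have := hL.weight_sum
      simp at this
    · exact (abs_nonneg _).trans (hψK ⟨0, hmpos⟩ hE.some)
  -- the inequality for the averages of `v`, up to their distance to `v`
  have key : ∀ ρ : ℝ, 0 < ρ →
      ∑ i, w i * entropyOf (ν i) (fun x => v x ^ 2) ≤ C * e + K * (2 * b * ρ) := by
    intro ρ hρ
    have h1 : ∀ᶠ h : ℝ≥0 in 𝓝[>] 0, dist (orbitAverage (P.l2 hS) h (hv2.toLp v)) (hv2.toLp v) < ρ := by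
      have h2 : Tendsto (fun t : ℝ≥0 => (t : ℝ)) (𝓝[>] 0) (𝓝[>] 0) := by
        refine tendsto_nhdsWithin_iff.2 ⟨?_, ?_⟩
        · have : Tendsto (fun t : ℝ≥0 => (t : ℝ)) (𝓝 0) (𝓝 ((0 : ℝ≥0) : ℝ)) :=
            NNReal.continuous_coe.tendsto 0
          rw [NNReal.coe_zero] at this
          exact this.mono_left nhdsWithin_le_nhds
        · filter_upwards [self_mem_nhdsWithin] with t ht
          exact_mod_cast ht
      exact ((hT.tendsto_orbitAverage (hv2.toLp v)).comp h2).eventually (Metric.ball_mem_nhds _ hρ)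
    obtain ⟨h, hhe, hhd, hh0⟩ := (he.and_eventually (h1.and self_mem_nhdsWithin)).exists
    have hh0 : 0 < h := hh0
    obtain ⟨f, g, hf, hg, hfm, hfab, hfA, hgen, hen, -⟩ := P.exists_average hS hR hm hab hv2 hh0
    have h2 := hL.sum_entropyOf_le_of_isGen hfm ha hfab hgen
      (P.energyQuotient_nonneg hS hR hv2 h) hen
    have hfpos : ∀ x, 0 < f x := fun x => ha.trans_le (hfab x).1
    have hfb : ∀ x, |f x| ≤ b := fun x => by rw [abs_of_pos (hfpos x)]; exact (hfab x).2
    have hfab2 : ∀ x, f x ^ 2 ∈ Set.Icc (a ^ 2) (b ^ 2) := fun x =>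
      ⟨pow_le_pow_left₀ ha.le (hfab x).1 2, pow_le_pow_left₀ (hfpos x).le (hfab x).2 2⟩
    have hdm : MemLp (fun x => v x - f x) 2 μ := hv2.sub hf
    have hdi : Integrable (fun x => |v x - f x|) μ := (hdm.integrable (by norm_num)).abs
    have hd1 : ∫ x, |v x - f x| ∂μ ≤ ρ := by
      refine integral_abs_le_of_sq hdm hρ.le ?_
      have e1 : hdm.toLp _ = hv2.toLp v - hf.toLp f := rfl
      rw [← norm_toLp_sq hdm, e1, hfA, ← dist_eq_norm, dist_comm]
      exact pow_le_pow_left₀ dist_nonneg hhd.le 2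
    have hcomp : ∀ i, entropyOf (ν i) (fun x => v x ^ 2)
        ≤ entropyOf (ν i) (fun x => f x ^ 2) + K * (2 * b) * ∫ x, |v x - f x| ∂(ν i) := by
      intro i
      have hif : Integrable (fun x => f x ^ 2) (ν i) :=
        integrable_of_abs_le (B := b ^ 2) (hfm.pow_const 2) fun x => by
          rw [abs_of_pos (pow_pos (hfpos x) 2)]; exact (hfab2 x).2
      have hiv : Integrable (fun x => v x ^ 2) (ν i) :=
        integrable_of_abs_le (B := b ^ 2) (hm.pow_const 2) fun x => by
          rw [abs_of_pos (pow_pos (hpos x) 2)]; exact (hab2 x).2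
      have h3 := integral_mul_le_entropyOf (fun x => sq_nonneg (f x)) hif
        (integrable_mul_log_of_mem_Icc (hfm.pow_const 2) (pow_pos ha 2) hfab2)
        (hψm i) (hψK i) (hψe i)
      have hifψ := hif.mul_bdd (c := K) (hψm i).aestronglyMeasurable (ae_of_all _ (hψK i))
      have hivψ := hiv.mul_bdd (c := K) (hψm i).aestronglyMeasurable (ae_of_all _ (hψK i))
      have h4 : ∫ x, v x ^ 2 * ψ i x ∂(ν i) - ∫ x, f x ^ 2 * ψ i x ∂(ν i)
          ≤ K * (2 * b) * ∫ x, |v x - f x| ∂(ν i) := by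
        rw [← integral_sub hivψ hifψ, ← integral_const_mul]
        refine integral_mono (hivψ.sub hifψ) ((hL.integrable_component hdi i).const_mul _)
          fun x => ?_
        have e1 : v x ^ 2 * ψ i x - f x ^ 2 * ψ i x = ψ i x * (v x + f x) * (v x - f x) := by ring
        simp only
        rw [e1]
        refine (le_abs_self _).trans ?_
        rw [abs_mul, abs_mul]
        have h5 : |v x + f x| ≤ 2 * b := (abs_add_le _ _).trans (by linarith [hvb x, hfb x])
        gcongr
        exact hψK i x
      rw [hEnt i]
      linarith
    calc ∑ i, w i * entropyOf (ν i) (fun x => v x ^ 2)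
        ≤ ∑ i, w i * (entropyOf (ν i) (fun x => f x ^ 2)
            + K * (2 * b) * ∫ x, |v x - f x| ∂(ν i)) := by
          refine Finset.sum_le_sum fun i _ => ?_
          exact mul_le_mul_of_nonneg_left (hcomp i) (hL.weight_pos i).le
      _ = ∑ i, w i * entropyOf (ν i) (fun x => f x ^ 2)
            + K * (2 * b) * ∫ x, |v x - f x| ∂μ := by
          rw [hL.integral_eq hdi, Finset.mul_sum, ← Finset.sum_add_distrib]
          refine Finset.sum_congr rfl fun i _ => ?_
          ring
      _ ≤ C * e + K * (2 * b) * ρ := by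
          refine add_le_add (h2.trans ?_) ?_
          · exact mul_le_mul_of_nonneg_left hhe hL.const_pos.le
          · gcongr
      _ = _ := by ring
  have h1 : Tendsto (fun ρ : ℝ => C * e + K * (2 * b * ρ)) (𝓝[>] 0)
      (𝓝 (C * e + K * (2 * b * 0))) := by
    refine Tendsto.mono_left ?_ nhdsWithin_le_nhds
    exact Continuous.tendsto (by fun_prop) 0
  have h2 := ge_of_tendsto h1 (by
    filter_upwards [self_mem_nhdsWithin] with ρ hρ using key ρ hρ)
  simpa using h2

end MixtureLevel

end Mixture

/-! ### Contraction of `L²` norms towards the means over the components -/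

section Contraction

open scoped InnerProductSpace

variable {E : Type*} [MeasurableSpace E] {P : MarkovSemigroup E} {μ : Measure E} {m : ℕ}
  {w : Fin m → ℝ} {ν : Fin m → Measure E} {C : ℝ}
  [IsProbabilityMeasure μ] [∀ i, IsProbabilityMeasure (ν i)]

lemma MarkovSemigroup.measurable_act (P : MarkovSemigroup E) (t : ℝ≥0) {f : E → ℝ}
    (hf : Measurable f) : Measurable (P.act t f) :=
  (StronglyMeasurable.integral_kernel (κ := P.kernel t) hf.stronglyMeasurable).measurable

lemma MarkovSemigroup.act_mem_Icc (P : MarkovSemigroup E) (t : ℝ≥0) {a b : ℝ} {f : E → ℝ}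
    (hf : Measurable f) (h : ∀ x, f x ∈ Set.Icc a b) (x : E) : P.act t f x ∈ Set.Icc a b :=
  _root_.act_mem_Icc _ hf h x

lemma MarkovSemigroup.abs_act_le (P : MarkovSemigroup E) (t : ℝ≥0) {B : ℝ} {f : E → ℝ}
    (hf : Measurable f) (h : ∀ x, |f x| ≤ B) (x : E) : |P.act t f x| ≤ B :=
  abs_le.2 (P.act_mem_Icc t hf (fun y => abs_le.1 (h y)) x)

lemma MarkovSemigroup.abs_act_le_act_abs (P : MarkovSemigroup E) (t : ℝ≥0) (f : E → ℝ) (x : E) :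
    |P.act t f x| ≤ P.act t (fun y => |f y|) x :=
  abs_integral_le_integral_abs

lemma MarkovSemigroup.integral_act (hS : P.HasStationary μ) (t : ℝ≥0) {f : E → ℝ}
    (hf : Integrable f μ) : ∫ x, P.act t f x ∂μ = ∫ x, f x ∂μ :=
  integral_integral_kernel (hS.invariant t) hf

lemma MarkovSemigroup.act_const_add_mul (P : MarkovSemigroup E) (t : ℝ≥0) {f : E → ℝ}
    (hf : Measurable f) {B : ℝ} (hB : ∀ x, |f x| ≤ B) (a c : ℝ) (x : E) :
    P.act t (fun y => a + c * f y) x = a + c * P.act t f x := by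
  have h1 : Integrable f (P.kernel t x) := integrable_of_abs_le hf hB
  simp only [MarkovSemigroup.act]
  rw [integral_add (integrable_const a) (h1.const_mul c), integral_const_mul]
  simp

namespace MixtureLevel

/-- `P_t u` has finite energy. Only the steps `h = 2 t / m` are controlled, hence the frequent bound. -/
lemma energyQuotient_act_le (hL : MixtureLevel P μ w ν C) {t : ℝ≥0} (ht : 0 < t) {u : E → ℝ}
    (hu : MemLp u 2 μ) :
    ∃ᶠ h : ℝ≥0 in 𝓝[>] 0, P.energyQuotient μ h (P.act t u) ≤ (∫ x, u x ^ 2 ∂μ) / (2 * t) := by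
  have hS := hL.stationary
  have hT := P.isSymmSemigroup hS hL.reversible
  have h1 : Tendsto (fun m : ℕ => 2 * t / ((m + 1 : ℕ) : ℝ≥0)) atTop (𝓝[>] 0) := by
    refine tendsto_nhdsWithin_iff.2 ⟨?_, Eventually.of_forall fun m => ?_⟩
    · exact (tendsto_const_div_atTop_nhds_zero_nat (2 * t)).comp (tendsto_add_atTop_nat 1)
    · simp only [Set.mem_Ioi]; positivity
  refine h1.frequently (Eventually.frequently (Eventually.of_forall fun m => ?_))
  have h2 := hT.energy_orbit_le ht (Nat.succ_pos m) (hu.toLp u)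
  rw [norm_toLp_sq, P.l2_toLp] at h2
  rw [P.energyQuotient_eq_inner hS _ (P.memLp_act hS t hu)]
  exact h2

/-- The Poincaré inequality on the components, applied to `P_t u`. -/
lemma sum_variance_act_le (hL : MixtureLevel P μ w ν C) {t : ℝ≥0} (ht : 0 < t) {u : E → ℝ}
    (hm : Measurable u) {B : ℝ} (hB : ∀ x, |u x| ≤ B) :
    ∑ i, w i * (∫ x, P.act t u x ^ 2 ∂(ν i) - (∫ x, P.act t u x ∂(ν i)) ^ 2)
      ≤ C * ((∫ x, u x ^ 2 ∂μ) / (2 * t)) := by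
  have hS := hL.stationary
  set z := P.act t u with hz
  have hzm : Measurable z := P.measurable_act t hm
  have hzB : ∀ x, |z x| ≤ B := P.abs_act_le t hm hB
  have hE : Nonempty E := by
    by_contra hE
    rw [not_nonempty_iff] at hE
    have := measure_univ (μ := μ)
    rw [Set.eq_empty_of_isEmpty (Set.univ : Set E)] at this
    simp at this
  have hB0 : 0 ≤ B := (abs_nonneg _).trans (hB hE.some)
  -- the entropy inequality is applied to a positive function of the form `1 + ε z`
  set ε : ℝ := 1 / (2 * (B + 1)) with hε
  have hεpos : 0 < ε := by positivity
  have hεz : ∀ x, |ε * z x| ≤ 1 / 2 := fun x => by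
    rw [abs_mul, abs_of_pos hεpos]
    calc ε * |z x| ≤ ε * (B + 1) := by gcongr; linarith [hzB x]
      _ = 1 / 2 := by rw [hε]; field_simp
  have hab : ∀ x, 1 + ε * z x ∈ Set.Icc (1 / 2 : ℝ) (3 / 2) := fun x => by
    have := abs_le.1 (hεz x)
    constructor <;> linarith
  have hvm : Measurable fun x => 1 + ε * z x := measurable_const.add (hzm.const_mul ε)
  have hz2 : MemLp z 2 μ := memLp_two_of_bound hzm hzB
  have hzi : Integrable z μ := integrable_of_abs_le hzm hzB
  have henergy : ∀ h : ℝ≥0, P.energyQuotient μ h (fun x => 1 + ε * z x)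
      = ε ^ 2 * P.energyQuotient μ h z := by
    intro h
    rw [MarkovSemigroup.energyQuotient, MarkovSemigroup.energyQuotient]
    have hPz := P.memLp_act hS h hz2
    have hPzi : Integrable (P.act h z) μ := hPz.integrable (by norm_num)
    have h1 : ∀ x, (1 + ε * z x) * (1 + ε * z x - P.act h (fun x => 1 + ε * z x) x)
        = ε * (z x - P.act h z x) + ε ^ 2 * (z x * (z x - P.act h z x)) := fun x => by
      rw [P.act_const_add_mul h hzm hzB]; ring
    simp_rw [h1]
    have h2 : Integrable (fun x => z x * (z x - P.act h z x)) μ :=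
      MemLp.integrable_mul (p := 2) (q := 2) hz2 (hz2.sub hPz)
    rw [integral_add (f := fun x => ε * (z x - P.act h z x)) ((hzi.sub hPzi).const_mul ε)
      (h2.const_mul _), integral_const_mul,
      integral_const_mul, integral_sub hzi hPzi, P.integral_act hS h hzi]
    ring
  have h1 := hL.sum_entropyOf_le hvm (by norm_num : (0 : ℝ) < 1 / 2) hab
    (e := ε ^ 2 * ((∫ x, u x ^ 2 ∂μ) / (2 * t))) (by
      refine (hL.energyQuotient_act_le ht (memLp_two_of_bound hm hB)).mono fun h hh => ?_
      rw [henergy]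
      exact mul_le_mul_of_nonneg_left hh (sq_nonneg ε))
  have h2 : ∀ i, ε ^ 2 * (∫ x, z x ^ 2 ∂(ν i) - (∫ x, z x ∂(ν i)) ^ 2)
      ≤ entropyOf (ν i) (fun x => (1 + ε * z x) ^ 2) := by
    intro i
    refine le_trans (le_of_eq ?_)
      (variance_le_entropyOf_sq hvm (by norm_num : (0 : ℝ) < 1 / 2) hab)
    have i1 : Integrable z (ν i) := integrable_of_abs_le hzm hzB
    have i2 : Integrable (fun x => z x ^ 2) (ν i) := (memLp_two_of_bound hzm hzB).integrable_sq
    have e1 : ∀ x, (1 + ε * z x) ^ 2 = 1 + 2 * ε * z x + ε ^ 2 * z x ^ 2 := fun x => by ring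
    simp_rw [e1]
    rw [integral_add (f := fun x => 1 + 2 * ε * z x) ((integrable_const _).add (i1.const_mul _))
      (i2.const_mul _), integral_add (integrable_const _) (i1.const_mul _),
      integral_add (integrable_const _) (i1.const_mul _)]
    simp only [integral_const_mul, integral_const, probReal_univ, smul_eq_mul, one_mul]
    ring
  have h3 : ε ^ 2 * ∑ i, w i * (∫ x, z x ^ 2 ∂(ν i) - (∫ x, z x ∂(ν i)) ^ 2)
      ≤ ε ^ 2 * (C * ((∫ x, u x ^ 2 ∂μ) / (2 * t))) := by
    rw [Finset.mul_sum]
    refine le_trans (Finset.sum_le_sum fun i _ => ?_) (h1.trans (le_of_eq (by ring)))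
    rw [mul_left_comm]
    exact mul_le_mul_of_nonneg_left (h2 i) (hL.weight_pos i).le
  exact le_of_mul_le_mul_left h3 (by positivity)

lemma sum_weight_abs_mean_le (hL : MixtureLevel P μ w ν C) (t : ℝ≥0) {u : E → ℝ}
    (hm : Measurable u) {B : ℝ} (hB : ∀ x, |u x| ≤ B) :
    ∑ i, w i * |∫ x, P.act t u x ∂(ν i)| ≤ ∫ x, |u x| ∂μ := by
  have hS := hL.stationary
  have hzm := P.measurable_act t hm
  have hzB := P.abs_act_le t hm hB
  have hui : Integrable (fun x => |u x|) μ := (integrable_of_abs_le hm hB).abs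
  have hzi : Integrable (fun x => |P.act t u x|) μ := (integrable_of_abs_le hzm hzB).abs
  have habs : ∀ x, |(fun y => |u y|) x| ≤ B := fun x => by simpa using hB x
  calc ∑ i, w i * |∫ x, P.act t u x ∂(ν i)| ≤ ∑ i, w i * ∫ x, |P.act t u x| ∂(ν i) := by
        refine Finset.sum_le_sum fun i _ => ?_
        exact mul_le_mul_of_nonneg_left abs_integral_le_integral_abs (hL.weight_pos i).le
    _ = ∫ x, |P.act t u x| ∂μ := (hL.integral_eq hzi).symm
    _ ≤ ∫ x, P.act t (fun y => |u y|) x ∂μ := by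
        refine integral_mono hzi ?_ fun x => P.abs_act_le_act_abs t u x
        exact integrable_of_abs_le (P.measurable_act t hm.abs) (P.abs_act_le t hm.abs habs)
    _ = ∫ x, |u x| ∂μ := P.integral_act hS t hui

lemma integral_act_sq_le_add (hL : MixtureLevel P μ w ν C) {t : ℝ≥0} (ht : 0 < t) {u : E → ℝ}
    (hm : Measurable u) {B : ℝ} (hB : ∀ x, |u x| ≤ B) :
    ∫ x, P.act t u x ^ 2 ∂μ ≤ C * ((∫ x, u x ^ 2 ∂μ) / (2 * t))
      + ∑ i, w i * (∫ x, P.act t u x ∂(ν i)) ^ 2 := by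
  have h1 := hL.sum_variance_act_le ht hm hB
  have hz2 : MemLp (P.act t u) 2 μ :=
    memLp_two_of_bound (P.measurable_act t hm) (P.abs_act_le t hm hB)
  rw [hL.integral_eq hz2.integrable_sq]
  simp_rw [mul_sub] at h1
  rw [Finset.sum_sub_distrib] at h1
  linarith

/-- One step of the semigroup contracts the `L²` norm, up to a multiple of the `L¹` norm: the
variance within the components is contracted, and the mean over a component of weight `w i` is
at most `‖u‖₁ / w i`. -/
lemma integral_act_sq_le (hL : MixtureLevel P μ w ν C) {t : ℝ≥0} (ht : 0 < t) {u : E → ℝ}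
    (hm : Measurable u) {B : ℝ} (hB : ∀ x, |u x| ≤ B) :
    ∫ x, P.act t u x ^ 2 ∂μ ≤ C * ((∫ x, u x ^ 2 ∂μ) / (2 * t))
      + (∑ i, 1 / w i) * (∫ x, |u x| ∂μ) ^ 2 := by
  refine (hL.integral_act_sq_le_add ht hm hB).trans (add_le_add_right ?_ _)
  have h1 := hL.sum_weight_abs_mean_le t hm hB
  rw [Finset.sum_mul]
  refine Finset.sum_le_sum fun i _ => ?_
  have hw := hL.weight_pos i
  have h2 : w i * |∫ x, P.act t u x ∂(ν i)| ≤ ∫ x, |u x| ∂μ :=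
    (Finset.single_le_sum (f := fun i => w i * |∫ x, P.act t u x ∂(ν i)|)
      (fun j _ => mul_nonneg (hL.weight_pos j).le (abs_nonneg _)) (Finset.mem_univ i)).trans h1
  have h3 := pow_le_pow_left₀ (mul_nonneg hw.le (abs_nonneg _)) h2 2
  rw [mul_pow, sq_abs] at h3
  rw [one_div, ← div_eq_inv_mul, le_div_iff₀ hw]
  calc _ = w i ^ 2 * (∫ x, P.act t u x ∂(ν i)) ^ 2 := by ring
    _ ≤ _ := h3

/-- For functions of mean zero the `L¹` term of `integral_act_sq_le` can be halved, since no
component contributes more than half of `∑ i, w i * |mean over ν i|`. -/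
lemma integral_act_sq_le_of_integral_eq_zero (hL : MixtureLevel P μ w ν C) {t : ℝ≥0} (ht : 0 < t)
    {u : E → ℝ} (hm : Measurable u) {B : ℝ} (hB : ∀ x, |u x| ≤ B) (h0 : ∫ x, u x ∂μ = 0) :
    ∫ x, P.act t u x ^ 2 ∂μ ≤ C * ((∫ x, u x ^ 2 ∂μ) / (2 * t))
      + (∑ i, 1 / w i) / 2 * (∫ x, |u x| ∂μ) ^ 2 := by
  refine (hL.integral_act_sq_le_add ht hm hB).trans (add_le_add_right ?_ _)
  have h1 := hL.sum_weight_abs_mean_le t hm hB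
  set z : Fin m → ℝ := fun i => ∫ x, P.act t u x ∂(ν i) with hz
  set S := ∑ i, w i * |z i| with hS
  have hsum0 : ∑ i, w i * z i = 0 := by
    rw [← hL.integral_eq (integrable_of_abs_le (P.measurable_act t hm) (P.abs_act_le t hm hB)),
      P.integral_act hL.stationary t (integrable_of_abs_le hm hB), h0]
  have hS0 : 0 ≤ S := Finset.sum_nonneg fun i _ => mul_nonneg (hL.weight_pos i).le (abs_nonneg _)
  have hhalf : ∀ i, w i * |z i| ≤ S / 2 := by
    intro i
    have h2 : w i * z i = -∑ j ∈ Finset.univ.erase i, w j * z j := by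
      rw [← Finset.add_sum_erase _ _ (Finset.mem_univ i)] at hsum0
      linarith
    have h3 : w i * |z i| ≤ ∑ j ∈ Finset.univ.erase i, w j * |z j| := by
      rw [← abs_of_pos (hL.weight_pos i), ← abs_mul, h2, abs_neg]
      refine (Finset.abs_sum_le_sum_abs _ _).trans (Finset.sum_le_sum fun j _ => ?_)
      rw [abs_mul, abs_of_pos (hL.weight_pos j)]
    have h4 : S = w i * |z i| + ∑ j ∈ Finset.univ.erase i, w j * |z j| :=
      (Finset.add_sum_erase _ _ (Finset.mem_univ i)).symm
    linarith
  have hW : ∀ i, 1 / w i ≤ ∑ j, 1 / w j := fun i =>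
    Finset.single_le_sum (f := fun j => 1 / w j)
      (fun j _ => (one_div_pos.2 (hL.weight_pos j)).le) (Finset.mem_univ i)
  have hW0 : 0 ≤ ∑ j, 1 / w j := Finset.sum_nonneg fun j _ => (one_div_pos.2 (hL.weight_pos j)).le
  calc ∑ i, w i * z i ^ 2 ≤ ∑ i, (∑ j, 1 / w j) * (S / 2) * (w i * |z i|) := by
        refine Finset.sum_le_sum fun i _ => ?_
        have hw := hL.weight_pos i
        have e1 : w i * z i ^ 2 = 1 / w i * (w i * |z i|) * (w i * |z i|) := by
          rw [← sq_abs]; field_simp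
        rw [e1]
        have := hW i
        have := hhalf i
        gcongr
    _ = (∑ j, 1 / w j) / 2 * S ^ 2 := by rw [← Finset.mul_sum, ← hS]; ring
    _ ≤ _ := by gcongr

end MixtureLevel

end Contraction

/-! ### Hypercontractivity -/

section Hypercontractivity

open scoped InnerProductSpace

variable {E : Type*} [MeasurableSpace E] {P : MarkovSemigroup E} {μ : Measure E} {m : ℕ}
  {w : Fin m → ℝ} {ν : Fin m → Measure E} {C : ℝ}
  [IsProbabilityMeasure μ] [∀ i, IsProbabilityMeasure (ν i)]

/-- The elementary inequality behind the comparison of Dirichlet forms of powers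
(Stroock-Varopoulos), with a constant that is not optimal. -/
lemma sq_rpow_sub_rpow_le {q : ℝ} (hq : 2 ≤ q) {x y : ℝ} (hx : 0 < x) (hy : 0 < y) :
    (x ^ (q / 2) - y ^ (q / 2)) ^ 2 ≤ q ^ 2 / 4 * ((x ^ (q - 1) - y ^ (q - 1)) * (x - y)) := by
  wlog hxy : y ≤ x generalizing x y
  · have := this hy hx (le_of_not_ge hxy)
    calc _ = (y ^ (q / 2) - x ^ (q / 2)) ^ 2 := by ring
      _ ≤ _ := this
      _ = _ := by ring
  -- tangent line of the convex function `z ^ (q / 2)` at `x`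
  have h1 : x ^ (q / 2) - y ^ (q / 2) ≤ q / 2 * x ^ (q / 2 - 1) * (x - y) := by
    have h2 : -1 ≤ y / x - 1 := by
      have : 0 ≤ y / x := by positivity
      linarith
    have h3 := one_add_mul_self_le_rpow_one_add h2 (by linarith : 1 ≤ q / 2)
    rw [add_sub_cancel, Real.div_rpow hy.le hx.le, le_div_iff₀ (by positivity)] at h3
    have h4 : x ^ (q / 2) = x ^ (q / 2 - 1) * x := by
      rw [← Real.rpow_add_one hx.ne']; ring_nf
    have h5 : (1 + q / 2 * (y / x - 1)) * x ^ (q / 2)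
        = x ^ (q / 2) - q / 2 * x ^ (q / 2 - 1) * (x - y) := by
      rw [h4]; field_simp; ring
    rw [h5] at h3
    linarith
  have h0 : 0 ≤ x ^ (q / 2) - y ^ (q / 2) :=
    sub_nonneg.2 (Real.rpow_le_rpow hy.le hxy (by linarith))
  have h2 : (x ^ (q / 2) - y ^ (q / 2)) ^ 2 ≤ q ^ 2 / 4 * (x ^ (q - 2) * (x - y) ^ 2) := by
    calc _ ≤ (q / 2 * x ^ (q / 2 - 1) * (x - y)) ^ 2 := pow_le_pow_left₀ h0 h1 2
      _ = q ^ 2 / 4 * ((x ^ (q / 2 - 1)) ^ 2 * (x - y) ^ 2) := by ring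
      _ = _ := by
        rw [← Real.rpow_natCast (x ^ (q / 2 - 1)), ← Real.rpow_mul hx.le]
        congr 3
        push_cast
        ring_nf
  refine h2.trans (mul_le_mul_of_nonneg_left ?_ (by positivity))
  have h3 : x ^ (q - 1) = x ^ (q - 2) * x := by
    rw [← Real.rpow_add_one hx.ne']; ring_nf
  have h4 : y ^ (q - 1) ≤ x ^ (q - 2) * y := by
    have : y ^ (q - 1) = y ^ (q - 2) * y := by
      rw [← Real.rpow_add_one hy.ne']; ring_nf
    rw [this]
    exact mul_le_mul_of_nonneg_right (Real.rpow_le_rpow hy.le hxy (by linarith)) hy.le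
  rw [h3, pow_two, ← mul_assoc]
  refine mul_le_mul_of_nonneg_right ?_ (sub_nonneg.2 hxy)
  linarith

/-- The form of a reversible kernel as a symmetric double integral. -/
lemma two_mul_integral_mul_sub_kernel {κ : Kernel E E} [IsMarkovKernel κ] (h : κ.IsReversible μ)
    {f g : E → ℝ} (hf : MemLp f 2 μ) (hg : MemLp g 2 μ) :
    2 * ∫ x, f x * (g x - ∫ y, g y ∂(κ x)) ∂μ
      = ∫ p : E × E, (f p.1 - f p.2) * (g p.1 - g p.2) ∂(μ ⊗ₘ κ) := by
  have hi := h.invariant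
  have hfst : MeasurePreserving (Prod.fst : E × E → E) (μ ⊗ₘ κ) μ := compProd_fst_measurePreserving
  have hsnd := compProd_snd_measurePreserving hi
  have hfg : Integrable (fun x => f x * g x) μ := MemLp.integrable_mul (p := 2) (q := 2) hf hg
  have hK := memLp_integral_kernel hi hg
  have i1 : Integrable (fun p : E × E => f p.1 * g p.1) (μ ⊗ₘ κ) :=
    hfst.integrable_comp_of_integrable hfg
  have i2 : Integrable (fun p : E × E => f p.2 * g p.2) (μ ⊗ₘ κ) :=
    hsnd.integrable_comp_of_integrable hfg
  have i3 := integrable_mul_compProd hi hf hg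
  have i4 : Integrable (fun p : E × E => f p.2 * g p.1) (μ ⊗ₘ κ) := by
    refine (integrable_mul_compProd hi hg hf).congr (ae_of_all _ fun p => ?_)
    simp only; ring
  have e1 : ∫ p : E × E, f p.1 * g p.1 ∂(μ ⊗ₘ κ) = ∫ x, f x * g x ∂μ := by
    have := integral_map (μ := μ ⊗ₘ κ) (φ := Prod.fst) measurable_fst.aemeasurable
      (f := fun x => f x * g x) (by rw [hfst.map_eq]; exact hfg.aestronglyMeasurable)
    rw [hfst.map_eq] at this
    exact this.symm
  have e2 : ∫ p : E × E, f p.2 * g p.2 ∂(μ ⊗ₘ κ) = ∫ x, f x * g x ∂μ := by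
    have := integral_map (μ := μ ⊗ₘ κ) (φ := Prod.snd) measurable_snd.aemeasurable
      (f := fun x => f x * g x) (by rw [hsnd.map_eq]; exact hfg.aestronglyMeasurable)
    rw [hsnd.map_eq] at this
    exact this.symm
  have e3 := integral_mul_integral_kernel hi hf hg
  have e4 : ∫ p : E × E, f p.2 * g p.1 ∂(μ ⊗ₘ κ) = ∫ x, f x * ∫ y, g y ∂(κ x) ∂μ := by
    rw [integral_mul_integral_kernel_comm h hf hg]
    have : ∫ x, (∫ y, f y ∂(κ x)) * g x ∂μ = ∫ x, g x * ∫ y, f y ∂(κ x) ∂μ := by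
      simp_rw [mul_comm]
    rw [this, integral_mul_integral_kernel hi hg hf]
    simp_rw [mul_comm]
  have e5 : ∀ p : E × E, (f p.1 - f p.2) * (g p.1 - g p.2)
      = (f p.1 * g p.1 + f p.2 * g p.2) - (f p.1 * g p.2 + f p.2 * g p.1) := fun p => by ring
  have hfK : Integrable (fun x => f x * ∫ y, g y ∂(κ x)) μ :=
    MemLp.integrable_mul (p := 2) (q := 2) hf hK
  simp_rw [e5, mul_sub]
  rw [integral_sub hfg hfK]
  rw [integral_sub (f := fun p : E × E => f p.1 * g p.1 + f p.2 * g p.2)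
      (g := fun p : E × E => f p.1 * g p.2 + f p.2 * g p.1) (i1.add i2) (i3.add i4),
    integral_add i1 i2, integral_add i3 i4, e1, e2, e4, ← e3]
  ring

lemma MarkovSemigroup.energyQuotient_rpow_le (hR : ∀ s, (P.kernel s).IsReversible μ) {q : ℝ}
    (hq : 2 ≤ q) {u : E → ℝ} (hm : Measurable u) {a b : ℝ} (ha : 0 < a)
    (hab : ∀ x, u x ∈ Set.Icc a b) (h : ℝ≥0) :
    P.energyQuotient μ h (fun x => u x ^ (q / 2))
      ≤ q ^ 2 / 4 * ((h : ℝ)⁻¹ * ∫ x, u x ^ (q - 1) * (u x - P.act h u x) ∂μ) := by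
  have hpos : ∀ x, 0 < u x := fun x => ha.trans_le (hab x).1
  have hmem : ∀ s : ℝ, 0 ≤ s → MemLp (fun x => u x ^ s) 2 μ := fun s hs =>
    memLp_two_of_bound (B := b ^ s) (hm.pow_const s) fun x => by
      rw [abs_of_pos (Real.rpow_pos_of_pos (hpos x) s)]
      exact Real.rpow_le_rpow (hpos x).le (hab x).2 hs
  have hu2 : MemLp u 2 μ := memLp_two_of_bound (B := b) hm fun x => by
    rw [abs_of_pos (hpos x)]; exact (hab x).2
  have hi := (hR h).invariant
  have i1 : ∀ {f g : E → ℝ}, MemLp f 2 μ → MemLp g 2 μ →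
      Integrable (fun p : E × E => (f p.1 - f p.2) * (g p.1 - g p.2)) (μ ⊗ₘ P.kernel h) := by
    intro f g hf hg
    refine MemLp.integrable_mul (p := 2) (q := 2) ?_ ?_
    · exact (hf.comp_measurePreserving compProd_fst_measurePreserving).sub
        (hf.comp_measurePreserving (compProd_snd_measurePreserving hi))
    · exact (hg.comp_measurePreserving compProd_fst_measurePreserving).sub
        (hg.comp_measurePreserving (compProd_snd_measurePreserving hi))
  have h1 := two_mul_integral_mul_sub_kernel (hR h) (hmem (q / 2) (by linarith))
    (hmem (q / 2) (by linarith))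
  have h2 := two_mul_integral_mul_sub_kernel (hR h) (hmem (q - 1) (by linarith)) hu2
  have h3 := integral_mono (i1 (hmem (q / 2) (by linarith)) (hmem (q / 2) (by linarith)))
    ((i1 (hmem (q - 1) (by linarith)) hu2).const_mul (q ^ 2 / 4)) (fun p => by
      have := sq_rpow_sub_rpow_le hq (hpos p.1) (hpos p.2)
      simp only
      rw [← pow_two]
      exact this)
  rw [integral_const_mul, ← h1, ← h2] at h3
  rw [MarkovSemigroup.energyQuotient, mul_left_comm (q ^ 2 / 4)]
  refine mul_le_mul_of_nonneg_left ?_ (inv_nonneg.2 h.coe_nonneg)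
  simp only [MarkovSemigroup.act]
  linarith

namespace MixtureLevel

/-- The entropy of a mixture: passing from the components to the mixture costs at most the
logarithm of the inverse minimal weight. -/
lemma entropyOf_le (hL : MixtureLevel P μ w ν C) {r : ℝ} (hr : ∀ i, 1 / w i ≤ r) {h : E → ℝ}
    (hm : Measurable h) {a b : ℝ} (ha : 0 < a) (hab : ∀ x, h x ∈ Set.Icc a b) :
    entropyOf μ h ≤ ∑ i, w i * entropyOf (ν i) h + Real.log r * ∫ x, h x ∂μ := by
  have hpos : ∀ x, 0 < h x := fun x => ha.trans_le (hab x).1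
  have hi : Integrable h μ := integrable_of_abs_le (B := b) hm fun x => by
    rw [abs_of_pos (hpos x)]; exact (hab x).2
  have hMpos := integral_pos_of_mem_Icc (ν := μ) hm ha hab
  have hmpos := fun i => integral_pos_of_mem_Icc (ν := ν i) hm ha hab
  simp only [entropyOf]
  rw [hL.integral_eq (integrable_mul_log_of_mem_Icc hm ha hab)]
  set M := ∫ x, h x ∂μ with hM
  have hMsum : M = ∑ i, w i * ∫ x, h x ∂(ν i) := hL.integral_eq hi
  have key : ∀ i, w i * ((∫ x, h x ∂(ν i)) * Real.log (∫ x, h x ∂(ν i)))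
      ≤ (w i * ∫ x, h x ∂(ν i)) * (Real.log M + Real.log r) := by
    intro i
    have hw := hL.weight_pos i
    have hrpos : 0 < r := (one_div_pos.2 hw).trans_le (hr i)
    rw [← mul_assoc]
    refine mul_le_mul_of_nonneg_left ?_ (mul_pos hw (hmpos i)).le
    rw [← Real.log_mul hMpos.ne' hrpos.ne']
    refine Real.log_le_log (hmpos i) ?_
    have h1 : w i * ∫ x, h x ∂(ν i) ≤ M := by
      rw [hMsum]
      exact Finset.single_le_sum (f := fun j => w j * ∫ x, h x ∂(ν j))
        (fun j _ => (mul_pos (hL.weight_pos j) (hmpos j)).le) (Finset.mem_univ i)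
    calc ∫ x, h x ∂(ν i) = (w i * ∫ x, h x ∂(ν i)) * (1 / w i) := by field_simp
      _ ≤ M * r := mul_le_mul h1 (hr i) (one_div_pos.2 hw).le hMpos.le
  have h2 := Finset.sum_le_sum fun i (_ : i ∈ Finset.univ) => key i
  rw [← Finset.sum_mul, ← hMsum] at h2
  simp_rw [mul_sub]
  rw [Finset.sum_sub_distrib]
  linarith

/-- Log-Sobolev inequality for powers, with the defect `log r` of a mixture. Here `I` is
`⟨u^(q-1), 𝓛 u⟩`, as a limit of difference quotients. -/
lemma entropyOf_rpow_le (hL : MixtureLevel P μ w ν C) {r : ℝ} (hr : ∀ i, 1 / w i ≤ r) {q : ℝ}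
    (hq : 2 ≤ q) {u : E → ℝ} (hm : Measurable u) {a b : ℝ} (ha : 0 < a)
    (hab : ∀ x, u x ∈ Set.Icc a b) {I : ℝ}
    (hI : Tendsto (fun h : ℝ≥0 => (h : ℝ)⁻¹ * ∫ x, u x ^ (q - 1) * (u x - P.act h u x) ∂μ) (𝓝[>] 0)
      (𝓝 (-I))) :
    entropyOf μ (fun x => u x ^ q) ≤ C * (q ^ 2 / 4 * -I) + Real.log r * ∫ x, u x ^ q ∂μ := by
  have hpos : ∀ x, 0 < u x := fun x => ha.trans_le (hab x).1
  have hpow : ∀ s : ℝ, 0 ≤ s → ∀ x, u x ^ s ∈ Set.Icc (a ^ s) (b ^ s) := fun s hs x =>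
    ⟨Real.rpow_le_rpow ha.le (hab x).1 hs, Real.rpow_le_rpow (hpos x).le (hab x).2 hs⟩
  have hsq : ∀ x, (u x ^ (q / 2)) ^ 2 = u x ^ q := fun x => by
    rw [← Real.rpow_natCast (u x ^ (q / 2)), ← Real.rpow_mul (hpos x).le]
    congr 1; push_cast; ring
  have h1 := hL.entropyOf_le hr (hm.pow_const q) (Real.rpow_pos_of_pos ha q)
    (hpow q (by linarith))
  refine h1.trans (add_le_add_left ?_ _)
  have key : ∀ ρ : ℝ, 0 < ρ →
      ∑ i, w i * entropyOf (ν i) (fun x => u x ^ q) ≤ C * (q ^ 2 / 4 * (-I + ρ)) := by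
    intro ρ hρ
    have h2 := hL.sum_entropyOf_le (hm.pow_const (q / 2)) (Real.rpow_pos_of_pos ha (q / 2))
      (hpow (q / 2) (by linarith)) (e := q ^ 2 / 4 * (-I + ρ)) (by
        have : NeBot (𝓝[>] (0 : ℝ≥0)) := inferInstance
        refine Eventually.frequently ?_
        filter_upwards [hI.eventually (gt_mem_nhds (by linarith : -I < -I + ρ))] with h hh
        refine (P.energyQuotient_rpow_le hL.reversible hq hm ha hab h).trans ?_
        gcongr)
    simp_rw [hsq] at h2
    exact h2
  have h3 : Tendsto (fun ρ : ℝ => C * (q ^ 2 / 4 * (-I + ρ))) (𝓝[>] 0)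
      (𝓝 (C * (q ^ 2 / 4 * (-I + 0)))) := by
    refine Tendsto.mono_left ?_ nhdsWithin_le_nhds
    exact Continuous.tendsto (by fun_prop) 0
  have h4 := ge_of_tendsto h3 (by
    filter_upwards [self_mem_nhdsWithin] with ρ hρ using key ρ hρ)
  simpa using h4

end MixtureLevel

end Hypercontractivity

section HypercontractivityOrbit

open scoped InnerProductSpace

variable {E : Type*} [MeasurableSpace E] {P : MarkovSemigroup E} {μ : Measure E} {m : ℕ}
  {w : Fin m → ℝ} {ν : Fin m → Measure E} {C : ℝ}
  [IsProbabilityMeasure μ] [∀ i, IsProbabilityMeasure (ν i)]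

lemma contDiffOn_rpow_prod {a b : ℝ} (ha : 0 < a) :
    ContDiffOn ℝ 1 (fun p : ℝ × ℝ => p.2 ^ p.1) (Set.Icc 1 4 ×ˢ Set.Icc a b) := fun _ hp =>
  (contDiffAt_snd.rpow contDiffAt_fst (ha.trans_le hp.2.1).ne').contDiffWithinAt

lemma exists_lipschitz_of_contDiffOn {F : ℝ × ℝ → ℝ} {a b : ℝ}
    (hF : ContDiffOn ℝ 1 F (Set.Icc 1 4 ×ˢ Set.Icc a b)) :
    ∃ L : ℝ, 0 ≤ L ∧ ∀ q ∈ Set.Icc (1 : ℝ) 4, ∀ q' ∈ Set.Icc (1 : ℝ) 4, ∀ x ∈ Set.Icc a b,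
      ∀ y ∈ Set.Icc a b, |F (q, x) - F (q', y)| ≤ L * (|q - q'| + |x - y|) := by
  have hc : Convex ℝ (Set.Icc (1 : ℝ) 4 ×ˢ Set.Icc a b) := (convex_Icc _ _).prod (convex_Icc _ _)
  obtain ⟨K, hK⟩ := (hF.locallyLipschitzOn hc).exists_lipschitzOnWith_of_compact
    (isCompact_Icc.prod isCompact_Icc)
  refine ⟨K, K.coe_nonneg, fun q hq q' hq' x hx y hy => ?_⟩
  have h := hK.dist_le_mul (q, x) ⟨hq, hx⟩ (q', y) ⟨hq', hy⟩
  rw [Real.dist_eq] at h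
  refine h.trans (mul_le_mul_of_nonneg_left ?_ K.coe_nonneg)
  rw [Prod.dist_eq, Real.dist_eq, Real.dist_eq]
  exact max_le (le_add_of_nonneg_right (abs_nonneg _)) (le_add_of_nonneg_left (abs_nonneg _))

lemma integral_abs_le_norm_toLp {f : E → ℝ} (hf : MemLp f 2 μ) :
    ∫ x, |f x| ∂μ ≤ ‖hf.toLp f‖ :=
  integral_abs_le_of_sq hf (norm_nonneg _) (norm_toLp_sq hf).ge

/-- A Lipschitz function of a parameter and of a bounded function, integrated over the space,
depends continuously on the parameter and, in `L²`, on the function. -/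
lemma tendsto_integral_comp {ι : Type*} {l : Filter ι} {F : ℝ × ℝ → ℝ} {a b : ℝ}
    (hF : ContDiffOn ℝ 1 F (Set.Icc 1 4 ×ˢ Set.Icc a b)) (hFm : Measurable F)
    {q : ι → ℝ} {q₀ : ℝ} {u : ι → E → ℝ} {u₀ : E → ℝ}
    (hq : ∀ᶠ i in l, q i ∈ Set.Icc (1 : ℝ) 4) (hq₀ : q₀ ∈ Set.Icc (1 : ℝ) 4)
    (hu : ∀ i x, u i x ∈ Set.Icc a b) (hu₀ : ∀ x, u₀ x ∈ Set.Icc a b)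
    (hum : ∀ i, Measurable (u i)) (hum₀ : Measurable u₀)
    (hu2 : ∀ i, MemLp (u i) 2 μ) (hu2₀ : MemLp u₀ 2 μ)
    (hqt : Tendsto q l (𝓝 q₀)) (hut : Tendsto (fun i => (hu2 i).toLp (u i)) l (𝓝 (hu2₀.toLp u₀))) :
    Tendsto (fun i => ∫ x, F (q i, u i x) ∂μ) l (𝓝 (∫ x, F (q₀, u₀ x) ∂μ)) := by
  obtain ⟨L, hL0, hL⟩ := exists_lipschitz_of_contDiffOn hF
  obtain ⟨B, hB⟩ := (isCompact_Icc.prod isCompact_Icc).exists_bound_of_continuousOn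
    hF.continuousOn
  have hint : ∀ q' ∈ Set.Icc (1 : ℝ) 4, ∀ v : E → ℝ, (∀ x, v x ∈ Set.Icc a b) → Measurable v →
      Integrable (fun x => F (q', v x)) μ := fun q' hq' v hv hvm =>
    integrable_of_abs_le (hFm.comp (measurable_const.prodMk hvm)) fun x => hB _ ⟨hq', hv x⟩
  rw [tendsto_iff_norm_sub_tendsto_zero] at hut hqt ⊢
  have hlim : Tendsto (fun i => L * (‖q i - q₀‖ + ‖(hu2 i).toLp (u i) - hu2₀.toLp u₀‖)) l (𝓝 0) := by
    simpa using (hqt.add hut).const_mul L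
  refine squeeze_zero' (Eventually.of_forall fun i => norm_nonneg _) ?_ hlim
  filter_upwards [hq] with i hi
  have hd : MemLp (u i - u₀) 2 μ := (hu2 i).sub hu2₀
  rw [← MemLp.toLp_sub, ← integral_sub (hint _ hi _ (hu i) (hum i)) (hint _ hq₀ _ hu₀ hum₀)]
  have hdi : Integrable (fun x => |(u i - u₀) x|) μ := (hd.integrable (by norm_num)).abs
  calc _ ≤ ∫ x, |F (q i, u i x) - F (q₀, u₀ x)| ∂μ := abs_integral_le_integral_abs
    _ ≤ ∫ x, L * (|q i - q₀| + |(u i - u₀) x|) ∂μ := by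
        refine integral_mono ((hint _ hi _ (hu i) (hum i)).sub (hint _ hq₀ _ hu₀ hum₀)).abs
          (((integrable_const _).add hdi).const_mul L) fun x => ?_
        exact hL _ hi _ hq₀ _ (hu i x) _ (hu₀ x)
    _ = L * (|q i - q₀| + ∫ x, |(u i - u₀) x| ∂μ) := by
        rw [integral_const_mul, integral_add (integrable_const _) hdi]
        simp
    _ ≤ _ := by
        have := integral_abs_le_norm_toLp hd
        rw [Real.norm_eq_abs]
        gcongr

lemma tendsto_toLp_rpow {ι : Type*} {l : Filter ι} {a b q : ℝ} (ha : 0 < a)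
    (hq : q ∈ Set.Icc (1 : ℝ) 4) {u : ι → E → ℝ} {u₀ : E → ℝ}
    (hu : ∀ i x, u i x ∈ Set.Icc a b) (hu₀ : ∀ x, u₀ x ∈ Set.Icc a b)
    (hu2 : ∀ i, MemLp (u i) 2 μ) (hu2₀ : MemLp u₀ 2 μ)
    (hp2 : ∀ i, MemLp (fun x => u i x ^ q) 2 μ) (hp2₀ : MemLp (fun x => u₀ x ^ q) 2 μ)
    (hut : Tendsto (fun i => (hu2 i).toLp (u i)) l (𝓝 (hu2₀.toLp u₀))) :
    Tendsto (fun i => (hp2 i).toLp (fun x => u i x ^ q)) l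
      (𝓝 (hp2₀.toLp (fun x => u₀ x ^ q))) := by
  obtain ⟨L, hL0, hL⟩ := exists_lipschitz_of_contDiffOn (contDiffOn_rpow_prod (b := b) ha)
  rw [tendsto_iff_norm_sub_tendsto_zero] at hut ⊢
  have hlim : Tendsto (fun i => L * ‖(hu2 i).toLp (u i) - hu2₀.toLp u₀‖) l (𝓝 0) := by
    simpa using hut.const_mul L
  refine squeeze_zero (fun i => norm_nonneg _) (fun i => ?_) hlim
  rw [← MemLp.toLp_sub, ← MemLp.toLp_sub]
  refine Lp.norm_le_mul_norm_of_ae_le_mul ?_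
  filter_upwards [((hp2 i).sub hp2₀).coeFn_toLp, ((hu2 i).sub hu2₀).coeFn_toLp] with x h1 h2
  rw [h1, h2]
  have := hL q hq q hq _ (hu i x) _ (hu₀ x)
  simpa using this

/-- Convexity of `(q, x) ↦ x ^ q` in each variable, at the point `(q', y)`. -/
lemma rpow_sub_rpow_le {q q' x y : ℝ} (hq : 1 ≤ q) (hx : 0 < x) (hy : 0 < y) :
    y ^ q' - x ^ q ≤ (q' - q) * (y ^ q' * Real.log y) + q * (y ^ (q - 1) * (y - x)) := by
  have h1 : y ^ q' - y ^ q ≤ (q' - q) * (y ^ q' * Real.log y) := by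
    have h2 := Real.add_one_le_exp (Real.log y * (q - q'))
    rw [← Real.rpow_def_of_pos hy] at h2
    have h3 : y ^ q = y ^ q' * y ^ (q - q') := by rw [← Real.rpow_add hy]; ring_nf
    have h4 := mul_le_mul_of_nonneg_left h2 (Real.rpow_pos_of_pos hy q').le
    rw [← h3] at h4
    linarith
  have h5 : y ^ q - x ^ q ≤ q * (y ^ (q - 1) * (y - x)) := by
    have h2 : -1 ≤ x / y - 1 := by
      have : 0 ≤ x / y := by positivity
      linarith
    have h3 := one_add_mul_self_le_rpow_one_add h2 hq
    rw [add_sub_cancel, Real.div_rpow hx.le hy.le, le_div_iff₀ (by positivity)] at h3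
    have h4 : y ^ q = y ^ (q - 1) * y := by
      rw [← Real.rpow_add_one hy.ne']; ring_nf
    have h5 : (1 + q * (x / y - 1)) * y ^ q = y ^ q - q * (y ^ (q - 1) * (y - x)) := by
      rw [h4]; field_simp; ring
    rw [h5] at h3
    linarith
  linarith

namespace MixtureLevel

/-- The differential inequality of Gross along the orbit of a function in the domain of the
generator: `∫ (P_s f)^q(s)`, with `q(s) = 2 + 2 s / t`, is compared with the solution
`exp (q(s) c) / r` of the differential equation `G' = (q' / q) G (log G + log r)`. -/
lemma integral_act_rpow_four_le (hL : MixtureLevel P μ w ν C) {r : ℝ} (hr : ∀ i, 1 / w i ≤ r)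
    (hr0 : 0 < r) {t : ℝ≥0} (ht : 0 < t) (hCt : C / 2 ≤ t) {f g : E → ℝ} (hm : Measurable f)
    {a b : ℝ} (ha : 0 < a) (hab : ∀ x, f x ∈ Set.Icc a b) (hf : MemLp f 2 μ) (hg : MemLp g 2 μ)
    (hgen : Tendsto (fun s : ℝ≥0 => (s : ℝ)⁻¹ • (P.l2 hL.stationary s (hf.toLp f) - hf.toLp f))
      (𝓝[>] 0) (𝓝 (hg.toLp g))) :
    ∫ x, P.act t f x ^ (4 : ℝ) ∂μ ≤ r * (∫ x, f x ^ (2 : ℝ) ∂μ) ^ 2 := by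
  have hS := hL.stationary
  have hT := P.isSymmSemigroup hS hL.reversible
  have htR : (0 : ℝ) < t := ht
  set U : ℝ → E → ℝ := fun s => P.act s.toNNReal f with hU
  have hUm : ∀ s, Measurable (U s) := fun s => P.measurable_act _ hm
  have hUab : ∀ s x, U s x ∈ Set.Icc a b := fun s => P.act_mem_Icc _ hm hab
  have hUpos : ∀ s x, 0 < U s x := fun s x => ha.trans_le (hUab s x).1
  have hU2 : ∀ s, MemLp (U s) 2 μ := fun s => P.memLp_act hS _ hf
  have hUT : ∀ s, (hU2 s).toLp (U s) = P.l2 hS s.toNNReal (hf.toLp f) := fun s =>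
    (P.l2_toLp hS _ hf).symm
  have hpow2 : ∀ q : ℝ, 0 ≤ q → ∀ s, MemLp (fun x => U s x ^ q) 2 μ := fun q hq s =>
    memLp_two_of_bound (B := b ^ q) ((hUm s).pow_const q) fun x => by
      rw [abs_of_pos (Real.rpow_pos_of_pos (hUpos s x) q)]
      exact Real.rpow_le_rpow (hUpos s x).le (hUab s x).2 hq
  set q : ℝ → ℝ := fun s => 2 + 2 * s / t with hq
  have hqc : Continuous q := by fun_prop
  have hq2 : ∀ s ∈ Set.Icc (0 : ℝ) t, q s ∈ Set.Icc (2 : ℝ) 4 := fun s hs => by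
    have h1 : s / t ≤ 1 := (div_le_one htR).2 hs.2
    have h2 : 0 ≤ s / t := div_nonneg hs.1 htR.le
    have h3 : q s = 2 + 2 * (s / t) := by simp only [hq]; ring
    constructor <;> linarith
  have hq1 : ∀ s ∈ Set.Icc (0 : ℝ) t, q s ∈ Set.Icc (1 : ℝ) 4 := fun s hs =>
    ⟨by linarith [(hq2 s hs).1], (hq2 s hs).2⟩
  have hUc : Continuous fun s => (hU2 s).toLp (U s) := by
    simp_rw [hUT]; exact hT.continuous_orbit_real _
  set G : ℝ → ℝ := fun s => ∫ x, U s x ^ q s ∂μ with hG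
  have hFrpow := contDiffOn_rpow_prod (b := b) ha
  have hFm : Measurable (fun p : ℝ × ℝ => p.2 ^ p.1) := measurable_snd.pow measurable_fst
  have hFlog : ContDiffOn ℝ 1 (fun p : ℝ × ℝ => p.2 ^ p.1 * Real.log p.2)
      (Set.Icc 1 4 ×ˢ Set.Icc a b) :=
    hFrpow.mul (contDiffOn_snd.log fun _ hp => (ha.trans_le hp.2.1).ne')
  have hFlogm : Measurable (fun p : ℝ × ℝ => p.2 ^ p.1 * Real.log p.2) :=
    hFm.mul (Real.measurable_log.comp measurable_snd)
  have hGc : ContinuousOn G (Set.Icc 0 t) := fun s hs =>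
    tendsto_integral_comp hFrpow hFm (by
      filter_upwards [self_mem_nhdsWithin] with z hz using hq1 z hz) (hq1 s hs) (fun z => hUab z)
      (hUab s) (fun z => hUm z) (hUm s) hU2 (hU2 s) (hqc.continuousWithinAt)
      hUc.continuousWithinAt
  -- the right upper derivative of `G`
  set V : ℝ → Lp ℝ 2 μ := fun s => P.l2 hS s.toNNReal (hg.toLp g) with hV
  set I : ℝ → ℝ := fun s =>
    if h : 0 ≤ q s - 1 then ⟪(hpow2 (q s - 1) h s).toLp _, V s⟫_ℝ else 0 with hI
  set D : ℝ → ℝ := fun s => 2 / t * ∫ x, U s x ^ q s * Real.log (U s x) ∂μ + q s * I s with hD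
  have hderiv : ∀ s, 0 ≤ s → Tendsto (fun z : ℝ => (z - s)⁻¹ • ((hU2 z).toLp (U z) -
      (hU2 s).toLp (U s))) (𝓝[>] s) (𝓝 (V s)) := fun s hs => by
    simp_rw [hUT]; exact hT.hasDerivWithinAt_orbit hgen hs
  have hslope : ∀ s ∈ Set.Ico (0 : ℝ) t, ∀ ρ : ℝ, D s < ρ → ∃ᶠ z in 𝓝[>] s, slope G s z < ρ := by
    intro s hs ρ hρ
    have hsI : s ∈ Set.Icc (0 : ℝ) t := ⟨hs.1, hs.2.le⟩
    have hqs := hq2 s hsI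
    have hqs0 : 0 ≤ q s - 1 := by linarith [hqs.1]
    have hev : ∀ᶠ z in 𝓝[>] s, z ∈ Set.Ioc s t := Ioc_mem_nhdsGT hs.2
    have h1 : Tendsto (fun z => ∫ x, U z x ^ q z * Real.log (U z x) ∂μ) (𝓝[>] s)
        (𝓝 (∫ x, U s x ^ q s * Real.log (U s x) ∂μ)) :=
      tendsto_integral_comp hFlog hFlogm (by
        filter_upwards [hev] with z hz using hq1 z ⟨hs.1.trans hz.1.le, hz.2⟩) (hq1 s hsI)
        (fun z => hUab z) (hUab s) (fun z => hUm z) (hUm s) hU2 (hU2 s)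
        hqc.continuousWithinAt hUc.continuousWithinAt
    have h2 := tendsto_toLp_rpow ha ⟨by linarith [hqs.1], by linarith [hqs.2]⟩
      (fun z => hUab z) (hUab s) hU2 (hU2 s) (hpow2 (q s - 1) hqs0) (hpow2 (q s - 1) hqs0 s)
      (hUc.continuousWithinAt (s := Set.Ioi s) (x := s))
    have h3 : Tendsto (fun z => 2 / t * ∫ x, U z x ^ q z * Real.log (U z x) ∂μ
        + q s * ⟪(hpow2 (q s - 1) hqs0 z).toLp _,
          (z - s)⁻¹ • ((hU2 z).toLp (U z) - (hU2 s).toLp (U s))⟫_ℝ) (𝓝[>] s) (𝓝 (D s)) := by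
      have := (h1.const_mul (2 / (t : ℝ))).add ((h2.inner (𝕜 := ℝ) (hderiv s hs.1)).const_mul (q s))
      simp only [hD, hI, hqs0, dif_pos]
      exact this
    refine Eventually.frequently ?_
    filter_upwards [h3.eventually (gt_mem_nhds hρ), hev] with z hz hzI
    refine lt_of_le_of_lt ?_ hz
    have hzs : 0 < z - s := sub_pos.2 hzI.1
    have hzI' : z ∈ Set.Icc (0 : ℝ) t := ⟨hs.1.trans hzI.1.le, hzI.2⟩
    have hqz := hq2 z hzI'
    rw [inner_smul_right, ← MemLp.toLp_sub, inner_toLp, slope_def_field, div_eq_inv_mul]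
    have hqq : q z - q s = (z - s) * (2 / t) := by simp only [hq]; ring
    have ipow : ∀ y, 0 ≤ q y → ∀ y', Integrable (fun x => U y' x ^ q y) μ := fun y hy y' =>
      (hpow2 (q y) hy y').integrable (by norm_num)
    have ilog : Integrable (fun x => U z x ^ q z * Real.log (U z x)) μ := by
      refine MemLp.integrable_mul (p := 2) (q := 2) (hpow2 (q z) (by linarith [hqz.1]) z) ?_
      obtain ⟨B, hB⟩ := (isCompact_Icc (a := a) (b := b)).exists_bound_of_continuousOn
        (f := Real.log) (Real.continuousOn_log.mono fun x hx => (ha.trans_le hx.1).ne')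
      exact memLp_two_of_bound (Real.measurable_log.comp (hUm z)) fun x => hB _ (hUab z x)
    have imul : Integrable (fun x => U z x ^ (q s - 1) * (U z x - U s x)) μ :=
      MemLp.integrable_mul (p := 2) (q := 2) (hpow2 _ hqs0 z) ((hU2 z).sub (hU2 s))
    have hmono : G z - G s ≤ (q z - q s) * ∫ x, U z x ^ q z * Real.log (U z x) ∂μ
        + q s * ∫ x, U z x ^ (q s - 1) * (U z x - U s x) ∂μ := by
      simp only [hG]
      rw [← integral_sub (ipow z (by linarith [hqz.1]) z) (ipow s (by linarith [hqs.1]) s),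
        ← integral_const_mul, ← integral_const_mul,
        ← integral_add (ilog.const_mul _) (imul.const_mul _)]
      refine integral_mono ((ipow z (by linarith [hqz.1]) z).sub
        (ipow s (by linarith [hqs.1]) s)) ((ilog.const_mul _).add (imul.const_mul _)) fun x => ?_
      exact rpow_sub_rpow_le (by linarith [hqs.1]) (hUpos s x) (hUpos z x)
    rw [inv_mul_le_iff₀ hzs]
    refine hmono.trans (le_of_eq ?_)
    rw [hqq]
    simp only [Pi.sub_apply]
    field_simp
  -- the logarithmic Sobolev inequality bounds the derivative
  have hGpos : ∀ s ∈ Set.Icc (0 : ℝ) t, 0 < G s := fun s hs =>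
    integral_pos_of_mem_Icc ((hUm s).pow_const (q s)) (Real.rpow_pos_of_pos ha (q s))
      fun x => ⟨Real.rpow_le_rpow ha.le (hUab s x).1 (by linarith [(hq2 s hs).1]),
        Real.rpow_le_rpow (hUpos s x).le (hUab s x).2 (by linarith [(hq2 s hs).1])⟩
  have hgross : ∀ s ∈ Set.Ico (0 : ℝ) t,
      q s * D s ≤ 2 / t * (G s * (Real.log (G s) + Real.log r)) := by
    intro s hs
    have hsI : s ∈ Set.Icc (0 : ℝ) t := ⟨hs.1, hs.2.le⟩
    have hqs := hq2 s hsI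
    have hqs0 : 0 ≤ q s - 1 := by linarith [hqs.1]
    have hlim : Tendsto (fun h : ℝ≥0 => (h : ℝ)⁻¹ *
        ∫ x, U s x ^ (q s - 1) * (U s x - P.act h (U s) x) ∂μ) (𝓝[>] 0) (𝓝 (-I s)) := by
      have h1 : Tendsto (fun h : ℝ≥0 => s + (h : ℝ)) (𝓝[>] 0) (𝓝[>] s) := by
        refine tendsto_nhdsWithin_iff.2 ⟨?_, ?_⟩
        · refine Tendsto.mono_left ?_ nhdsWithin_le_nhds
          have : Continuous fun h : ℝ≥0 => s + (h : ℝ) := by fun_prop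
          simpa using this.tendsto 0
        · filter_upwards [self_mem_nhdsWithin] with h hh
          exact lt_add_of_pos_right s (NNReal.coe_pos.2 hh)
      have h2 := (((tendsto_const_nhds (x := (hpow2 (q s - 1) hqs0 s).toLp _)).inner (𝕜 := ℝ)
        (hderiv s hs.1)).comp h1).neg
      have h3 : I s = ⟪(hpow2 (q s - 1) hqs0 s).toLp _, V s⟫_ℝ := by simp only [hI, hqs0, dif_pos]
      rw [h3]
      refine h2.congr fun h => ?_
      have h4 : (hU2 (s + h)).toLp (U (s + h)) = (P.memLp_act hS h (hU2 s)).toLp _ := by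
        rw [hUT, ← P.l2_toLp hS h (hU2 s), hUT, Real.toNNReal_add hs.1 h.coe_nonneg,
          Real.toNNReal_coe, add_comm, hT.add]
      change -⟪_, (s + (h : ℝ) - s)⁻¹ • ((hU2 (s + h)).toLp (U (s + h)) - _)⟫_ℝ = _
      rw [h4, ← MemLp.toLp_sub, inner_smul_right, inner_toLp, add_sub_cancel_left, ← mul_neg,
        ← integral_neg]
      congr 2
      ext x
      simp only [Pi.sub_apply]
      ring
    have hI0 : 0 ≤ -I s := by
      have h1 := ge_of_tendsto hlim (b := 0) (Eventually.of_forall fun h => by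
        have h2 := (P.energyQuotient_nonneg hS hL.reversible (hpow2 (q s / 2)
          (by linarith [hqs.1]) s) h).trans
          (P.energyQuotient_rpow_le hL.reversible hqs.1 (hUm s) ha (hUab s) h)
        exact nonneg_of_mul_nonneg_right h2 (by nlinarith [hqs.1]))
      exact h1
    have hent := hL.entropyOf_rpow_le hr hqs.1 (hUm s) ha (hUab s) hlim
    have hent' : q s * ∫ x, U s x ^ q s * Real.log (U s x) ∂μ - G s * Real.log (G s)
        ≤ C * (q s ^ 2 / 4 * -I s) + Real.log r * G s := by
      refine le_trans (le_of_eq ?_) hent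
      rw [entropyOf, ← integral_const_mul]
      congr 2
      ext x
      rw [Real.log_rpow (hUpos s x)]
      ring
    have h5 : 2 / t * C ≤ 4 := by
      rw [div_mul_eq_mul_div, div_le_iff₀ htR]; linarith
    have h6 := mul_le_mul_of_nonneg_left hent' (by positivity : 0 ≤ 2 / (t : ℝ))
    have h7 : 0 ≤ (4 - 2 / t * C) * (q s ^ 2 / 4 * -I s) :=
      mul_nonneg (by linarith) (mul_nonneg (by positivity) hI0)
    simp only [hD]
    linarith
  -- comparison
  set c : ℝ := (Real.log (G 0) + Real.log r) / 2 with hc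
  have h0I : (0 : ℝ) ∈ Set.Icc (0 : ℝ) t := ⟨le_rfl, htR.le⟩
  have hcomp : ∀ ε : ℝ, 0 < ε → G t ≤ Real.exp (4 * (c + ε * t)) / r := by
    intro ε hε
    have h := image_le_of_liminf_slope_right_lt_deriv_boundary' (f := G) (f' := D) hGc hslope
      (B := fun s => Real.exp (q s * (c + ε * s)) / r)
      (B' := fun s => Real.exp (q s * (c + ε * s)) * (2 / t * (c + ε * s) + q s * ε) / r)
      (by
        have : q 0 * (c + ε * 0) = Real.log (G 0) + Real.log r := by simp only [hq, hc]; ring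
        simp only [this]
        rw [Real.exp_add, Real.exp_log (hGpos 0 h0I), Real.exp_log hr0, mul_div_cancel_right₀ _
          hr0.ne'])
      (by fun_prop) (fun s _ => by
        have h1 : HasDerivAt q (2 / t) s := by
          have h2 : q = fun s => 2 + 2 / (t : ℝ) * s := by
            funext y; simp only [hq]; ring
          rw [h2]
          simpa using ((hasDerivAt_id s).const_mul (2 / (t : ℝ))).const_add 2
        have h2 : HasDerivAt (fun s => c + ε * s) ε s := by
          simpa using ((hasDerivAt_id s).const_mul ε).const_add c
        exact ((h1.mul h2).exp.div_const r).hasDerivWithinAt)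
      (fun s hs heq => by
        have hsI : s ∈ Set.Icc (0 : ℝ) t := ⟨hs.1, hs.2.le⟩
        have hqs := hq2 s hsI
        have hlog : Real.log (G s) + Real.log r = q s * (c + ε * s) := by
          rw [heq, Real.log_div (Real.exp_pos _).ne' hr0.ne', Real.log_exp]; ring
        have h1 := hgross s hs
        rw [hlog] at h1
        have hq0 : 0 < q s := by linarith [hqs.1]
        have h2 : D s ≤ 2 / t * (G s * (c + ε * s)) := by
          refine le_of_mul_le_mul_left (h1.trans (le_of_eq ?_)) hq0
          ring
        refine h2.trans_lt ?_
        have h3 : Real.exp (q s * (c + ε * s)) * (2 / t * (c + ε * s) + q s * ε) / r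
            = 2 / t * (G s * (c + ε * s)) + G s * (q s * ε) := by
          rw [heq]; ring
        rw [h3]
        have := mul_pos (hGpos s hsI) (mul_pos hq0 hε)
        linarith) (x := (t : ℝ)) ⟨htR.le, le_rfl⟩
    have hqt : q t = 4 := by simp only [hq]; field_simp; norm_num
    simpa only [hqt] using h
  have hlim : Tendsto (fun ε : ℝ => Real.exp (4 * (c + ε * t)) / r) (𝓝[>] 0)
      (𝓝 (Real.exp (4 * (c + 0 * t)) / r)) :=
    Tendsto.mono_left (Continuous.tendsto (by fun_prop) 0) nhdsWithin_le_nhds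
  have hfinal := ge_of_tendsto hlim (by
    filter_upwards [self_mem_nhdsWithin] with ε hε using hcomp ε hε)
  have hqt : q t = 4 := by simp only [hq]; field_simp; norm_num
  have hq0 : q 0 = 2 := by simp [hq]
  have hU0 : U 0 = f := by
    ext x
    simp only [hU, Real.toNNReal_zero, MarkovSemigroup.act, P.zero]
    rw [Kernel.id_apply, integral_dirac' _ _ hm.stronglyMeasurable]
  have hGt : G t = ∫ x, P.act t f x ^ (4 : ℝ) ∂μ := by
    simp only [hG, hqt, hU, Real.toNNReal_coe]
  have hG0 : G 0 = ∫ x, f x ^ (2 : ℝ) ∂μ := by simp only [hG, hq0, hU0]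
  rw [← hGt, ← hG0]
  refine hfinal.trans (le_of_eq ?_)
  have h1 : 4 * (c + 0 * t) = 2 * Real.log (G 0) + 2 * Real.log r := by simp only [hc]; ring
  rw [h1, Real.exp_add, mul_comm 2, mul_comm 2, Real.exp_mul, Real.exp_mul,
    Real.exp_log (hGpos 0 h0I), Real.exp_log hr0, Real.rpow_two, Real.rpow_two]
  field_simp

/-- Hypercontractivity with a defect: `‖P_t u‖₄ ≤ r^(1/4) ‖u‖₂` if `t ≥ C / 2`, where `r` bounds the
inverse weights of the mixture. -/
lemma integral_act_pow_four_le (hL : MixtureLevel P μ w ν C) {r : ℝ} (hr : ∀ i, 1 / w i ≤ r)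
    (hr0 : 0 < r) {t : ℝ≥0} (ht : 0 < t) (hCt : C / 2 ≤ t) {u : E → ℝ} (hm : Measurable u)
    {B : ℝ} (hB : ∀ x, |u x| ≤ B) :
    ∫ x, P.act t u x ^ 4 ∂μ ≤ r * (∫ x, u x ^ 2 ∂μ) ^ 2 := by
  have hS := hL.stationary
  have hT := P.isSymmSemigroup hS hL.reversible
  -- functions bounded away from zero are approximated by elements of the domain
  have hpos : ∀ {v : E → ℝ} {a b : ℝ}, Measurable v → 0 < a → (∀ x, v x ∈ Set.Icc a b) →
      ∫ x, P.act t v x ^ (4 : ℝ) ∂μ ≤ r * (∫ x, v x ^ (2 : ℝ) ∂μ) ^ 2 := by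
    intro v a b hvm ha hab
    have hv : MemLp v 2 μ := memLp_two_of_bound (B := b) hvm fun x => by
      rw [abs_of_pos (ha.trans_le (hab x).1)]; exact (hab x).2
    choose f g hf hg hfm hfab hfT _ _ hgen using fun k : ℕ =>
      P.exists_average hS hL.reversible hvm hab hv (h := 1 / ((k : ℝ≥0) + 1)) (by positivity)
    have h0 : Tendsto (fun k : ℕ => (hf k).toLp (f k)) atTop (𝓝 (hv.toLp v)) := by
      simp_rw [hfT]
      refine (hT.tendsto_orbitAverage (hv.toLp v)).comp (tendsto_nhdsWithin_iff.2 ⟨?_, ?_⟩)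
      · have h1 := tendsto_one_div_add_atTop_nhds_zero_nat (𝕜 := ℝ)
        refine h1.congr fun k => ?_
        push_cast
        rfl
      · refine Eventually.of_forall fun k => ?_
        simp only [Set.mem_Ioi]
        positivity
    have h1 : Tendsto (fun k : ℕ => (P.memLp_act hS t (hf k)).toLp _) atTop
        (𝓝 ((P.memLp_act hS t hv).toLp _)) := by
      have h2 := ((P.l2 hS t).continuous.tendsto (hv.toLp v)).comp h0
      rw [P.l2_toLp] at h2
      exact h2.congr fun k => P.l2_toLp hS t (hf k)
    have hF := contDiffOn_rpow_prod (b := b) ha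
    have hFm : Measurable (fun p : ℝ × ℝ => p.2 ^ p.1) := measurable_snd.pow measurable_fst
    have h4 : (4 : ℝ) ∈ Set.Icc (1 : ℝ) 4 := by norm_num
    have h2 : (2 : ℝ) ∈ Set.Icc (1 : ℝ) 4 := by norm_num
    have l4 := tendsto_integral_comp (l := atTop) (q := fun _ : ℕ => (4 : ℝ)) hF hFm
      (Eventually.of_forall fun _ => h4) h4 (fun k => P.act_mem_Icc t (hfm k) (hfab k))
      (P.act_mem_Icc t hvm hab) (fun k => P.measurable_act t (hfm k)) (P.measurable_act t hvm)
      (fun k => P.memLp_act hS t (hf k)) (P.memLp_act hS t hv) tendsto_const_nhds h1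
    have l2 := tendsto_integral_comp (l := atTop) (q := fun _ : ℕ => (2 : ℝ)) hF hFm
      (Eventually.of_forall fun _ => h2) h2 hfab hab hfm hvm hf hv tendsto_const_nhds h0
    exact le_of_tendsto_of_tendsto' l4 ((l2.pow 2).const_mul r) fun k =>
      hL.integral_act_rpow_four_le hr hr0 ht hCt (hfm k) ha (hfab k) (hf k) (hg k) (hgen k)
  have hpos' : ∀ δ : ℝ, 0 < δ → ∫ x, P.act t u x ^ 4 ∂μ
      ≤ r * (∫ x, u x ^ 2 ∂μ + 2 * δ * ∫ x, |u x| ∂μ + δ ^ 2) ^ 2 := by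
    intro δ hδ
    have hvm : Measurable fun x => δ + 1 * |u x| := (hm.abs.const_mul 1).const_add δ
    have habs : ∀ x, |(fun y => |u y|) x| ≤ B := fun x => by simpa using hB x
    have hab : ∀ x, δ + 1 * |u x| ∈ Set.Icc δ (δ + B) := fun x => by
      have := hB x
      have := abs_nonneg (u x)
      constructor <;> linarith
    have h1 := hpos hvm hδ hab
    have hfour : ∀ x : ℝ, x ^ (4 : ℝ) = x ^ 4 := fun x => by
      rw [← Real.rpow_natCast]; norm_num
    simp_rw [Real.rpow_two, hfour] at h1
    have hle : ∀ x, |P.act t u x| ≤ P.act t (fun x => δ + 1 * |u x|) x := fun x => by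
      rw [P.act_const_add_mul t hm.abs habs]
      linarith [P.abs_act_le_act_abs t u x]
    have hi : ∀ {v : E → ℝ} {b : ℝ}, Measurable v → (∀ x, |v x| ≤ b) →
        Integrable (fun x => v x ^ 4) μ := fun {v b} hv hb =>
      integrable_of_abs_le (B := b ^ 4) (hv.pow_const 4) fun x => by
        rw [abs_pow]; exact pow_le_pow_left₀ (abs_nonneg _) (hb x) 4
    have h2 : ∫ x, P.act t u x ^ 4 ∂μ ≤ ∫ x, P.act t (fun x => δ + 1 * |u x|) x ^ 4 ∂μ := by
      refine integral_mono (hi (P.measurable_act t hm) (P.abs_act_le t hm hB))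
        (hi (P.measurable_act t hvm) (P.abs_act_le t hvm (B := δ + B) fun x => ?_)) fun x => ?_
      · rw [abs_of_pos (hδ.trans_le (hab x).1)]; exact (hab x).2
      · have := pow_le_pow_left₀ (abs_nonneg _) (hle x) 4
        rwa [(by decide : Even 4).pow_abs] at this
    refine h2.trans (h1.trans (le_of_eq ?_))
    congr 2
    have i1 : Integrable (fun x => |u x|) μ := (integrable_of_abs_le hm hB).abs
    have i2 : Integrable (fun x => u x ^ 2) μ := (memLp_two_of_bound hm hB).integrable_sq
    have e1 : ∀ x, (δ + 1 * |u x|) ^ 2 = u x ^ 2 + 2 * δ * |u x| + δ ^ 2 := fun x => by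
      rw [← sq_abs (u x)]; ring
    simp_rw [e1]
    rw [integral_add (f := fun x => u x ^ 2 + 2 * δ * |u x|) (i2.add (i1.const_mul _))
      (integrable_const _), integral_add i2 (i1.const_mul _), integral_const_mul]
    simp
  have hlim : Tendsto (fun δ : ℝ => r * (∫ x, u x ^ 2 ∂μ + 2 * δ * ∫ x, |u x| ∂μ + δ ^ 2) ^ 2)
      (𝓝[>] 0) (𝓝 (r * (∫ x, u x ^ 2 ∂μ + 2 * 0 * ∫ x, |u x| ∂μ + 0 ^ 2) ^ 2)) :=
    Tendsto.mono_left (Continuous.tendsto (by fun_prop) 0) nhdsWithin_le_nhds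
  have := ge_of_tendsto hlim (by
    filter_upwards [self_mem_nhdsWithin] with δ hδ using hpos' δ hδ)
  simpa using this

end MixtureLevel

end HypercontractivityOrbit

/-! ### One step of the particle system -/

section ParticleStep

variable {E : Type*} [MeasurableSpace E] {N : ℕ} [NeZero N]

/-- The mean of `u` over the particles. -/
noncomputable def empiricalMean (u : E → ℝ) (x : Fin N → E) : ℝ := (N : ℝ)⁻¹ * ∑ i, u (x i)

lemma measurable_empiricalMean {u : E → ℝ} (hu : Measurable u) :
    Measurable (empiricalMean (N := N) u) :=
  (Finset.measurable_sum _ fun i _ => hu.comp (measurable_pi_apply i)).const_mul _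

lemma abs_empiricalMean_le {u : E → ℝ} {B : ℝ} (hu : ∀ x, |u x| ≤ B) (x : Fin N → E) :
    |empiricalMean u x| ≤ B := by
  have hN : (0 : ℝ) < N := Nat.cast_pos.2 (NeZero.pos N)
  rw [empiricalMean, abs_mul, abs_of_pos (inv_pos.2 hN), inv_mul_le_iff₀ hN]
  refine (Finset.abs_sum_le_sum_abs _ _).trans ?_
  refine (Finset.sum_le_sum fun i _ => hu (x i)).trans (le_of_eq ?_)
  simp

lemma empiricalMean_const (a : ℝ) (x : Fin N → E) : empiricalMean (fun _ => a) x = a := by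
  have hN : (N : ℝ) ≠ 0 := Nat.cast_ne_zero.2 (NeZero.ne N)
  simp [empiricalMean, hN]

lemma empiricalMean_sub_const (u : E → ℝ) (a : ℝ) (x : Fin N → E) :
    empiricalMean (fun y => u y - a) x = empiricalMean u x - a := by
  have hN : (N : ℝ) ≠ 0 := Nat.cast_ne_zero.2 (NeZero.ne N)
  simp [empiricalMean, mul_sub, hN]

/-- The second moments of the means over independent particles with law `ρ`. -/
lemma integral_empiricalMean_mul_pi (ρ : Measure E) [IsProbabilityMeasure ρ] {u v : E → ℝ}
    (hu : Measurable u) (hv : Measurable v) {A B : ℝ} (hA : ∀ x, |u x| ≤ A) (hB : ∀ x, |v x| ≤ B) :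
    ∫ x : Fin N → E, empiricalMean u x * empiricalMean v x ∂(Measure.pi fun _ => ρ)
      = (N : ℝ)⁻¹ * ∫ x, u x * v x ∂ρ + (1 - (N : ℝ)⁻¹) * ((∫ x, u x ∂ρ) * ∫ x, v x ∂ρ) := by
  have hN : (N : ℝ) ≠ 0 := Nat.cast_ne_zero.2 (NeZero.ne N)
  have hmul : ∀ x : Fin N → E, empiricalMean u x * empiricalMean v x
      = (N : ℝ)⁻¹ ^ 2 * ∑ i, ∑ j, u (x i) * v (x j) := fun x => by
    rw [empiricalMean, empiricalMean, ← Finset.sum_mul_sum]; ring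
  have hint : ∀ i j : Fin N, Integrable (fun x : Fin N → E => u (x i) * v (x j))
      (Measure.pi fun _ => ρ) := fun i j =>
    integrable_of_abs_le (B := A * B) ((hu.comp (measurable_pi_apply i)).mul
      (hv.comp (measurable_pi_apply j))) fun x => by
        rw [abs_mul]
        exact mul_le_mul (hA _) (hB _) (abs_nonneg _) ((abs_nonneg _).trans (hA (x i)))
  have hij : ∀ i j : Fin N, ∫ x : Fin N → E, u (x i) * v (x j) ∂(Measure.pi fun _ => ρ)
      = (∫ x, u x ∂ρ) * ∫ x, v x ∂ρ
        + if i = j then ∫ x, u x * v x ∂ρ - (∫ x, u x ∂ρ) * ∫ x, v x ∂ρ else 0 := by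
    intro i j
    have e : ∀ {h : E → ℝ}, Measurable h → ∀ k : Fin N,
        ∫ x : Fin N → E, h (x k) ∂(Measure.pi fun _ => ρ) = ∫ x, h x ∂ρ := fun hh k =>
      integral_comp_eval (i := k) hh.aestronglyMeasurable
    split_ifs with h
    · subst h
      have h2 := e (hu.mul hv) i
      simp only [Pi.mul_apply] at h2
      rw [h2]
      ring
    · have hI : iIndepFun (fun (k : Fin N) (x : Fin N → E) => x k) (Measure.pi fun _ => ρ) :=
        iIndepFun_pi (X := fun _ => id) fun _ => aemeasurable_id
      have h2 := (hI.indepFun h).comp hu hv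
      have h3 := h2.integral_fun_mul_eq_mul_integral
        (hu.comp (measurable_pi_apply i)).aestronglyMeasurable
        (hv.comp (measurable_pi_apply j)).aestronglyMeasurable
      simp only [Function.comp] at h3
      rw [h3, e hu i, e hv j, add_zero]
  simp_rw [hmul]
  rw [integral_const_mul, integral_finsetSum _ fun i _ => integrable_finsetSum _ fun j _ =>
    hint i j]
  simp_rw [fun i => integral_finsetSum _ fun j (_ : j ∈ Finset.univ) => hint i j, hij,
    Finset.sum_add_distrib]
  simp only [Finset.sum_const, Finset.card_univ, Fintype.card_fin, nsmul_eq_mul,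
    Finset.sum_ite_eq, Finset.mem_univ, if_true]
  field_simp
  ring

lemma lintegral_sum_pi (ρ : Measure E) [IsProbabilityMeasure ρ] {h : E → ℝ≥0∞}
    (hh : Measurable h) :
    ∫⁻ x : Fin N → E, (N : ℝ≥0∞)⁻¹ * ∑ i, h (x i) ∂(Measure.pi fun _ => ρ) = ∫⁻ x, h x ∂ρ := by
  have hN : (N : ℝ≥0∞) ≠ 0 := Nat.cast_ne_zero.2 (NeZero.ne N)
  have hm : ∀ i : Fin N, Measurable fun x : Fin N → E => h (x i) := fun i =>
    hh.comp (measurable_pi_apply i)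
  rw [lintegral_const_mul _ (Finset.measurable_sum _ fun i _ => hm i),
    lintegral_finsetSum _ fun i _ => hm i]
  have : ∀ i : Fin N, ∫⁻ x : Fin N → E, h (x i) ∂(Measure.pi fun _ => ρ) = ∫⁻ x, h x ∂ρ :=
    fun i => (measurePreserving_eval (fun _ => ρ) i).lintegral_comp hh
  simp_rw [this]
  rw [Finset.sum_const, Finset.card_univ, Fintype.card_fin, nsmul_eq_mul, ← mul_assoc,
    ENNReal.inv_mul_cancel hN (ENNReal.natCast_ne_top N), one_mul]

variable {μ μ' : Measure E} {κ : Kernel E E} [IsMarkovKernel κ]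

/-- The law of one particle after resampling and moving, given the particles `x`. -/
noncomputable def offspringLaw (μ' μ : Measure E) (κ : Kernel E E) (x : Fin N → E) : Measure E :=
  ∑ i, (smcWeight μ' μ x i : ℝ≥0∞) • κ (x i)

instance (x : Fin N → E) : IsProbabilityMeasure (offspringLaw μ' μ κ x) := by
  constructor
  simp only [offspringLaw, Measure.coe_finsetSum, Finset.sum_apply, Measure.smul_apply,
    measure_univ, smul_eq_mul, mul_one]
  exact_mod_cast sum_smcWeight μ' μ (NeZero.ne N) x

/-- Resampling followed by independent moves. -/
noncomputable def particleKernel (μ' μ : Measure E) (κ : Kernel E E) [IsMarkovKernel κ] (N : ℕ) :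
    Kernel (Fin N → E) (Fin N → E) :=
  (moveKernel κ N) ∘ₖ (resampleKernel μ' μ N)

/-- Given the present particles, the next ones are independent and identically distributed. -/
lemma particleKernel_apply (x : Fin N → E) :
    particleKernel μ' μ κ N x = Measure.pi fun _ => offspringLaw μ' μ κ x := by
  symm
  refine Measure.pi_eq fun s hs => ?_
  have hm : Measurable fun y => moveKernel κ N y (Set.univ.pi s) :=
    (moveKernel κ N).measurable_coe (MeasurableSet.univ_pi hs)
  rw [particleKernel, Kernel.comp_apply' _ _ _ (MeasurableSet.univ_pi hs)]
  have h1 : resampleKernel μ' μ N x = ∑ a : Fin N → Fin N,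
    ((∏ i, smcWeight μ' μ x (a i) : ℝ≥0) : ℝ≥0∞) • Measure.dirac (fun i => x (a i)) := rfl
  have h2 : ∀ y, moveKernel κ N y (Set.univ.pi s) = ∏ i, κ (y i) (s i) := fun y =>
    Measure.pi_pi _ _
  rw [h1, lintegral_finsetSum_measure]
  simp_rw [lintegral_smul_measure, lintegral_dirac' _ hm, h2, offspringLaw, Measure.coe_finsetSum,
    Finset.sum_apply, Measure.smul_apply, smul_eq_mul, ENNReal.ofNNReal_finsetProd,
    ← Finset.prod_mul_distrib]
  rw [Finset.prod_univ_sum, Fintype.piFinset_univ]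

instance : IsMarkovKernel (particleKernel μ' μ κ N) :=
  ⟨fun x => by rw [particleKernel_apply]; infer_instance⟩

/-- The mean of the density ratio over the particles, the factor by which the normalization of
the particle approximation changes. -/
noncomputable def meanRatio (μ' μ : Measure E) (x : Fin N → E) : ℝ≥0 :=
  (N : ℝ≥0)⁻¹ * ∑ i, densityRatio μ' μ (x i)

lemma measurable_densityRatio : Measurable (densityRatio μ' μ) :=
  (Measure.measurable_rnDeriv μ' μ).ennreal_toNNReal

lemma measurable_meanRatio : Measurable (meanRatio (N := N) μ' μ) :=
  (Finset.measurable_sum _ fun i _ =>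
    measurable_densityRatio.comp (measurable_pi_apply i)).const_mul _

/-- The normalization cancels, also when all the unnormalized weights vanish. -/
lemma meanRatio_mul_smcWeight (x : Fin N → E) (i : Fin N) :
    meanRatio μ' μ x * smcWeight μ' μ x i = (N : ℝ≥0)⁻¹ * densityRatio μ' μ (x i) := by
  rw [meanRatio, smcWeight]
  split_ifs with h
  · rw [(Finset.sum_eq_zero_iff.1 h) i (Finset.mem_univ i), h]
    simp
  · rw [mul_assoc, mul_div_cancel₀ _ h]

lemma meanRatio_mul_integral_offspringLaw (x : Fin N → E) {u : E → ℝ} (hu : Measurable u) {B : ℝ}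
    (hB : ∀ x, |u x| ≤ B) :
    meanRatio μ' μ x * ∫ y, u y ∂(offspringLaw μ' μ κ x)
      = empiricalMean (fun y => densityRatio μ' μ y * ∫ z, u z ∂(κ y)) x := by
  rw [offspringLaw, integral_finsetSum_measure fun i _ =>
    (integrable_of_abs_le hu hB).smul_measure ENNReal.coe_ne_top, Finset.mul_sum, empiricalMean,
    Finset.mul_sum]
  refine Finset.sum_congr rfl fun i _ => ?_
  have h := congrArg ((↑) : ℝ≥0 → ℝ) (meanRatio_mul_smcWeight (μ' := μ') (μ := μ) x i)
  push_cast at h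
  rw [integral_smul_measure, ENNReal.coe_toReal, smul_eq_mul, ← mul_assoc, h, mul_assoc]

lemma meanRatio_mul_lintegral_offspringLaw (x : Fin N → E) {h : E → ℝ≥0∞} :
    meanRatio μ' μ x * ∫⁻ y, h y ∂(offspringLaw μ' μ κ x)
      = (N : ℝ≥0∞)⁻¹ * ∑ i, densityRatio μ' μ (x i) * ∫⁻ z, h z ∂(κ (x i)) := by
  have hN : (N : ℝ≥0) ≠ 0 := Nat.cast_ne_zero.2 (NeZero.ne N)
  rw [offspringLaw, lintegral_finsetSum_measure, Finset.mul_sum, Finset.mul_sum]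
  refine Finset.sum_congr rfl fun i _ => ?_
  have h := congrArg ((↑) : ℝ≥0 → ℝ≥0∞) (meanRatio_mul_smcWeight (μ' := μ') (μ := μ) x i)
  rw [ENNReal.coe_mul, ENNReal.coe_mul, ENNReal.coe_inv hN, ENNReal.coe_natCast] at h
  rw [lintegral_smul_measure, smul_eq_mul, ← mul_assoc, h, mul_assoc]

lemma lintegral_densityRatio_mul [SigmaFinite μ] [SigmaFinite μ'] (hac : μ' ≪ μ) {h : E → ℝ≥0∞}
    (hh : Measurable h) :
    ∫⁻ x, densityRatio μ' μ x * h x ∂μ = ∫⁻ x, h x ∂μ' := by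
  rw [← lintegral_rnDeriv_mul hac hh.aemeasurable]
  refine lintegral_congr_ae ?_
  filter_upwards [Measure.rnDeriv_lt_top μ' μ] with x hx
  rw [densityRatio, ENNReal.coe_toNNReal hx.ne]

end ParticleStep

/-! ### The particle system with its normalization -/

section WeightedParticles

variable {E : Type*} [MeasurableSpace E]

/-- The joint law of the particles at level `k` and of the normalization `z`, the product of the
mean density ratios over the particles of the levels before `k`. -/
noncomputable def weightedLaw (μ : ℕ → Measure E) (P : ℕ → MarkovSemigroup E) (t : ℕ → ℝ≥0)
    (N : ℕ) : ℕ → Measure (ℝ≥0 × (Fin N → E))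
  | 0 => 0
  | 1 => (Measure.pi fun _ => μ 1).map fun x => (1, x)
  | k + 2 => ((weightedLaw μ P t N (k + 1)) ⊗ₘ
      ((particleKernel (μ (k + 2)) (μ (k + 1)) ((P (k + 2)).kernel (t (k + 2))) N).comap Prod.snd
        measurable_snd)).map
      fun p => (p.1.1 * meanRatio (μ (k + 2)) (μ (k + 1)) p.1.2, p.2)

/-- The assumptions on a sequence of distributions `μ 1, …, μ n` and semigroups that the analysis
of the second moments of the particle system uses. -/
structure SMCSequence (n : ℕ) (μ : ℕ → Measure E) (P : ℕ → MarkovSemigroup E) (γ : ℝ) : Prop where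
  prob : ∀ k, 1 ≤ k → k ≤ n → IsProbabilityMeasure (μ k)
  one_le : 1 ≤ γ
  abs_cont : ∀ k, 1 ≤ k → k < n → μ (k + 1) ≪ μ k
  ratio_le : ∀ k, 1 ≤ k → k < n →
    ∀ᵐ x ∂(μ k), (μ (k + 1)).rnDeriv (μ k) x ≤ ENNReal.ofReal γ
  invariant : ∀ k, 1 ≤ k → k ≤ n → ∀ s, ((P k).kernel s).Invariant (μ k)

/-- The density ratio, cut off at its essential bound `γ` so that it is bounded everywhere. -/
noncomputable def cutRatio (γ : ℝ) (μ' μ : Measure E) (x : E) : ℝ :=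
  min (densityRatio μ' μ x : ℝ) γ

/-- The operator `u ↦ (dμ_{k+1}/dμ_k) P_{k+1} u`, which takes functions on level `k + 1` to functions
on level `k` and preserves integrals. -/
noncomputable def transfer (μ : ℕ → Measure E) (P : ℕ → MarkovSemigroup E) (t : ℕ → ℝ≥0) (γ : ℝ)
    (k : ℕ) (u : E → ℝ) (x : E) : ℝ :=
  cutRatio γ (μ (k + 1)) (μ k) x * (P (k + 1)).act (t (k + 1)) u x

/-- The second moments `𝔼[z² η(u) η(v)]` of the unnormalized particle approximation at level `k`. -/
noncomputable def secondMoment (μ : ℕ → Measure E) (P : ℕ → MarkovSemigroup E) (t : ℕ → ℝ≥0)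
    (N k : ℕ) (u v : E → ℝ) : ℝ :=
  ∫ p, (p.1 : ℝ) ^ 2 * (empiricalMean u p.2 * empiricalMean v p.2) ∂(weightedLaw μ P t N k)

variable {μ : ℕ → Measure E} {P : ℕ → MarkovSemigroup E} {t : ℕ → ℝ≥0} {γ : ℝ} {n N k : ℕ}
  [NeZero N]

lemma measurable_weightedInit :
    Measurable fun x : Fin N → E => ((1 : ℝ≥0), x) := measurable_const.prodMk measurable_id

lemma measurable_weightedStep {μ' μ : Measure E} :
    Measurable fun p : (ℝ≥0 × (Fin N → E)) × (Fin N → E) =>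
      (p.1.1 * meanRatio μ' μ p.1.2, p.2) :=
  ((measurable_fst.comp measurable_fst).mul
    (measurable_meanRatio.comp (measurable_snd.comp measurable_fst))).prodMk measurable_snd

lemma isProbabilityMeasure_weightedLaw (h1 : IsProbabilityMeasure (μ 1)) :
    ∀ k, IsProbabilityMeasure (weightedLaw μ P t N (k + 1))
  | 0 => Measure.isProbabilityMeasure_map measurable_weightedInit.aemeasurable
  | k + 1 => by
    have := isProbabilityMeasure_weightedLaw h1 k
    exact Measure.isProbabilityMeasure_map measurable_weightedStep.aemeasurable

lemma map_snd_weightedLaw (h1 : IsProbabilityMeasure (μ 1)) :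
    ∀ k, (weightedLaw μ P t N (k + 1)).map Prod.snd = smcLaw μ P t N (k + 1)
  | 0 => by
    rw [weightedLaw, smcLaw, Measure.map_map measurable_snd measurable_weightedInit]
    exact Measure.map_id
  | k + 1 => by
    have := isProbabilityMeasure_weightedLaw (P := P) (t := t) (N := N) h1 k
    rw [weightedLaw, smcLaw, Measure.map_map measurable_snd measurable_weightedStep,
      ← map_snd_weightedLaw h1 k, Measure.comp_assoc]
    have e : (Prod.snd ∘ fun p : (ℝ≥0 × (Fin N → E)) × (Fin N → E) =>
      (p.1.1 * meanRatio (μ (k + 2)) (μ (k + 1)) p.1.2, p.2)) = Prod.snd := rfl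
    rw [e, ← Measure.snd, Measure.snd_compProd]
    ext s hs
    rw [Measure.bind_apply hs (Kernel.aemeasurable _), Measure.bind_apply hs (Kernel.aemeasurable _),
      lintegral_map (Kernel.measurable_coe _ hs) measurable_snd]
    rfl

lemma lintegral_weightedLaw_succ (h1 : IsProbabilityMeasure (μ 1))
    {F : ℝ≥0 × (Fin N → E) → ℝ≥0∞} (hF : Measurable F) :
    ∫⁻ p, F p ∂(weightedLaw μ P t N (k + 2))
      = ∫⁻ p, ∫⁻ y, F (p.1 * meanRatio (μ (k + 2)) (μ (k + 1)) p.2, y)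
        ∂(Measure.pi fun _ => offspringLaw (μ (k + 2)) (μ (k + 1))
          ((P (k + 2)).kernel (t (k + 2))) p.2) ∂(weightedLaw μ P t N (k + 1)) := by
  have := isProbabilityMeasure_weightedLaw (P := P) (t := t) (N := N) h1 k
  have h2 := Measure.lintegral_compProd (μ := weightedLaw μ P t N (k + 1))
    (κ := (particleKernel (μ (k + 2)) (μ (k + 1)) ((P (k + 2)).kernel (t (k + 2))) N).comap Prod.snd
        measurable_snd)
    (hF.comp (measurable_weightedStep (μ' := μ (k + 2)) (μ := μ (k + 1))))
  simp only [Function.comp_def, Kernel.comap_apply, particleKernel_apply] at h2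
  rw [weightedLaw, lintegral_map hF measurable_weightedStep, h2]

/-- The particle approximation with its normalization is unbiased. -/
lemma lintegral_weightedLaw (hA : SMCSequence n μ P γ) :
    ∀ k, k + 1 ≤ n → ∀ {h : E → ℝ≥0∞}, Measurable h →
      ∫⁻ p, (p.1 : ℝ≥0∞) * ((N : ℝ≥0∞)⁻¹ * ∑ i, h (p.2 i)) ∂(weightedLaw μ P t N (k + 1))
        = ∫⁻ x, h x ∂(μ (k + 1))
  | 0, hk, h, hh => by
    have := hA.prob 1 le_rfl hk
    have hm : Measurable fun p : ℝ≥0 × (Fin N → E) =>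
        (p.1 : ℝ≥0∞) * ((N : ℝ≥0∞)⁻¹ * ∑ i, h (p.2 i)) :=
      measurable_fst.coe_nnreal_ennreal.mul ((Finset.measurable_sum _ fun i _ =>
        hh.comp ((measurable_pi_apply i).comp measurable_snd)).const_mul _)
    rw [weightedLaw, lintegral_map hm measurable_weightedInit]
    simp only [ENNReal.coe_one, one_mul]
    exact lintegral_sum_pi (μ 1) hh
  | k + 1, hk, h, hh => by
    have i1 := hA.prob 1 le_rfl (by omega)
    have i2 := hA.prob (k + 1) (by omega) (by omega)
    have i3 := hA.prob (k + 2) (by omega) (by omega)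
    have hm : Measurable fun p : ℝ≥0 × (Fin N → E) =>
        (p.1 : ℝ≥0∞) * ((N : ℝ≥0∞)⁻¹ * ∑ i, h (p.2 i)) :=
      measurable_fst.coe_nnreal_ennreal.mul ((Finset.measurable_sum _ fun i _ =>
        hh.comp ((measurable_pi_apply i).comp measurable_snd)).const_mul _)
    have hmN : Measurable fun y : Fin N → E => (N : ℝ≥0∞)⁻¹ * ∑ i, h (y i) :=
      (Finset.measurable_sum _ fun i _ => hh.comp (measurable_pi_apply i)).const_mul _
    have hmκ : Measurable fun x => ∫⁻ z, h z ∂((P (k + 2)).kernel (t (k + 2)) x) :=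
      hh.lintegral_kernel
    rw [lintegral_weightedLaw_succ i1 hm]
    simp_rw [lintegral_const_mul _ hmN, lintegral_sum_pi _ hh, ENNReal.coe_mul, mul_assoc,
      meanRatio_mul_lintegral_offspringLaw]
    rw [lintegral_weightedLaw hA k (by omega)
      (h := fun x => densityRatio (μ (k + 2)) (μ (k + 1)) x *
        ∫⁻ z, h z ∂((P (k + 2)).kernel (t (k + 2)) x))
      (measurable_densityRatio.coe_nnreal_ennreal.mul hmκ),
      lintegral_densityRatio_mul (hA.abs_cont (k + 1) (by omega) (by omega)) hmκ,
      ← Measure.lintegral_bind (Kernel.aemeasurable _) hh.aemeasurable,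
      hA.invariant (k + 2) (by omega) hk (t (k + 2))]

/-- Almost surely, the particles avoid a given null set, or else their normalization vanishes. -/
lemma ae_weightedLaw (hA : SMCSequence n μ P γ) (hk : k + 1 ≤ n) {p : E → Prop}
    (hp : ∀ᵐ x ∂(μ (k + 1)), p x) :
    ∀ᵐ q ∂(weightedLaw μ P t N (k + 1)), q.1 = 0 ∨ ∀ i, p (q.2 i) := by
  set s := toMeasurable (μ (k + 1)) {x | ¬ p x} with hs
  have hsm : MeasurableSet s := measurableSet_toMeasurable _ _
  have hs0 : μ (k + 1) s = 0 := by rw [hs, measure_toMeasurable]; exact hp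
  have hm : Measurable (s.indicator (fun _ => (1 : ℝ≥0∞))) := measurable_const.indicator hsm
  have h1 := lintegral_weightedLaw (P := P) (t := t) (N := N) hA k hk hm
  have hm2 : Measurable fun p : ℝ≥0 × (Fin N → E) =>
      (p.1 : ℝ≥0∞) * ((N : ℝ≥0∞)⁻¹ * ∑ i, s.indicator (fun _ => (1 : ℝ≥0∞)) (p.2 i)) :=
    measurable_fst.coe_nnreal_ennreal.mul ((Finset.measurable_sum _ fun i _ =>
      hm.comp ((measurable_pi_apply i).comp measurable_snd)).const_mul _)
  rw [lintegral_indicator_const hsm, hs0, mul_zero, lintegral_eq_zero_iff hm2] at h1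
  filter_upwards [h1] with q hq
  simp only [Pi.zero_apply, mul_eq_zero, ENNReal.coe_eq_zero, ENNReal.inv_eq_zero,
    ENNReal.natCast_ne_top, false_or, Finset.sum_eq_zero_iff] at hq
  refine hq.imp id fun h i => ?_
  by_contra hi
  have h2 := h i (Finset.mem_univ i)
  have h3 : q.2 i ∈ s := subset_toMeasurable _ _ hi
  simp [h3] at h2

lemma measurable_cutRatio {μ' μ : Measure E} : Measurable (cutRatio γ μ' μ) :=
  measurable_densityRatio.coe_nnreal_real.min measurable_const

lemma cutRatio_nonneg (hγ : 1 ≤ γ) {μ' μ : Measure E} (x : E) : 0 ≤ cutRatio γ μ' μ x :=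
  le_min (NNReal.coe_nonneg _) (by linarith)

lemma cutRatio_le {μ' μ : Measure E} (x : E) : cutRatio γ μ' μ x ≤ γ := min_le_right _ _

lemma abs_cutRatio_le (hγ : 1 ≤ γ) {μ' μ : Measure E} (x : E) : |cutRatio γ μ' μ x| ≤ γ := by
  rw [abs_of_nonneg (cutRatio_nonneg hγ x)]; exact cutRatio_le x

lemma ae_densityRatio_le (hA : SMCSequence n μ P γ) (hk : k + 1 < n) :
    ∀ᵐ x ∂(μ (k + 1)), (densityRatio (μ (k + 2)) (μ (k + 1)) x : ℝ) ≤ γ := by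
  filter_upwards [hA.ratio_le (k + 1) (by omega) hk] with x hx
  have := ENNReal.toReal_le_of_le_ofReal (by linarith [hA.one_le]) hx
  exact this

lemma ae_normalization_le (hA : SMCSequence n μ P γ) :
    ∀ k, k + 1 ≤ n → ∀ᵐ p ∂(weightedLaw μ P t N (k + 1)), (p.1 : ℝ) ≤ γ ^ k
  | 0, _ => by
    have hs : MeasurableSet {p : ℝ≥0 × (Fin N → E) | (p.1 : ℝ) ≤ γ ^ 0} :=
      measurableSet_le measurable_fst.coe_nnreal_real measurable_const
    rw [weightedLaw, ae_map_iff measurable_weightedInit.aemeasurable hs]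
    simp
  | k + 1, hk => by
    have i1 := hA.prob 1 le_rfl (by omega)
    have := isProbabilityMeasure_weightedLaw (P := P) (t := t) (N := N) i1 k
    have hs : MeasurableSet {p : ℝ≥0 × (Fin N → E) | (p.1 : ℝ) ≤ γ ^ (k + 1)} :=
      measurableSet_le measurable_fst.coe_nnreal_real measurable_const
    rw [weightedLaw, ae_map_iff measurable_weightedStep.aemeasurable hs]
    refine (Measure.ae_compProd_iff (p := fun x : (ℝ≥0 × (Fin N → E)) × (Fin N → E) =>
      ((x.1.1 * meanRatio (μ (k + 2)) (μ (k + 1)) x.1.2 : ℝ≥0) : ℝ) ≤ γ ^ (k + 1))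
      (measurable_weightedStep hs)).2 ?_
    have hγ0 : 0 ≤ γ := by linarith [hA.one_le]
    filter_upwards [ae_normalization_le hA k (by omega),
      ae_weightedLaw hA (by omega) (ae_densityRatio_le hA (by omega : k + 1 < n))] with p hp1 hp2
    refine ae_of_all _ fun y => ?_
    simp only [NNReal.coe_mul]
    rcases hp2 with h0 | h0
    · rw [h0]; simp only [NNReal.coe_zero, zero_mul]; positivity
    · have h2 : (meanRatio (μ (k + 2)) (μ (k + 1)) p.2 : ℝ) ≤ γ := by
        have hN : (0 : ℝ) < N := Nat.cast_pos.2 (NeZero.pos N)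
        rw [meanRatio]
        push_cast
        rw [inv_mul_le_iff₀ hN]
        refine (Finset.sum_le_sum fun i _ => h0 i).trans (le_of_eq ?_)
        simp
      rw [pow_succ]
      exact mul_le_mul hp1 h2 (NNReal.coe_nonneg _) (by positivity)

lemma integrable_secondMoment (hA : SMCSequence n μ P γ) (hk : k + 1 ≤ n) {u v : E → ℝ}
    (hu : Measurable u) (hv : Measurable v) {A B : ℝ} (hA' : ∀ x, |u x| ≤ A)
    (hB : ∀ x, |v x| ≤ B) :
    Integrable (fun p : ℝ≥0 × (Fin N → E) =>
      (p.1 : ℝ) ^ 2 * (empiricalMean u p.2 * empiricalMean v p.2))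
      (weightedLaw μ P t N (k + 1)) := by
  have i1 := hA.prob 1 le_rfl (by omega)
  have := isProbabilityMeasure_weightedLaw (P := P) (t := t) (N := N) i1 k
  refine Integrable.of_bound (C := (γ ^ k) ^ 2 * (A * B)) ?_ ?_
  · exact ((measurable_fst.coe_nnreal_real.pow_const 2).mul
      (((measurable_empiricalMean hu).comp measurable_snd).mul
      ((measurable_empiricalMean hv).comp measurable_snd))).aestronglyMeasurable
  · filter_upwards [ae_normalization_le hA k hk] with p hp
    rw [Real.norm_eq_abs, abs_mul, abs_mul, abs_of_nonneg (sq_nonneg _)]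
    have hA0 : 0 ≤ A := (abs_nonneg _).trans (abs_empiricalMean_le hA' p.2)
    exact mul_le_mul (pow_le_pow_left₀ p.1.coe_nonneg hp 2)
      (mul_le_mul (abs_empiricalMean_le hA' _) (abs_empiricalMean_le hB _) (abs_nonneg _) hA0)
      (by positivity) (by positivity)

lemma measurable_transfer {u : E → ℝ} (hu : Measurable u) :
    Measurable (transfer μ P t γ k u) :=
  measurable_cutRatio.mul ((P (k + 1)).measurable_act _ hu)

lemma abs_transfer_le (hγ : 1 ≤ γ) {u : E → ℝ} (hu : Measurable u) {B : ℝ} (hB : ∀ x, |u x| ≤ B)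
    (x : E) : |transfer μ P t γ k u x| ≤ γ * B := by
  rw [transfer, abs_mul]
  exact mul_le_mul (abs_cutRatio_le hγ x) ((P (k + 1)).abs_act_le _ hu hB x) (abs_nonneg _)
    (by linarith)

lemma secondMoment_one (h1 : IsProbabilityMeasure (μ 1)) {u v : E → ℝ} (hu : Measurable u)
    (hv : Measurable v) {A B : ℝ} (hA : ∀ x, |u x| ≤ A) (hB : ∀ x, |v x| ≤ B) :
    secondMoment μ P t N 1 u v = (N : ℝ)⁻¹ * ∫ x, u x * v x ∂(μ 1)
      + (1 - (N : ℝ)⁻¹) * ((∫ x, u x ∂(μ 1)) * ∫ x, v x ∂(μ 1)) := by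
  have hm : Measurable fun p : ℝ≥0 × (Fin N → E) =>
      (p.1 : ℝ) ^ 2 * (empiricalMean u p.2 * empiricalMean v p.2) :=
    (measurable_fst.coe_nnreal_real.pow_const 2).mul
      (((measurable_empiricalMean hu).comp measurable_snd).mul
      ((measurable_empiricalMean hv).comp measurable_snd))
  rw [secondMoment, weightedLaw, integral_map measurable_weightedInit.aemeasurable
    hm.aestronglyMeasurable]
  simp only [NNReal.coe_one, one_pow, one_mul]
  exact integral_empiricalMean_mul_pi (μ 1) hu hv hA hB

/-- The recursion for the second moments. -/
lemma secondMoment_succ (hA : SMCSequence n μ P γ) (hk : k + 2 ≤ n) {u v : E → ℝ}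
    (hu : Measurable u) (hv : Measurable v) {A B : ℝ} (hA' : ∀ x, |u x| ≤ A)
    (hB : ∀ x, |v x| ≤ B) :
    secondMoment μ P t N (k + 2) u v
      = (N : ℝ)⁻¹ * secondMoment μ P t N (k + 1) (cutRatio γ (μ (k + 2)) (μ (k + 1)))
          (transfer μ P t γ (k + 1) fun x => u x * v x)
        + (1 - (N : ℝ)⁻¹) * secondMoment μ P t N (k + 1) (transfer μ P t γ (k + 1) u)
          (transfer μ P t γ (k + 1) v) := by
  have i1 := hA.prob 1 le_rfl (by omega)
  have := isProbabilityMeasure_weightedLaw (P := P) (t := t) (N := N) i1 k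
  have hint := integrable_secondMoment (t := t) (N := N) hA hk hu hv hA' hB
  have huv : ∀ x, |u x * v x| ≤ A * B := fun x => by
    rw [abs_mul]
    exact mul_le_mul (hA' x) (hB x) (abs_nonneg _) ((abs_nonneg _).trans (hA' x))
  have huvm : Measurable fun x => u x * v x := hu.mul hv
  have hm : Measurable fun p : ℝ≥0 × (Fin N → E) =>
      (p.1 : ℝ) ^ 2 * (empiricalMean u p.2 * empiricalMean v p.2) :=
    (measurable_fst.coe_nnreal_real.pow_const 2).mul
      (((measurable_empiricalMean hu).comp measurable_snd).mul
      ((measurable_empiricalMean hv).comp measurable_snd))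
  rw [secondMoment, weightedLaw, integral_map measurable_weightedStep.aemeasurable
    hm.aestronglyMeasurable]
  rw [weightedLaw, integrable_map_measure hm.aestronglyMeasurable
    measurable_weightedStep.aemeasurable] at hint
  have hint2 := Measure.integral_compProd hint
  simp only [Function.comp_def] at hint2
  rw [hint2]
  have j1 := integrable_secondMoment (t := t) (N := N) hA (by omega : k + 1 ≤ n)
    (measurable_cutRatio (γ := γ) (μ' := μ (k + 2)) (μ := μ (k + 1)))
    (measurable_transfer (μ := μ) (P := P) (t := t) (γ := γ) (k := k + 1) huvm)
    (abs_cutRatio_le hA.one_le) (abs_transfer_le hA.one_le huvm huv)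
  have j2 := integrable_secondMoment (t := t) (N := N) hA (by omega : k + 1 ≤ n)
    (measurable_transfer (μ := μ) (P := P) (t := t) (γ := γ) (k := k + 1) hu)
    (measurable_transfer (μ := μ) (P := P) (t := t) (γ := γ) (k := k + 1) hv)
    (abs_transfer_le hA.one_le hu hA') (abs_transfer_le hA.one_le hv hB)
  rw [secondMoment, secondMoment, ← integral_const_mul, ← integral_const_mul,
    ← integral_add (j1.const_mul _) (j2.const_mul _)]
  refine integral_congr_ae ?_
  filter_upwards [ae_weightedLaw hA (by omega)
    (ae_densityRatio_le hA (by omega : k + 1 < n))] with p hp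
  simp only [Kernel.comap_apply, particleKernel_apply]
  rw [integral_const_mul, integral_empiricalMean_mul_pi _ hu hv hA' hB]
  rcases hp with h0 | h0
  · simp [h0]
  · have e1 : ∀ {h : E → ℝ},
        empiricalMean (fun y => densityRatio (μ (k + 2)) (μ (k + 1)) y * h y) p.2
        = empiricalMean (fun y => cutRatio γ (μ (k + 2)) (μ (k + 1)) y * h y) p.2 := fun {h} => by
      simp only [empiricalMean, cutRatio]
      congr 1
      exact Finset.sum_congr rfl fun i _ => by rw [min_eq_left (h0 i)]
    have e2 : ∀ {h : E → ℝ} {C : ℝ}, Measurable h → (∀ x, |h x| ≤ C) →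
        (meanRatio (μ (k + 2)) (μ (k + 1)) p.2 : ℝ) * ∫ y, h y ∂(offspringLaw (μ (k + 2))
          (μ (k + 1)) ((P (k + 2)).kernel (t (k + 2))) p.2)
        = empiricalMean (transfer μ P t γ (k + 1) h) p.2 := fun hm hb => by
      rw [meanRatio_mul_integral_offspringLaw p.2 hm hb, e1]
      rfl
    have e3 : (meanRatio (μ (k + 2)) (μ (k + 1)) p.2 : ℝ)
        = empiricalMean (cutRatio γ (μ (k + 2)) (μ (k + 1))) p.2 := by
      have := @e1 (fun _ => 1)
      simp only [mul_one] at this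
      change _ = empiricalMean (fun y => cutRatio γ (μ (k + 2)) (μ (k + 1)) y) p.2
      rw [← this, meanRatio, empiricalMean]
      push_cast
      rfl
    rw [← e2 huvm huv, ← e2 hu hA', ← e2 hv hB, ← e3]
    push_cast
    ring

end WeightedParticles

/-! ### Expansion of the second moments -/

section Expansion

variable {E : Type*} [MeasurableSpace E]

/-- Bounded measurable functions. -/
structure BddMeasurable (u : E → ℝ) : Prop where
  measurable : Measurable u
  bdd : ∃ B, ∀ x, |u x| ≤ B

namespace BddMeasurable

variable {u v : E → ℝ}

lemma const (a : ℝ) : BddMeasurable fun _ : E => a := ⟨measurable_const, |a|, fun _ => le_rfl⟩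

lemma mul (hu : BddMeasurable u) (hv : BddMeasurable v) : BddMeasurable fun x => u x * v x := by
  obtain ⟨A, hA⟩ := hu.bdd
  obtain ⟨B, hB⟩ := hv.bdd
  refine ⟨hu.measurable.mul hv.measurable, A * B, fun x => ?_⟩
  rw [abs_mul]
  exact mul_le_mul (hA x) (hB x) (abs_nonneg _) ((abs_nonneg _).trans (hA x))

lemma pow (hu : BddMeasurable u) (m : ℕ) : BddMeasurable fun x => u x ^ m := by
  obtain ⟨A, hA⟩ := hu.bdd
  refine ⟨hu.measurable.pow_const m, A ^ m, fun x => ?_⟩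
  rw [abs_pow]
  exact pow_le_pow_left₀ (abs_nonneg _) (hA x) m

lemma abs (hu : BddMeasurable u) : BddMeasurable fun x => |u x| := by
  obtain ⟨A, hA⟩ := hu.bdd
  exact ⟨hu.measurable.abs, A, fun x => by rw [abs_abs]; exact hA x⟩

lemma act (hu : BddMeasurable u) (P : MarkovSemigroup E) (t : ℝ≥0) : BddMeasurable (P.act t u) := by
  obtain ⟨A, hA⟩ := hu.bdd
  exact ⟨P.measurable_act t hu.measurable, A, P.abs_act_le t hu.measurable hA⟩

lemma cutRatio {γ : ℝ} (hγ : 1 ≤ γ) (μ' μ : Measure E) : BddMeasurable (cutRatio γ μ' μ) :=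
  ⟨measurable_cutRatio, γ, abs_cutRatio_le hγ⟩

lemma transfer (hu : BddMeasurable u) {γ : ℝ} (hγ : 1 ≤ γ) (μ : ℕ → Measure E)
    (P : ℕ → MarkovSemigroup E) (t : ℕ → ℝ≥0) (k : ℕ) : BddMeasurable (transfer μ P t γ k u) :=
  (cutRatio hγ _ _).mul (hu.act _ _)

lemma integrable (hu : BddMeasurable u) (μ : Measure E) [IsFiniteMeasure μ] : Integrable u μ := by
  obtain ⟨A, hA⟩ := hu.bdd
  exact integrable_of_abs_le hu.measurable hA

end BddMeasurable

/-- The composition `Q_{i,i+d} = q_i ⋯ q_{i+d-1}` of transfer operators, from functions on level `i + d`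
to functions on level `i`. -/
noncomputable def transferIter (μ : ℕ → Measure E) (P : ℕ → MarkovSemigroup E) (t : ℕ → ℝ≥0)
    (γ : ℝ) : ℕ → ℕ → (E → ℝ) → E → ℝ
  | _, 0, u => u
  | i, d + 1, u => transfer μ P t γ i (transferIter μ P t γ (i + 1) d u)

variable {μ : ℕ → Measure E} {P : ℕ → MarkovSemigroup E} {t : ℕ → ℝ≥0} {γ : ℝ} {n N k : ℕ}

lemma transferIter_succ (d : ℕ) : ∀ (i : ℕ) (u : E → ℝ),
    transferIter μ P t γ i (d + 1) u = transferIter μ P t γ i d (transfer μ P t γ (i + d) u) := by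
  induction d with
  | zero => intro i u; rfl
  | succ d ih =>
    intro i u
    rw [transferIter, ih (i + 1) u, show i + 1 + d = i + (d + 1) by omega]
    rfl

lemma BddMeasurable.transferIter {u : E → ℝ} (hu : BddMeasurable u) (hγ : 1 ≤ γ)
    (μ : ℕ → Measure E) (P : ℕ → MarkovSemigroup E) (t : ℕ → ℝ≥0) (d : ℕ) :
    ∀ i, BddMeasurable (transferIter μ P t γ i d u) := by
  induction d with
  | zero => exact fun _ => hu
  | succ d ih => exact fun i => (ih (i + 1)).transfer hγ μ P t i

lemma transfer_nonneg (hγ : 1 ≤ γ) {u : E → ℝ} (hu : ∀ x, 0 ≤ u x) (x : E) :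
    0 ≤ transfer μ P t γ k u x :=
  mul_nonneg (cutRatio_nonneg hγ x) (integral_nonneg hu)

lemma transferIter_nonneg (hγ : 1 ≤ γ) {u : E → ℝ} (hu : ∀ x, 0 ≤ u x) (d : ℕ) :
    ∀ i x, 0 ≤ transferIter μ P t γ i d u x := by
  induction d with
  | zero => exact fun _ => hu
  | succ d ih => exact fun i => transfer_nonneg hγ (ih (i + 1))

lemma transfer_one (x : E) :
    transfer μ P t γ k (fun _ => 1) x = cutRatio γ (μ (k + 1)) (μ k) x := by
  simp [transfer, MarkovSemigroup.act]

namespace SMCSequence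

variable (hA : SMCSequence n μ P γ)
include hA

lemma integral_cutRatio_mul (hk : 1 ≤ k) (hkn : k < n) {h : E → ℝ} :
    ∫ x, cutRatio γ (μ (k + 1)) (μ k) x * h x ∂(μ k) = ∫ x, h x ∂(μ (k + 1)) := by
  have i1 := hA.prob k hk (by omega)
  have i2 := hA.prob (k + 1) (by omega) (by omega)
  rw [← integral_rnDeriv_smul (hA.abs_cont k hk hkn)]
  refine integral_congr_ae ?_
  obtain ⟨k, rfl⟩ : ∃ j, k = j + 1 := ⟨k - 1, by omega⟩
  filter_upwards [ae_densityRatio_le hA hkn] with x hx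
  rw [cutRatio, min_eq_left hx, smul_eq_mul]
  rfl

lemma integral_act (hk : 1 ≤ k) (hkn : k ≤ n) (s : ℝ≥0) {u : E → ℝ} (hu : BddMeasurable u) :
    ∫ x, (P k).act s u x ∂(μ k) = ∫ x, u x ∂(μ k) := by
  have i1 := hA.prob k hk hkn
  exact integral_integral_kernel (hA.invariant k hk hkn s) (hu.integrable _)

lemma integral_transfer (hk : 1 ≤ k) (hkn : k < n) {u : E → ℝ} (hu : BddMeasurable u) :
    ∫ x, transfer μ P t γ k u x ∂(μ k) = ∫ x, u x ∂(μ (k + 1)) := by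
  simp only [transfer]
  rw [hA.integral_cutRatio_mul hk hkn, hA.integral_act (by omega) (by omega) _ hu]

lemma integral_transferIter {u : E → ℝ} (hu : BddMeasurable u) (d : ℕ) :
    ∀ i, 1 ≤ i → i + d ≤ n → ∫ x, transferIter μ P t γ i d u x ∂(μ i) = ∫ x, u x ∂(μ (i + d)) := by
  induction d with
  | zero => exact fun i _ _ => rfl
  | succ d ih =>
    intro i hi hid
    rw [transferIter, hA.integral_transfer hi (by omega) (hu.transferIter hA.one_le μ P t d (i + 1)),
      ih (i + 1) (by omega) (by omega), show i + 1 + d = i + (d + 1) by omega]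

lemma abs_transfer_le_transfer_abs (u : E → ℝ) (x : E) :
    |transfer μ P t γ k u x| ≤ transfer μ P t γ k (fun y => |u y|) x := by
  rw [transfer, abs_mul, abs_of_nonneg (cutRatio_nonneg hA.one_le x)]
  exact mul_le_mul_of_nonneg_left ((P (k + 1)).abs_act_le_act_abs _ u x)
    (cutRatio_nonneg hA.one_le x)

lemma integral_abs_transferIter_le {u : E → ℝ} (hu : BddMeasurable u) (d : ℕ) :
    ∀ i, 1 ≤ i → i + d ≤ n →
      ∫ x, |transferIter μ P t γ i d u x| ∂(μ i) ≤ ∫ x, |u x| ∂(μ (i + d)) := by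
  induction d with
  | zero => exact fun i _ _ => le_rfl
  | succ d ih =>
    intro i hi hid
    have i1 := hA.prob i hi (by omega)
    have h1 := hu.transferIter hA.one_le μ P t d (i + 1)
    have h2 := ih (i + 1) (by omega) (by omega)
    rw [show i + 1 + d = i + (d + 1) by omega] at h2
    refine le_trans ?_ h2
    rw [← hA.integral_transfer (t := t) hi (by omega) h1.abs]
    exact integral_mono (hu.transferIter hA.one_le μ P t (d + 1) i |>.abs.integrable _)
      ((h1.abs.transfer hA.one_le μ P t i).integrable _) (hA.abs_transfer_le_transfer_abs _)

lemma integral_transfer_pow_le (hk : 1 ≤ k) (hkn : k < n) {u : E → ℝ} (hu : BddMeasurable u)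
    {m : ℕ} (hm : Even m) (hm0 : m ≠ 0) :
    ∫ x, transfer μ P t γ k u x ^ m ∂(μ k)
      ≤ γ ^ (m - 1) * ∫ x, (P (k + 1)).act (t (k + 1)) u x ^ m ∂(μ (k + 1)) := by
  have i1 := hA.prob k hk (by omega)
  rw [← hA.integral_cutRatio_mul hk hkn, ← integral_const_mul]
  have hp := (hu.act (P (k + 1)) (t (k + 1))).pow m
  refine integral_mono (((hu.transfer hA.one_le μ P t k).pow m).integrable _)
    (((BddMeasurable.cutRatio hA.one_le _ _).mul hp).integrable _ |>.const_mul _) fun x => ?_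
  obtain ⟨l, rfl⟩ : ∃ l, m = l + 1 := ⟨m - 1, by omega⟩
  have h0 := cutRatio_nonneg hA.one_le (μ' := μ (k + 1)) (μ := μ k) x
  simp only [transfer]
  rw [mul_pow, pow_succ (cutRatio γ (μ (k + 1)) (μ k) x), mul_assoc, Nat.add_sub_cancel]
  exact mul_le_mul_of_nonneg_right (pow_le_pow_left₀ h0 (cutRatio_le x) l)
    (mul_nonneg h0 (hm.pow_nonneg _))

variable [NeZero N]

lemma secondMoment_one_nonneg {h : E → ℝ} (hh : ∀ x, 0 ≤ h x) :
    0 ≤ secondMoment μ P t N k (fun _ => 1) h := by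
  refine integral_nonneg fun p => mul_nonneg (sq_nonneg _) ?_
  rw [empiricalMean_const, one_mul]
  exact mul_nonneg (inv_nonneg.2 (Nat.cast_nonneg _)) (Finset.sum_nonneg fun i _ => hh _)

lemma secondMoment_one_succ (hk : k + 2 ≤ n) {h : E → ℝ} (hh : BddMeasurable h) :
    secondMoment μ P t N (k + 2) (fun _ => 1) h
      = secondMoment μ P t N (k + 1) (transfer μ P t γ (k + 1) fun _ => 1)
        (transfer μ P t γ (k + 1) h) := by
  obtain ⟨B, hB⟩ := hh.bdd
  rw [secondMoment_succ hA hk measurable_const hh.measurable (fun _ => le_rfl) hB]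
  have e1 : cutRatio γ (μ (k + 2)) (μ (k + 1)) = transfer μ P t γ (k + 1) fun _ => 1 :=
    funext fun x => (transfer_one x).symm
  simp only [one_mul, e1]
  ring

/-- Unfolding the recursion for the second moments. The hypothesis on the products holds if `u = v`
and if both functions are nonnegative. -/
lemma secondMoment_le : ∀ k, k + 1 ≤ n → ∀ {u v : E → ℝ}, BddMeasurable u → BddMeasurable v →
    (∀ i ≤ k, ∀ x, 0 ≤ transferIter μ P t γ (i + 1) (k - i) u x *
      transferIter μ P t γ (i + 1) (k - i) v x) →
    0 ≤ (∫ x, u x ∂(μ (k + 1))) * ∫ x, v x ∂(μ (k + 1)) →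
    secondMoment μ P t N (k + 1) u v ≤ (∫ x, u x ∂(μ (k + 1))) * ∫ x, v x ∂(μ (k + 1))
      + (N : ℝ)⁻¹ * ∑ i ∈ Finset.range (k + 1), secondMoment μ P t N (i + 1) (fun _ => 1)
        fun x => transferIter μ P t γ (i + 1) (k - i) u x *
          transferIter μ P t γ (i + 1) (k - i) v x := by
  have hN1 : (N : ℝ)⁻¹ ≤ 1 := inv_le_one_of_one_le₀ (by exact_mod_cast NeZero.one_le)
  have hN0 : 0 ≤ (N : ℝ)⁻¹ := inv_nonneg.2 (Nat.cast_nonneg _)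
  intro k
  induction k with
  | zero =>
    intro hk u v hu hv huv hint
    have i1 := hA.prob 1 le_rfl hk
    obtain ⟨A, hA'⟩ := hu.bdd
    obtain ⟨B, hB⟩ := hv.bdd
    obtain ⟨D, hD⟩ := (hu.mul hv).bdd
    rw [Finset.sum_range_one]
    simp only [Nat.sub_zero, transferIter, zero_add] at huv hint ⊢
    rw [secondMoment_one i1 hu.measurable hv.measurable hA' hB,
      secondMoment_one i1 measurable_const (hu.mul hv).measurable (fun _ => le_rfl) hD]
    simp only [one_mul, integral_const, probReal_univ, smul_eq_mul, mul_one]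
    have := mul_nonneg hN0 hint
    linarith
  | succ k ih =>
    intro hk u v hu hv huv hint
    have i1 := hA.prob 1 le_rfl (by omega)
    obtain ⟨A, hA'⟩ := hu.bdd
    obtain ⟨B, hB⟩ := hv.bdd
    have hit : ∀ i ≤ k, ∀ w : E → ℝ, transferIter μ P t γ (i + 1) (k + 1 - i) w
        = transferIter μ P t γ (i + 1) (k - i) (transfer μ P t γ (k + 1) w) := by
      intro i hi w
      rw [show k + 1 - i = (k - i) + 1 by omega, transferIter_succ,
        show i + 1 + (k - i) = k + 1 by omega]
    have hiu := hA.integral_transfer (t := t) (by omega : 1 ≤ k + 1) (by omega) hu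
    have hiv := hA.integral_transfer (t := t) (by omega : 1 ≤ k + 1) (by omega) hv
    have h1 := ih (by omega) (hu.transfer hA.one_le μ P t (k + 1))
      (hv.transfer hA.one_le μ P t (k + 1)) (fun i hi x => by
        have := huv i (by omega) x
        rwa [hit i hi, hit i hi] at this) (by rw [hiu, hiv]; exact hint)
    rw [hiu, hiv] at h1
    rw [secondMoment_succ hA hk hu.measurable hv.measurable hA' hB, Finset.sum_range_succ]
    have h2 : secondMoment μ P t N (k + 1) (cutRatio γ (μ (k + 2)) (μ (k + 1)))
        (transfer μ P t γ (k + 1) fun x => u x * v x)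
        = secondMoment μ P t N (k + 1 + 1) (fun _ => 1) fun x =>
          transferIter μ P t γ (k + 1 + 1) (k + 1 - (k + 1)) u x *
          transferIter μ P t γ (k + 1 + 1) (k + 1 - (k + 1)) v x := by
      rw [hA.secondMoment_one_succ hk
        (h := fun x => transferIter μ P t γ (k + 1 + 1) (k + 1 - (k + 1)) u x *
          transferIter μ P t γ (k + 1 + 1) (k + 1 - (k + 1)) v x) (by
          simp only [Nat.sub_self]; exact hu.mul hv)]
      simp only [Nat.sub_self, transferIter]
      congr 1
      exact funext fun x => (transfer_one x).symm
    have h3 : ∑ i ∈ Finset.range (k + 1), secondMoment μ P t N (i + 1) (fun _ => 1)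
          (fun x => transferIter μ P t γ (i + 1) (k + 1 - i) u x *
          transferIter μ P t γ (i + 1) (k + 1 - i) v x)
        = ∑ i ∈ Finset.range (k + 1), secondMoment μ P t N (i + 1) (fun _ => 1)
          fun x => transferIter μ P t γ (i + 1) (k - i) (transfer μ P t γ (k + 1) u) x *
          transferIter μ P t γ (i + 1) (k - i) (transfer μ P t γ (k + 1) v) x := by
      refine Finset.sum_congr rfl fun i hi => ?_
      rw [hit i (by simpa [Nat.lt_succ_iff] using hi), hit i (by simpa [Nat.lt_succ_iff] using hi)]
    rw [h2, h3]
    set S := ∑ i ∈ Finset.range (k + 1), secondMoment μ P t N (i + 1) (fun _ => 1)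
          fun x => transferIter μ P t γ (i + 1) (k - i) (transfer μ P t γ (k + 1) u) x *
          transferIter μ P t γ (i + 1) (k - i) (transfer μ P t γ (k + 1) v) x with hS
    have hS0 : 0 ≤ S := Finset.sum_nonneg fun i hi => hA.secondMoment_one_nonneg fun x => by
      have hi' : i ≤ k := by simpa [Nat.lt_succ_iff] using hi
      have := huv i (by omega) x
      rwa [hit i hi', hit i hi'] at this
    have h4 := mul_le_mul_of_nonneg_left h1 (sub_nonneg.2 hN1)
    have h5 : (1 - (N : ℝ)⁻¹) * ((∫ x, u x ∂μ (k + 1 + 1)) * ∫ x, v x ∂μ (k + 1 + 1)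
        + (N : ℝ)⁻¹ * S) ≤ (∫ x, u x ∂μ (k + 1 + 1)) * ∫ x, v x ∂μ (k + 1 + 1) + (N : ℝ)⁻¹ * S :=
      mul_le_of_le_one_left (add_nonneg hint (mul_nonneg hN0 hS0)) (by linarith)
    rw [mul_add (N : ℝ)⁻¹]
    linarith

/-- The same expansion for `𝔼[z² η(h)]`, where the diagonal term is absent. -/
lemma secondMoment_one_le (hk : k + 1 ≤ n) {h : E → ℝ} (hh : BddMeasurable h)
    (h0 : ∀ x, 0 ≤ h x) :
    secondMoment μ P t N (k + 1) (fun _ => 1) h ≤ ∫ x, h x ∂(μ (k + 1))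
      + (N : ℝ)⁻¹ * ∑ i ∈ Finset.range k, secondMoment μ P t N (i + 1) (fun _ => 1)
        fun x => transferIter μ P t γ (i + 1) (k - i) (fun _ => 1) x *
          transferIter μ P t γ (i + 1) (k - i) h x := by
  have i1 := hA.prob 1 le_rfl (by omega)
  rcases k with _ | k
  · obtain ⟨B, hB⟩ := hh.bdd
    rw [secondMoment_one i1 measurable_const hh.measurable (fun _ => le_rfl) hB]
    simp only [one_mul, integral_const, probReal_univ, smul_eq_mul, Finset.range_zero,
      Finset.sum_empty, mul_zero, add_zero, zero_add]
    linarith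
  · have h1 := BddMeasurable.const (E := E) 1
    have hit : ∀ i ≤ k, ∀ w : E → ℝ, transferIter μ P t γ (i + 1) (k + 1 - i) w
        = transferIter μ P t γ (i + 1) (k - i) (transfer μ P t γ (k + 1) w) := by
      intro i hi w
      rw [show k + 1 - i = (k - i) + 1 by omega, transferIter_succ,
        show i + 1 + (k - i) = k + 1 by omega]
    have i2 := hA.prob (k + 2) (by omega) (by omega)
    rw [hA.secondMoment_one_succ hk hh]
    refine (hA.secondMoment_le k (by omega) (h1.transfer hA.one_le μ P t (k + 1))
      (hh.transfer hA.one_le μ P t (k + 1)) (fun i hi x => ?_) ?_).trans (le_of_eq ?_)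
    · exact mul_nonneg
        (transferIter_nonneg hA.one_le (transfer_nonneg hA.one_le fun _ => zero_le_one) _ _ _)
        (transferIter_nonneg hA.one_le (transfer_nonneg hA.one_le h0) _ _ _)
    · exact mul_nonneg (integral_nonneg (transfer_nonneg hA.one_le fun _ => zero_le_one))
        (integral_nonneg (transfer_nonneg hA.one_le h0))
    · rw [hA.integral_transfer (by omega) (by omega) h1, hA.integral_transfer (by omega) (by omega) hh]
      simp only [integral_const, probReal_univ, smul_eq_mul, one_mul]
      congr 2
      refine Finset.sum_congr rfl fun i hi => ?_
      rw [hit i (by simpa [Nat.lt_succ_iff] using hi), hit i (by simpa [Nat.lt_succ_iff] using hi)]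

end SMCSequence

end Expansion

/-! ### Moments of transferred functions -/

section TransferMoments

variable {E : Type*} [MeasurableSpace E]

lemma BddMeasurable.memLp_two {u : E → ℝ} (hu : BddMeasurable u) (μ : Measure E)
    [IsFiniteMeasure μ] : MemLp u 2 μ := by
  obtain ⟨A, hA⟩ := hu.bdd
  exact memLp_two_of_bound hu.measurable hA

lemma BddMeasurable.sq_integral_mul_le {u v : E → ℝ} (hu : BddMeasurable u) (hv : BddMeasurable v)
    (μ : Measure E) [IsFiniteMeasure μ] :
    (∫ x, u x * v x ∂μ) ^ 2 ≤ (∫ x, u x ^ 2 ∂μ) * ∫ x, v x ^ 2 ∂μ := by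
  have h := real_inner_mul_inner_self_le ((hu.memLp_two μ).toLp u) ((hv.memLp_two μ).toLp v)
  rw [inner_toLp, real_inner_self_eq_norm_sq, real_inner_self_eq_norm_sq, norm_toLp_sq,
    norm_toLp_sq] at h
  rw [pow_two]
  exact h

lemma BddMeasurable.sq_integral_le {u : E → ℝ} (hu : BddMeasurable u) (μ : Measure E)
    [IsProbabilityMeasure μ] : (∫ x, u x ∂μ) ^ 2 ≤ ∫ x, u x ^ 2 ∂μ := by
  have h := hu.sq_integral_mul_le (BddMeasurable.const 1) μ
  simpa using h

lemma BddMeasurable.sq_integral_abs_le {u : E → ℝ} (hu : BddMeasurable u) (μ : Measure E)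
    [IsProbabilityMeasure μ] : (∫ x, |u x| ∂μ) ^ 2 ≤ ∫ x, u x ^ 2 ∂μ := by
  simpa using hu.abs.sq_integral_le μ

/-- The contraction properties of the moves on which the bound for the mean squared error rests,
with rate `α / γ` and constants `β`, `r` that measure how the distributions split into
components: contraction of `L²` norms up to `L¹` norms (`sq_le`, and `sq_le_of_integral_eq_zero` with
half the constant for mean zero), and boundedness from `L²` to `L⁴` (`pow_four_le`). -/
structure SMCContraction (n : ℕ) (μ : ℕ → Measure E) (P : ℕ → MarkovSemigroup E) (t : ℕ → ℝ≥0)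
    (γ α β r : ℝ) : Prop extends SMCSequence n μ P γ where
  rate_pos : 0 < α
  rate_lt_one : α < 1
  two_le : 2 ≤ β
  one_le_defect : 1 ≤ r
  defect_le : r ≤ β
  sq_le : ∀ k, 1 ≤ k → k ≤ n → ∀ u : E → ℝ, BddMeasurable u →
    ∫ x, (P k).act (t k) u x ^ 2 ∂(μ k)
      ≤ α / γ * ∫ x, u x ^ 2 ∂(μ k) + (β - 1) * (∫ x, |u x| ∂(μ k)) ^ 2
  sq_le_of_integral_eq_zero : ∀ k, 1 ≤ k → k ≤ n → ∀ u : E → ℝ, BddMeasurable u →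
    ∫ x, u x ∂(μ k) = 0 → ∫ x, (P k).act (t k) u x ^ 2 ∂(μ k)
      ≤ α / γ * ∫ x, u x ^ 2 ∂(μ k) + (β - 1) / 2 * (∫ x, |u x| ∂(μ k)) ^ 2
  pow_four_le : ∀ k, 1 ≤ k → k ≤ n → ∀ u : E → ℝ, BddMeasurable u →
    ∫ x, (P k).act (t k) u x ^ 4 ∂(μ k) ≤ r * (∫ x, u x ^ 2 ∂(μ k)) ^ 2

variable {μ : ℕ → Measure E} {P : ℕ → MarkovSemigroup E} {t : ℕ → ℝ≥0} {γ α β r : ℝ} {n : ℕ}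

namespace SMCContraction

/-- Iteration of the contraction of `L²` norms along the levels. The `L¹` norms do not increase, so the
constants stay below any solution `X` of the fixed point inequality `α X + b ≤ X`, where `b` is
the coefficient of the `L¹` norm. -/
lemma integral_act_transferIter_sq_le_of (hA : SMCContraction n μ P t γ α β r) {u : E → ℝ}
    (hu : BddMeasurable u) {j : ℕ} (hj : j ≤ n) {b X : ℝ} (hb : 0 ≤ b) (h1 : α + b ≤ X)
    (h2 : α * X + b ≤ X)
    (hu2 : ∀ d i, 1 ≤ i → i + d = j →
      ∫ x, (P i).act (t i) (transferIter μ P t γ i d u) x ^ 2 ∂(μ i)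
        ≤ α / γ * ∫ x, transferIter μ P t γ i d u x ^ 2 ∂(μ i)
          + b * (∫ x, |transferIter μ P t γ i d u x| ∂(μ i)) ^ 2) (d : ℕ) :
    ∀ i, 1 ≤ i → i + d = j →
      ∫ x, (P i).act (t i) (transferIter μ P t γ i d u) x ^ 2 ∂(μ i)
        ≤ X * ∫ x, u x ^ 2 ∂(μ j) := by
  have hγ := hA.one_le
  have hγ0 : 0 < γ := by linarith
  have hS0 : 0 ≤ ∫ x, u x ^ 2 ∂(μ j) := integral_nonneg fun _ => sq_nonneg _
  have habs : ∀ d i, 1 ≤ i → i + d = j →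
      (∫ x, |transferIter μ P t γ i d u x| ∂(μ i)) ^ 2 ≤ ∫ x, u x ^ 2 ∂(μ j) := by
    intro d i hi hid
    have ij := hA.prob j (by omega) hj
    have h3 := hA.integral_abs_transferIter_le (t := t) hu d i hi (by omega)
    rw [hid] at h3
    exact (pow_le_pow_left₀ (integral_nonneg fun _ => abs_nonneg _) h3 2).trans
      (hu.sq_integral_abs_le _)
  induction d with
  | zero =>
    intro i hi hid
    refine (hu2 0 i hi hid).trans ?_
    have h3 := habs 0 i hi hid
    simp only [add_zero] at hid
    subst hid
    simp only [transferIter] at h3 ⊢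
    have h4 : α / γ ≤ α := div_le_self hA.rate_pos.le hγ
    calc _ ≤ α * ∫ x, u x ^ 2 ∂(μ i) + b * ∫ x, u x ^ 2 ∂(μ i) := by gcongr
      _ ≤ _ := by rw [← add_mul]; gcongr
  | succ d ih =>
    intro i hi hid
    refine (hu2 (d + 1) i hi hid).trans ?_
    have h3 := habs (d + 1) i hi hid
    have h4 := ih (i + 1) (by omega) (by omega)
    have h5 := hA.integral_transfer_pow_le (t := t) hi (by omega)
      (hu.transferIter hγ μ P t d (i + 1)) even_two two_ne_zero
    have h6 : α / γ * ∫ x, transferIter μ P t γ i (d + 1) u x ^ 2 ∂(μ i)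
        ≤ α * (X * ∫ x, u x ^ 2 ∂(μ j)) := by
      calc _ ≤ α / γ * (γ ^ (2 - 1) * (X * ∫ x, u x ^ 2 ∂(μ j))) := by
            have := hA.rate_pos
            refine mul_le_mul_of_nonneg_left (h5.trans ?_) (by positivity)
            gcongr
        _ = _ := by rw [show 2 - 1 = 1 from rfl, pow_one]; field_simp
    calc _ ≤ α * (X * ∫ x, u x ^ 2 ∂(μ j)) + b * ∫ x, u x ^ 2 ∂(μ j) := by gcongr
      _ = (α * X + b) * ∫ x, u x ^ 2 ∂(μ j) := by ring
      _ ≤ _ := by gcongr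

lemma integral_transferIter_sq_le_of (hA : SMCContraction n μ P t γ α β r) {u : E → ℝ}
    (hu : BddMeasurable u) {j : ℕ} (hj : j ≤ n) {X : ℝ} (hX : 1 ≤ X)
    (h : ∀ d i, 1 ≤ i → i + d = j →
      ∫ x, (P i).act (t i) (transferIter μ P t γ i d u) x ^ 2 ∂(μ i)
        ≤ X * ∫ x, u x ^ 2 ∂(μ j)) :
    ∀ d i, 1 ≤ i → i + d = j →
      ∫ x, transferIter μ P t γ i d u x ^ 2 ∂(μ i) ≤ γ * (X * ∫ x, u x ^ 2 ∂(μ j)) := by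
  have hγ := hA.one_le
  have hS0 : 0 ≤ ∫ x, u x ^ 2 ∂(μ j) := integral_nonneg fun _ => sq_nonneg _
  intro d i hi hid
  rcases d with _ | d
  · simp only [add_zero] at hid
    subst hid
    simp only [transferIter]
    rw [← mul_assoc]
    exact le_mul_of_one_le_left hS0 (by nlinarith)
  · have h5 := hA.integral_transfer_pow_le (t := t) hi (by omega)
      (hu.transferIter hγ μ P t d (i + 1)) even_two two_ne_zero
    refine h5.trans ?_
    have := h d (i + 1) (by omega) (by omega)
    norm_num
    gcongr

lemma one_le_ratio (hA : SMCContraction n μ P t γ α β r) : 1 ≤ (β - 1) / (1 - α) := by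
  have := hA.rate_lt_one
  have := hA.two_le
  have := hA.rate_pos
  rw [le_div_iff₀ (by linarith)]
  linarith

lemma ratio_fixed (hA : SMCContraction n μ P t γ α β r) (b : ℝ) :
    α * (b / (1 - α)) + b = b / (1 - α) := by
  have : 1 - α ≠ 0 := by linarith [hA.rate_lt_one]
  field_simp
  ring

lemma integral_act_transferIter_sq_le (hA : SMCContraction n μ P t γ α β r) {u : E → ℝ}
    (hu : BddMeasurable u) {j : ℕ} (hj : j ≤ n) (d i : ℕ) (hi : 1 ≤ i) (hid : i + d = j) :
    ∫ x, (P i).act (t i) (transferIter μ P t γ i d u) x ^ 2 ∂(μ i)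
        ≤ (β - 1) / (1 - α) * ∫ x, u x ^ 2 ∂(μ j) := by
  have h1 := hA.one_le_ratio
  have h2 := hA.ratio_fixed (β - 1)
  have h3 := hA.rate_pos
  refine hA.integral_act_transferIter_sq_le_of hu hj (b := β - 1) (by linarith [hA.two_le]) ?_
    h2.le (fun d i hi hid => hA.sq_le i hi (by omega) _ (hu.transferIter hA.one_le μ P t d i))
    d i hi hid
  nlinarith

lemma integral_transferIter_sq_le (hA : SMCContraction n μ P t γ α β r) {u : E → ℝ}
    (hu : BddMeasurable u) {j : ℕ} (hj : j ≤ n) (d i : ℕ) (hi : 1 ≤ i) (hid : i + d = j) :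
    ∫ x, transferIter μ P t γ i d u x ^ 2 ∂(μ i)
      ≤ γ * ((β - 1) / (1 - α) * ∫ x, u x ^ 2 ∂(μ j)) :=
  hA.integral_transferIter_sq_le_of hu hj hA.one_le_ratio
    (hA.integral_act_transferIter_sq_le hu hj) d i hi hid

/-- For functions of mean zero the constant `(β - 1) / (1 - α)` improves to any `X ≥ 1` that satisfies
the fixed point inequality with `(β - 1) / 2`. -/
lemma integral_transferIter_sq_le_of_integral_eq_zero (hA : SMCContraction n μ P t γ α β r)
    {u : E → ℝ} (hu : BddMeasurable u) {j : ℕ} (hj : j ≤ n) (h0 : ∫ x, u x ∂(μ j) = 0) {X : ℝ}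
    (hX : 1 ≤ X) (h2 : α * X + (β - 1) / 2 ≤ X) (d i : ℕ) (hi : 1 ≤ i) (hid : i + d = j) :
    ∫ x, transferIter μ P t γ i d u x ^ 2 ∂(μ i) ≤ γ * (X * ∫ x, u x ^ 2 ∂(μ j)) := by
  refine hA.integral_transferIter_sq_le_of hu hj hX ?_ d i hi hid
  have h3 := hA.rate_pos
  refine hA.integral_act_transferIter_sq_le_of hu hj (b := (β - 1) / 2)
    (by linarith [hA.two_le]) (by nlinarith) h2 fun d i hi hid =>
      hA.sq_le_of_integral_eq_zero i hi (by omega) _ (hu.transferIter hA.one_le μ P t d i) ?_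
  rw [hA.integral_transferIter hu d i hi (by omega), hid, h0]

lemma integral_act_transferIter_pow_four_le (hA : SMCContraction n μ P t γ α β r) {u : E → ℝ}
    (hu : BddMeasurable u) {j : ℕ} (hj : j ≤ n) {D : ℝ} (hD : (β - 1) / (1 - α) ≤ D) (d i : ℕ)
    (hi : 1 ≤ i) (hid : i + d = j) :
    ∫ x, (P i).act (t i) (transferIter μ P t γ i d u) x ^ 4 ∂(μ i)
        ≤ r * (γ * (D * ∫ x, u x ^ 2 ∂(μ j))) ^ 2 := by
  have hγ0 : 0 ≤ γ := by linarith [hA.one_le]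
  have hr0 : 0 ≤ r := by linarith [hA.one_le_defect]
  have hS0 : 0 ≤ ∫ x, u x ^ 2 ∂(μ j) := integral_nonneg fun _ => sq_nonneg _
  refine (hA.pow_four_le i hi (by omega) _ (hu.transferIter hA.one_le μ P t d i)).trans ?_
  have h1 := hA.integral_transferIter_sq_le hu hj d i hi hid
  have h2 : 0 ≤ ∫ x, transferIter μ P t γ i d u x ^ 2 ∂(μ i) := integral_nonneg fun _ => sq_nonneg _
  refine mul_le_mul_of_nonneg_left (pow_le_pow_left₀ h2 (h1.trans ?_) 2) hr0
  gcongr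

lemma integral_transferIter_pow_four_le (hA : SMCContraction n μ P t γ α β r) {u : E → ℝ}
    (hu : BddMeasurable u) {j : ℕ} (hj : j ≤ n) {D : ℝ} (hD : (β - 1) / (1 - α) ≤ D) (d i : ℕ)
    (hi : 1 ≤ i) (hid : i + (d + 1) = j) :
    ∫ x, transferIter μ P t γ i (d + 1) u x ^ 4 ∂(μ i)
        ≤ r * γ ^ 5 * D ^ 2 * (∫ x, u x ^ 2 ∂(μ j)) ^ 2 := by
  have hγ0 : 0 ≤ γ := by linarith [hA.one_le]
  have h5 := hA.integral_transfer_pow_le (t := t) hi (by omega)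
    (hu.transferIter hA.one_le μ P t d (i + 1)) (by decide : Even 4) four_ne_zero
  have h6 := hA.integral_act_transferIter_pow_four_le hu hj hD d (i + 1) (by omega) (by omega)
  refine h5.trans ((mul_le_mul_of_nonneg_left h6 (by positivity)).trans (le_of_eq ?_))
  norm_num
  ring

/-- A bound on the `L²` norm of `Q 1 · Q h`, `Q = Q_{i,j}`, by the `L²` norm of `h`. -/
lemma integral_sq_transferIter_mul_le (hA : SMCContraction n μ P t γ α β r) {h : E → ℝ}
    (hh : BddMeasurable h) {j : ℕ} (hj : j ≤ n) {D : ℝ} (hD : (β - 1) / (1 - α) ≤ D) (d i : ℕ)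
    (hi : 1 ≤ i) (hid : i + (d + 1) = j) :
    ∫ x, (transferIter μ P t γ i (d + 1) (fun _ => 1) x * transferIter μ P t γ i (d + 1) h x) ^ 2
        ∂(μ i) ≤ r * γ ^ 5 * D ^ 2 * ∫ x, h x ^ 2 ∂(μ j) := by
  have ii := hA.prob i hi (by omega)
  have ij := hA.prob j (by omega) hj
  have hγ0 : 0 ≤ γ := by linarith [hA.one_le]
  have hr0 : 0 ≤ r := by linarith [hA.one_le_defect]
  have h1 := (BddMeasurable.const (E := E) 1).transferIter hA.one_le μ P t (d + 1) i
  have h2 := hh.transferIter hA.one_le μ P t (d + 1) i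
  have h3 := (h1.pow 2).sq_integral_mul_le (h2.pow 2) (μ i)
  have h4 := hA.integral_transferIter_pow_four_le (BddMeasurable.const (E := E) 1) hj hD d i hi hid
  have h5 := hA.integral_transferIter_pow_four_le hh hj hD d i hi hid
  have hS0 : 0 ≤ ∫ x, h x ^ 2 ∂(μ j) := integral_nonneg fun _ => sq_nonneg _
  have e4 : ∀ z : ℝ, (z ^ 2) ^ 2 = z ^ 4 := fun z => by ring
  simp only [one_pow, integral_const, probReal_univ, smul_eq_mul, mul_one] at h4
  simp only [e4] at h3
  simp_rw [mul_pow]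
  refine le_of_sq_le_sq (h3.trans ?_) (by positivity)
  calc _ ≤ (r * γ ^ 5 * D ^ 2) * (r * γ ^ 5 * D ^ 2 * (∫ x, h x ^ 2 ∂(μ j)) ^ 2) :=
        mul_le_mul h4 h5 (integral_nonneg fun _ => by positivity) (by positivity)
    _ = _ := by ring

/-- A bound on `∫ Q 1 · Q h`, `Q = Q_{i,j}`, by the geometric mean of the `L¹` and `L²` norms of `h`. The
first error term of the expansion of the second moments is of this kind, with `h` a square. -/
lemma integral_transferIter_mul_pow_four_le (hA : SMCContraction n μ P t γ α β r) {h : E → ℝ}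
    (hh : BddMeasurable h) (h0 : ∀ x, 0 ≤ h x) {j : ℕ} (hj : j ≤ n) {D : ℝ}
    (hD : (β - 1) / (1 - α) ≤ D) (d i : ℕ) (hi : 1 ≤ i) (hid : i + (d + 1) = j) :
    (∫ x, transferIter μ P t γ i (d + 1) (fun _ => 1) x * transferIter μ P t γ i (d + 1) h x
      ∂(μ i)) ^ 4
      ≤ γ ^ 4 * ((∫ x, h x ∂(μ j)) ^ 2 * (r * (γ * D) ^ 2 * (D * ∫ x, h x ^ 2 ∂(μ j)))) := by
  have ii := hA.prob i hi (by omega)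
  have ij := hA.prob j (by omega) hj
  have ii' := hA.prob (i + 1) (by omega) (by omega)
  have hγ := hA.one_le
  have hγ0 : 0 ≤ γ := by linarith
  have hr0 : 0 ≤ r := by linarith [hA.one_le_defect]
  have b1 := (BddMeasurable.const (E := E) 1).transferIter hγ μ P t d (i + 1)
  have b2 := hh.transferIter hγ μ P t d (i + 1)
  set φ := (P (i + 1)).act (t (i + 1)) (transferIter μ P t γ (i + 1) d fun _ => 1) with hφ
  set ψ := (P (i + 1)).act (t (i + 1)) (transferIter μ P t γ (i + 1) d h) with hψ
  have bφ : BddMeasurable φ := b1.act _ _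
  have bψ : BddMeasurable ψ := b2.act _ _
  have φ0 : ∀ x, 0 ≤ φ x := fun x => integral_nonneg (transferIter_nonneg hγ (fun _ => zero_le_one) _ _)
  have ψ0 : ∀ x, 0 ≤ ψ x := fun x => integral_nonneg (transferIter_nonneg hγ h0 _ _)
  have hS0 : 0 ≤ ∫ x, h x ^ 2 ∂(μ j) := integral_nonneg fun _ => sq_nonneg _
  -- reduction to level `i + 1`
  have s1 : ∫ x, transferIter μ P t γ i (d + 1) (fun _ => 1) x * transferIter μ P t γ i (d + 1) h x
      ∂(μ i) ≤ γ * ∫ x, φ x * ψ x ∂(μ (i + 1)) := by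
    rw [← hA.integral_cutRatio_mul hi (by omega), ← integral_const_mul]
    refine integral_mono ((((BddMeasurable.const (E := E) 1).transferIter hγ μ P t (d + 1) i).mul
      (hh.transferIter hγ μ P t (d + 1) i)).integrable _)
      (((BddMeasurable.cutRatio hγ _ _).mul (bφ.mul bψ)).integrable _ |>.const_mul _) fun x => ?_
    have g0 := cutRatio_nonneg hγ (μ' := μ (i + 1)) (μ := μ i) x
    have g1 := cutRatio_le (γ := γ) (μ' := μ (i + 1)) (μ := μ i) x
    have e1 : transferIter μ P t γ i (d + 1) (fun _ => 1) x * transferIter μ P t γ i (d + 1) h x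
        = cutRatio γ (μ (i + 1)) (μ i) x * (cutRatio γ (μ (i + 1)) (μ i) x * (φ x * ψ x)) := by
      simp only [transferIter, transfer, hφ, hψ]
      ring
    simp only [e1]
    exact mul_le_mul_of_nonneg_right g1 (mul_nonneg g0 (mul_nonneg (φ0 x) (ψ0 x)))
  -- the Cauchy-Schwarz inequality with respect to `ψ • μ`, and then with respect to `μ`
  have s2 : (∫ x, φ x * ψ x ∂(μ (i + 1))) ^ 2
      ≤ (∫ x, ψ x ∂(μ (i + 1))) * ∫ x, φ x ^ 2 * ψ x ∂(μ (i + 1)) := by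
    have bs : BddMeasurable fun x => Real.sqrt (ψ x) := by
      obtain ⟨B, hB⟩ := bψ.bdd
      refine ⟨bψ.measurable.sqrt, Real.sqrt B, fun x => ?_⟩
      rw [abs_of_nonneg (Real.sqrt_nonneg _)]
      exact Real.sqrt_le_sqrt ((le_abs_self _).trans (hB x))
    have := bs.sq_integral_mul_le (bφ.mul bs) (μ (i + 1))
    have e1 : ∀ x, Real.sqrt (ψ x) * (φ x * Real.sqrt (ψ x)) = φ x * ψ x := fun x => by
      have := Real.mul_self_sqrt (ψ0 x)
      linear_combination φ x * this
    have e2 : ∀ x, (φ x * Real.sqrt (ψ x)) ^ 2 = φ x ^ 2 * ψ x := fun x => by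
      rw [mul_pow, Real.sq_sqrt (ψ0 x)]
    simp_rw [e1, e2, fun x => Real.sq_sqrt (ψ0 x)] at this
    exact this
  have s3 := (bφ.pow 2).sq_integral_mul_le bψ (μ (i + 1))
  have e4 : ∀ z : ℝ, (z ^ 2) ^ 2 = z ^ 4 := fun z => by ring
  simp only [e4] at s3
  have hψint : ∫ x, ψ x ∂(μ (i + 1)) = ∫ x, h x ∂(μ j) := by
    rw [hψ, hA.integral_act (by omega) (by omega) _ b2,
      hA.integral_transferIter hh d (i + 1) (by omega) (by omega),
      show i + 1 + d = j by omega]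
  have s4 := hA.integral_act_transferIter_pow_four_le (BddMeasurable.const (E := E) 1) hj hD d (i + 1)
    (by omega) (by omega)
  simp only [one_pow, integral_const, probReal_univ, smul_eq_mul, mul_one] at s4
  have s5 := (hA.integral_act_transferIter_sq_le hh hj d (i + 1) (by omega) (by omega)).trans
    (mul_le_mul_of_nonneg_right hD hS0)
  rw [hψint] at s2
  have n0 : 0 ≤ ∫ x, transferIter μ P t γ i (d + 1) (fun _ => 1) x *
      transferIter μ P t γ i (d + 1) h x ∂(μ i) :=
    integral_nonneg fun x => mul_nonneg (transferIter_nonneg hγ (fun _ => zero_le_one) _ _ x)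
      (transferIter_nonneg hγ h0 _ _ x)
  calc _ ≤ (γ * ∫ x, φ x * ψ x ∂(μ (i + 1))) ^ 4 := pow_le_pow_left₀ n0 s1 4
    _ = γ ^ 4 * ((∫ x, φ x * ψ x ∂(μ (i + 1))) ^ 2) ^ 2 := by ring
    _ ≤ γ ^ 4 * ((∫ x, h x ∂(μ j)) * ∫ x, φ x ^ 2 * ψ x ∂(μ (i + 1))) ^ 2 := by gcongr
    _ = γ ^ 4 * ((∫ x, h x ∂(μ j)) ^ 2 * (∫ x, φ x ^ 2 * ψ x ∂(μ (i + 1))) ^ 2) := by ring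
    _ ≤ γ ^ 4 * ((∫ x, h x ∂(μ j)) ^ 2 *
        ((∫ x, φ x ^ 4 ∂(μ (i + 1))) * ∫ x, ψ x ^ 2 ∂(μ (i + 1)))) := by gcongr
    _ ≤ _ := by
      have : 0 ≤ ∫ x, ψ x ^ 2 ∂(μ (i + 1)) := integral_nonneg fun _ => sq_nonneg _
      gcongr

end SMCContraction

end TransferMoments

/-! ### Bounds for the second moments -/

section SecondMomentBounds

variable {E : Type*} [MeasurableSpace E] {μ : ℕ → Measure E} {P : ℕ → MarkovSemigroup E}
  {t : ℕ → ℝ≥0} {γ α β r : ℝ} {n N : ℕ} [NeZero N]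

lemma sum_range_le_ratio {k : ℕ} (hk : k ≤ n) {a : ℕ → ℝ} {A : ℝ} (hA : 0 ≤ A)
    (ha : ∀ i < k, a i ≤ A) : (N : ℝ)⁻¹ * ∑ i ∈ Finset.range k, a i ≤ (n / N : ℝ) * A := by
  have h1 : ∑ i ∈ Finset.range k, a i ≤ n * A := by
    refine (Finset.sum_le_sum fun i hi => ha i (Finset.mem_range.1 hi)).trans ?_
    rw [Finset.sum_const, Finset.card_range, nsmul_eq_mul]
    gcongr
  calc _ ≤ (N : ℝ)⁻¹ * (n * A) := by gcongr
    _ = _ := by ring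

namespace SMCContraction

/-- For sufficiently many particles, `𝔼[z² η(h)]` exceeds the integral of `h` by no more than a small
multiple of the `L²` norm of `h`. -/
lemma secondMoment_one_le_add (hA : SMCContraction n μ P t γ α β r) {D Λ : ℝ}
    (hD : (β - 1) / (1 - α) ≤ D) (hΛ0 : 0 ≤ Λ) (hΛ : r * γ ^ 5 * D ^ 2 ≤ Λ ^ 2)
    (hN : 2 * (n / N : ℝ) * Λ ≤ 1) (k : ℕ) :
    k + 1 ≤ n → ∀ {h : E → ℝ}, BddMeasurable h → (∀ x, 0 ≤ h x) →
    secondMoment μ P t N (k + 1) (fun _ => 1) h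
      ≤ ∫ x, h x ∂(μ (k + 1)) + 2 * (n / N : ℝ) * Λ * Real.sqrt (∫ x, h x ^ 2 ∂(μ (k + 1))) := by
  induction k using Nat.strong_induction_on with
  | _ k ih =>
    intro hk h hh h0
    have hγ := hA.one_le
    have ik := hA.prob (k + 1) (by omega) hk
    set S := Real.sqrt (∫ x, h x ^ 2 ∂(μ (k + 1))) with hS
    have hS0 : 0 ≤ S := Real.sqrt_nonneg _
    have hSS : S ^ 2 = ∫ x, h x ^ 2 ∂(μ (k + 1)) :=
      Real.sq_sqrt (integral_nonneg fun _ => sq_nonneg _)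
    refine (hA.secondMoment_one_le hk hh h0).trans (add_le_add_right ?_ _)
    have h1 := sum_range_le_ratio (n := n) (N := N) (k := k) (by omega) (A := 2 * Λ * S)
      (by positivity)
      (a := fun i => secondMoment μ P t N (i + 1) (fun _ => 1)
        fun x => transferIter μ P t γ (i + 1) (k - i) (fun _ => 1) x *
          transferIter μ P t γ (i + 1) (k - i) h x) (fun i hi => ?_)
    · exact h1.trans (le_of_eq (by ring))
    · have ii := hA.prob (i + 1) (by omega) (by omega)
      have b1 := ((BddMeasurable.const (E := E) 1).transferIter hγ μ P t (k - i) (i + 1)).mul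
        (hh.transferIter hγ μ P t (k - i) (i + 1))
      have h2 := ih i hi (by omega) b1 fun x => mul_nonneg
        (transferIter_nonneg hγ (fun _ => zero_le_one) _ _ x) (transferIter_nonneg hγ h0 _ _ x)
      have h3 := hA.integral_sq_transferIter_mul_le hh hk hD (k - i - 1) (i + 1) (by omega)
        (by omega)
      rw [show k - i - 1 + 1 = k - i by omega, ← hSS] at h3
      have h4 : Real.sqrt (∫ x, (transferIter μ P t γ (i + 1) (k - i) (fun _ => 1) x *
          transferIter μ P t γ (i + 1) (k - i) h x) ^ 2 ∂(μ (i + 1))) ≤ Λ * S := by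
        refine Real.sqrt_le_iff.2 ⟨by positivity, h3.trans ?_⟩
        rw [mul_pow]
        gcongr
      have h5 := Real.le_sqrt_of_sq_le (b1.sq_integral_le (μ (i + 1)))
      refine h2.trans ?_
      have h6 := mul_le_mul hN h4 (Real.sqrt_nonneg _) zero_le_one
      linarith

/-- The estimate of `secondMoment_one_le_add` for `h = (Q u) ^ 2`, with the first step of the
expansion made explicit. -/
lemma secondMoment_sq_transferIter_le (hA : SMCContraction n μ P t γ α β r) {D Λ W : ℝ}
    (hD : (β - 1) / (1 - α) ≤ D) (hΛ1 : 1 ≤ Λ) (hΛ : r * γ ^ 5 * D ^ 2 ≤ Λ ^ 2)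
    (hN : 2 * (n / N : ℝ) * Λ ≤ 1) (hW0 : 0 ≤ W)
    (hW : γ ^ 4 * ((γ * D) ^ 2 * (r * (γ * D) ^ 2 * (D * Λ ^ 2))) ≤ W ^ 4)
    {u : E → ℝ} (hu : BddMeasurable u) {V : ℝ} (hV : ∀ x, |u x| ≤ V) {j : ℕ}
    (hj : j ≤ n) {B : ℝ} (hB : B ≤ γ * D * V ^ 2) (d k : ℕ) (hkd : k + 1 + d = j)
    (hb : ∫ x, transferIter μ P t γ (k + 1) d u x ^ 2 ∂(μ (k + 1)) ≤ B) :
    secondMoment μ P t N (k + 1) (fun _ => 1) (fun x => transferIter μ P t γ (k + 1) d u x ^ 2)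
      ≤ B + (n / N : ℝ) * ((W + 2 * (n / N : ℝ) * Λ ^ 3) * V ^ 2) := by
  have hγ := hA.one_le
  have hγ0 : 0 < γ := by linarith
  have hr0 : 0 ≤ r := by linarith [hA.one_le_defect]
  have hD0 : 0 ≤ D := le_trans (by linarith [hA.one_le_ratio]) hD
  have hΛ0 : 0 ≤ Λ := by linarith
  have ij := hA.prob j (by omega) hj
  have ik := hA.prob (k + 1) (by omega) (by omega)
  have hQ := hu.transferIter hγ μ P t d (k + 1)
  set h : E → ℝ := fun x => transferIter μ P t γ (k + 1) d u x ^ 2 with hh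
  have bh : BddMeasurable h := hQ.pow 2
  have h0 : ∀ x, 0 ≤ h x := fun x => sq_nonneg _
  have hsq : ∀ x, u x ^ 2 ≤ V ^ 2 := fun x => sq_le_sq' (abs_le.1 (hV x)).1 (abs_le.1 (hV x)).2
  have hu2 : ∫ x, u x ^ 2 ∂(μ j) ≤ V ^ 2 := by
    refine (integral_mono ((hu.pow 2).integrable _) (integrable_const _) hsq).trans ?_
    simp
  have hu20 : 0 ≤ ∫ x, u x ^ 2 ∂(μ j) := integral_nonneg fun _ => sq_nonneg _
  have hh2 : ∫ x, h x ^ 2 ∂(μ (k + 1)) ≤ (Λ * V ^ 2) ^ 2 := by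
    have e4 : ∀ z : ℝ, (z ^ 2) ^ 2 = z ^ 4 := fun z => by ring
    simp only [hh, e4]
    rcases d with _ | d
    · simp only [add_zero] at hkd
      subst hkd
      simp only [transferIter]
      have h1 : ∀ x, u x ^ 4 ≤ V ^ 4 := fun x => by
        have := pow_le_pow_left₀ (sq_nonneg _) (hsq x) 2
        rwa [e4, e4] at this
      have h2 := integral_mono ((hu.pow 4).integrable (μ (k + 1))) (integrable_const _) h1
      simp only [integral_const, probReal_univ, smul_eq_mul, one_mul] at h2
      refine h2.trans ?_
      rw [mul_pow, e4]
      exact le_mul_of_one_le_left (by positivity) (one_le_pow₀ hΛ1)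
    · refine (hA.integral_transferIter_pow_four_le hu hj hD d (k + 1) (by omega) hkd).trans ?_
      rw [mul_pow]
      gcongr
  have hhint : ∫ x, h x ∂(μ (k + 1)) ≤ γ * D * V ^ 2 := hb.trans hB
  have hh0 : 0 ≤ ∫ x, h x ∂(μ (k + 1)) := integral_nonneg h0
  refine (hA.secondMoment_one_le (by omega) bh h0).trans (add_le_add hb ?_)
  refine sum_range_le_ratio (by omega) (by positivity) fun i hi => ?_
  have ii := hA.prob (i + 1) (by omega) (by omega)
  have b1 := ((BddMeasurable.const (E := E) 1).transferIter hγ μ P t (k - i) (i + 1)).mul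
    (bh.transferIter hγ μ P t (k - i) (i + 1))
  refine (hA.secondMoment_one_le_add hD hΛ0 hΛ hN i (by omega) b1 fun x => mul_nonneg
    (transferIter_nonneg hγ (fun _ => zero_le_one) _ _ x)
    (transferIter_nonneg hγ h0 _ _ x)).trans ?_
  have h3 := hA.integral_sq_transferIter_mul_le bh (j := k + 1) (by omega) hD (k - i - 1) (i + 1)
    (by omega) (by omega)
  have h4 := hA.integral_transferIter_mul_pow_four_le bh h0 (j := k + 1) (by omega) hD (k - i - 1)
    (i + 1) (by omega) (by omega)
  rw [show k - i - 1 + 1 = k - i by omega] at h3 h4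
  have h5 : Real.sqrt (∫ x, (transferIter μ P t γ (i + 1) (k - i) (fun _ => 1) x *
      transferIter μ P t γ (i + 1) (k - i) h x) ^ 2 ∂(μ (i + 1))) ≤ Λ * (Λ * V ^ 2) := by
    refine Real.sqrt_le_iff.2 ⟨by positivity, h3.trans ?_⟩
    rw [mul_pow]
    gcongr
  have h6 : ∫ x, transferIter μ P t γ (i + 1) (k - i) (fun _ => 1) x *
      transferIter μ P t γ (i + 1) (k - i) h x ∂(μ (i + 1)) ≤ W * V ^ 2 := by
    refine le_of_pow_le_pow_left₀ four_ne_zero (by positivity) (h4.trans ?_)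
    calc _ ≤ γ ^ 4 * ((γ * D * V ^ 2) ^ 2 * (r * (γ * D) ^ 2 * (D * (Λ * V ^ 2) ^ 2))) := by gcongr
      _ = γ ^ 4 * ((γ * D) ^ 2 * (r * (γ * D) ^ 2 * (D * Λ ^ 2))) * (V ^ 2) ^ 4 := by ring
      _ ≤ W ^ 4 * (V ^ 2) ^ 4 := by gcongr
      _ = _ := by ring
  have h7 : 2 * (n / N : ℝ) * Λ * Real.sqrt (∫ x, (transferIter μ P t γ (i + 1) (k - i)
      (fun _ => 1) x * transferIter μ P t γ (i + 1) (k - i) h x) ^ 2 ∂(μ (i + 1)))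
      ≤ 2 * (n / N : ℝ) * Λ * (Λ * (Λ * V ^ 2)) := by gcongr
  refine (add_le_add h6 h7).trans (le_of_eq (by ring))

/-- The error terms are small compared to the main terms if the number of particles satisfies the
assumption of the theorem. Powers with exponents in `ℤ / 8` are avoided by working with the eighth
roots `G`, `R`, `b` of `γ`, `r`, `β` and the fourth root `δ` of `β / (1 - α)`. -/
lemma error_term_le {G R b δ τ : ℝ} (hG : 1 ≤ G) (hR : 1 ≤ R) (hRb : R ≤ b) (hbδ : b ^ 2 ≤ δ)
    (hτ0 : 0 ≤ τ) (hτ : τ * (8 * G ^ 27 * R * δ ^ 4 * b ^ 6) ≤ 1) :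
    τ * (G ^ 26 * δ ^ 7 * R ^ 4 + 2 * τ * (G ^ 20 * δ ^ 4 * R ^ 4) ^ 3)
      ≤ G ^ 8 * δ ^ 4 * (1 / (8 * b ^ 4) + 1 / (32 * b ^ 2)) := by
  have hb : 1 ≤ b := hR.trans hRb
  have hb0 : 0 < b := by linarith
  have hδ : 1 ≤ δ := (one_le_pow₀ hb).trans hbδ
  have hG0 : 0 < G := by linarith
  have hR0 : 0 < R := by linarith
  have hδ0 : 0 < δ := by linarith
  set T := 8 * G ^ 27 * R * δ ^ 4 * b ^ 6 with hT
  have hT0 : 0 < T := by positivity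
  have h1 : τ * (G ^ 26 * δ ^ 7 * R ^ 4) ≤ G ^ 8 * δ ^ 4 * (1 / (8 * b ^ 4)) := by
    have h2 : G ^ 26 * δ ^ 7 * R ^ 4 ≤ G ^ 8 * δ ^ 4 * (1 / (8 * b ^ 4)) * T := by
      have e : G ^ 8 * δ ^ 4 * (1 / (8 * b ^ 4)) * T
          = (G ^ 26 * G ^ 9) * (δ ^ 7 * δ) * (R * b ^ 2) := by
        rw [hT]; field_simp
      have e2 : R ^ 4 ≤ δ * (R * b ^ 2) := by
        calc R ^ 4 = R ^ 2 * (R * R) := by ring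
          _ ≤ b ^ 2 * (R * b) := by gcongr
          _ ≤ δ * (R * b ^ 2) := by
            have : b ≤ b ^ 2 := by nlinarith
            gcongr
      rw [e]
      calc _ ≤ G ^ 26 * δ ^ 7 * (δ * (R * b ^ 2)) := by gcongr
        _ ≤ G ^ 26 * G ^ 9 * δ ^ 7 * (δ * (R * b ^ 2)) := by
          have : G ^ 26 ≤ G ^ 26 * G ^ 9 :=
            le_mul_of_one_le_right (by positivity) (one_le_pow₀ hG)
          gcongr
        _ = _ := by ring
    calc _ ≤ τ * (G ^ 8 * δ ^ 4 * (1 / (8 * b ^ 4)) * T) := by gcongr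
      _ = G ^ 8 * δ ^ 4 * (1 / (8 * b ^ 4)) * (τ * T) := by ring
      _ ≤ G ^ 8 * δ ^ 4 * (1 / (8 * b ^ 4)) * 1 := by gcongr
      _ = _ := by ring
  have h3 : τ * (2 * τ * (G ^ 20 * δ ^ 4 * R ^ 4) ^ 3) ≤ G ^ 8 * δ ^ 4 * (1 / (32 * b ^ 2)) := by
    have h2 : 2 * (G ^ 20 * δ ^ 4 * R ^ 4) ^ 3 ≤ G ^ 8 * δ ^ 4 * (1 / (32 * b ^ 2)) * T ^ 2 := by
      have e : G ^ 8 * δ ^ 4 * (1 / (32 * b ^ 2)) * T ^ 2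
          = 2 * (G ^ 60 * G ^ 2) * δ ^ 12 * (R ^ 2 * b ^ 10) := by
        rw [hT]; field_simp; ring
      rw [e]
      calc _ = 2 * G ^ 60 * δ ^ 12 * (R ^ 2 * R ^ 10) := by ring
        _ ≤ 2 * (G ^ 60 * G ^ 2) * δ ^ 12 * (R ^ 2 * b ^ 10) := by
          have : G ^ 60 ≤ G ^ 60 * G ^ 2 :=
            le_mul_of_one_le_right (by positivity) (one_le_pow₀ hG)
          gcongr
    calc _ = τ ^ 2 * (2 * (G ^ 20 * δ ^ 4 * R ^ 4) ^ 3) := by ring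
      _ ≤ τ ^ 2 * (G ^ 8 * δ ^ 4 * (1 / (32 * b ^ 2)) * T ^ 2) := by gcongr
      _ = G ^ 8 * δ ^ 4 * (1 / (32 * b ^ 2)) * (τ * T) ^ 2 := by ring
      _ ≤ G ^ 8 * δ ^ 4 * (1 / (32 * b ^ 2)) * 1 ^ 2 := by gcongr
      _ = _ := by ring
  rw [mul_add, mul_add]
  exact add_le_add h1 h3

/-- The second moments of the particle approximation of a function of mean zero or of a constant. -/
lemma secondMoment_self_le (hA : SMCContraction n μ P t γ α β r) {G R b δ : ℝ} (hG : 1 ≤ G)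
    (hR : 1 ≤ R) (hRb : R ≤ b) (hGγ : G ^ 8 = γ) (hRr : R ^ 8 = r) (hbβ : b ^ 8 = β)
    (hδ0 : 0 ≤ δ) (hδ : δ ^ 4 = β / (1 - α))
    (hN : (n / N : ℝ) * (8 * G ^ 27 * R * δ ^ 4 * b ^ 6) ≤ 1) {k : ℕ} (hk : k + 1 = n)
    {u : E → ℝ} (hu : BddMeasurable u) {V : ℝ} (hV : ∀ x, |u x| ≤ V)
    {B : ℝ} (hB : B ≤ γ * δ ^ 4 * V ^ 2)
    (hb : ∀ d i, 1 ≤ i → i + d = k + 1 → ∫ x, transferIter μ P t γ i d u x ^ 2 ∂(μ i) ≤ B) :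
    secondMoment μ P t N (k + 1) u u ≤ (∫ x, u x ∂(μ (k + 1))) ^ 2
      + (n / N : ℝ) * (B + γ * δ ^ 4 * (1 / (8 * b ^ 4) + 1 / (32 * b ^ 2)) * V ^ 2) := by
  have hγ := hA.one_le
  have hα := hA.rate_pos
  have hα1 := hA.rate_lt_one
  have hβ := hA.two_le
  have hb1 : 1 ≤ b := hR.trans hRb
  have hb0 : 0 < b := by linarith
  have hbδ : b ^ 2 ≤ δ := by
    refine le_of_pow_le_pow_left₀ four_ne_zero hδ0 ?_
    rw [← pow_mul, hbβ, hδ]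
    exact le_div_self (by linarith) (by linarith) (by linarith)
  have hδ1 : 1 ≤ δ := (one_le_pow₀ hb1).trans hbδ
  have hG0 : 0 < G := by linarith
  have hR0 : 0 < R := by linarith
  have hδpos : 0 < δ := by linarith
  have hD : (β - 1) / (1 - α) ≤ δ ^ 4 := by
    rw [hδ]
    have : 0 < 1 - α := by linarith
    gcongr
    linarith
  have hτ0 : 0 ≤ (n / N : ℝ) := by positivity
  have h1 : 2 * (n / N : ℝ) * (G ^ 20 * δ ^ 4 * R ^ 4) ≤ 1 := by
    refine le_trans ?_ hN
    have : G ^ 20 * δ ^ 4 * R ^ 4 * 2 ≤ 8 * G ^ 27 * R * δ ^ 4 * b ^ 6 := by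
      have e1 : G ^ 20 ≤ G ^ 27 := pow_le_pow_right₀ hG (by norm_num)
      have e2 : R ^ 3 ≤ b ^ 6 :=
        (pow_le_pow_left₀ hR0.le hRb 3).trans (pow_le_pow_right₀ hb1 (by norm_num))
      calc G ^ 20 * δ ^ 4 * R ^ 4 * 2 = 2 * G ^ 20 * R * δ ^ 4 * R ^ 3 := by ring
        _ ≤ 8 * G ^ 27 * R * δ ^ 4 * b ^ 6 := by gcongr; norm_num
    calc _ = (n / N : ℝ) * (G ^ 20 * δ ^ 4 * R ^ 4 * 2) := by ring
      _ ≤ _ := by gcongr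
  have h2 : 1 ≤ G ^ 20 * δ ^ 4 * R ^ 4 :=
    one_le_mul_of_one_le_of_one_le
      (one_le_mul_of_one_le_of_one_le (one_le_pow₀ hG) (one_le_pow₀ hδ1)) (one_le_pow₀ hR)
  have hmul : 0 ≤ (∫ x, u x ∂(μ (k + 1))) * ∫ x, u x ∂(μ (k + 1)) := mul_self_nonneg _
  refine (hA.secondMoment_le k (by omega) hu hu (fun i hi x => mul_self_nonneg _) hmul).trans ?_
  rw [pow_two]
  refine add_le_add_right (sum_range_le_ratio (by omega) ?_ fun i hi => ?_) _
  · have hB0 : 0 ≤ B := (integral_nonneg fun _ => sq_nonneg _).trans (hb 0 (k + 1) (by omega) rfl)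
    positivity
  · simp_rw [← pow_two]
    have h3 := hA.secondMoment_sq_transferIter_le (N := N) hD h2 (W := G ^ 26 * δ ^ 7 * R ^ 4)
      (by rw [← hGγ, ← hRr]; exact le_of_eq (by ring)) h1 (by positivity)
      (by rw [← hGγ, ← hRr]; exact le_of_eq (by ring)) hu hV (j := k + 1) (by omega) hB (k - i)
      i (by omega) (hb (k - i) (i + 1) (by omega) (by omega))
    refine h3.trans (add_le_add_right ?_ _)
    have h4 := error_term_le hG hR hRb hbδ hτ0 hN
    rw [hGγ] at h4
    rw [← mul_assoc]
    exact mul_le_mul_of_nonneg_right h4 (sq_nonneg V)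

end SMCContraction

end SecondMomentBounds

/-! ### The mean squared error -/

section MeanSquaredError

variable {E : Type*} [MeasurableSpace E] {μ : ℕ → Measure E} {P : ℕ → MarkovSemigroup E}
  {t : ℕ → ℝ≥0} {γ α β r : ℝ} {n N : ℕ} [NeZero N]

lemma SMCSequence.integral_normalization (hA : SMCSequence n μ P γ) {k : ℕ} (hk : k + 1 ≤ n) :
    ∫ p, (p.1 : ℝ) ∂(weightedLaw μ P t N (k + 1)) = 1 := by
  have i1 := hA.prob (k + 1) (by omega) hk
  have hN : (N : ℝ≥0∞) ≠ 0 := Nat.cast_ne_zero.2 (NeZero.ne N)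
  have h := lintegral_weightedLaw (t := t) (N := N) hA k hk (h := fun _ => 1) measurable_const
  simp only [Finset.sum_const, Finset.card_univ, Fintype.card_fin, nsmul_eq_mul, mul_one,
    ENNReal.inv_mul_cancel hN (ENNReal.natCast_ne_top N), lintegral_const, measure_univ] at h
  rw [integral_eq_lintegral_of_nonneg_ae (ae_of_all _ fun p => p.1.coe_nonneg)
    measurable_fst.coe_nnreal_real.aestronglyMeasurable]
  simp only [ENNReal.ofReal_coe_nnreal, h, ENNReal.toReal_one]

/-- The mean squared error in terms of second moments of the unnormalized approximation, from the
elementary inequality `1 ≤ (5/2) z² + (5/3) (z - 1)²`. -/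
lemma SMCSequence.smcMSE_le (hA : SMCSequence n μ P γ) (hn : 1 ≤ n) {f : E → ℝ}
    (hf : BddMeasurable f) {V : ℝ} (hV : ∀ x, |f x - ∫ y, f y ∂(μ n)| ≤ V) :
    smcMSE μ P t N n f ≤ 5 / 2 * secondMoment μ P t N n (fun x => f x - ∫ y, f y ∂(μ n))
        (fun x => f x - ∫ y, f y ∂(μ n))
      + 5 / 3 * V ^ 2 * (secondMoment μ P t N n (fun _ => 1) (fun _ => 1) - 1) := by
  obtain ⟨k, rfl⟩ : ∃ k, n = k + 1 := ⟨n - 1, by omega⟩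
  have i1 := hA.prob 1 le_rfl hn
  have iJ := isProbabilityMeasure_weightedLaw (P := P) (t := t) (N := N) i1 k
  set a := ∫ y, f y ∂(μ (k + 1)) with ha
  have hum : Measurable fun x => f x - a := hf.measurable.sub_const a
  have hm : Measurable (empiricalMean (N := N) fun x => f x - a) := measurable_empiricalMean hum
  have e1 : smcMSE μ P t N (k + 1) f
      = ∫ p, empiricalMean (fun x => f x - a) p.2 ^ 2 ∂(weightedLaw μ P t N (k + 1)) := by
    rw [smcMSE, ← map_snd_weightedLaw i1 k]
    have e2 : ∀ ξ : Fin N → E, (1 / (N : ℝ)) * ∑ i, f (ξ i) - ∫ x, f x ∂(μ (k + 1))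
        = empiricalMean (fun x => f x - a) ξ := fun ξ => by
      rw [empiricalMean_sub_const, empiricalMean, one_div]
    simp_rw [e2]
    rw [integral_map measurable_snd.aemeasurable (hm.pow_const 2).aestronglyMeasurable]
  have j1 := integrable_secondMoment (t := t) (N := N) hA le_rfl hum hum hV hV
  have j2 := integrable_secondMoment (t := t) (N := N) hA le_rfl
    (measurable_const (a := (1 : ℝ))) (measurable_const (a := (1 : ℝ))) (fun _ => le_rfl) (fun _ => le_rfl)
  simp only [empiricalMean_const, mul_one] at j2
  have jz : Integrable (fun p : ℝ≥0 × (Fin N → E) => (p.1 : ℝ)) (weightedLaw μ P t N (k + 1)) := by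
    refine Integrable.of_bound (C := γ ^ k) measurable_fst.coe_nnreal_real.aestronglyMeasurable ?_
    filter_upwards [ae_normalization_le (t := t) (N := N) hA k le_rfl] with p hp
    rwa [Real.norm_of_nonneg p.1.coe_nonneg]
  have j0 : Integrable (fun p : ℝ≥0 × (Fin N → E) => empiricalMean (fun x => f x - a) p.2 ^ 2)
      (weightedLaw μ P t N (k + 1)) := by
    refine integrable_of_abs_le (B := V ^ 2) ((hm.comp measurable_snd).pow_const 2) fun p => ?_
    rw [abs_pow]
    exact pow_le_pow_left₀ (abs_nonneg _) (abs_empiricalMean_le hV p.2) 2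
  have j3 : Integrable (fun p : ℝ≥0 × (Fin N → E) => (p.1 : ℝ) ^ 2 - 2 * p.1 + 1)
      (weightedLaw μ P t N (k + 1)) := (j2.sub (jz.const_mul 2)).add (integrable_const 1)
  have hz := hA.integral_normalization (t := t) (N := N) le_rfl
  have h1 : ∫ p, empiricalMean (fun x => f x - a) p.2 ^ 2 ∂(weightedLaw μ P t N (k + 1))
      ≤ ∫ p, (5 / 2 * ((p.1 : ℝ) ^ 2 * (empiricalMean (fun x => f x - a) p.2 *
        empiricalMean (fun x => f x - a) p.2))
        + 5 / 3 * V ^ 2 * ((p.1 : ℝ) ^ 2 - 2 * p.1 + 1)) ∂(weightedLaw μ P t N (k + 1)) := by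
    refine integral_mono j0 ((j1.const_mul _).add
      (j3.const_mul _)) fun p => ?_
    have h2 : empiricalMean (fun x => f x - a) p.2 ^ 2 ≤ V ^ 2 :=
      sq_le_sq' (abs_le.1 (abs_empiricalMean_le hV p.2)).1 (abs_le.1 (abs_empiricalMean_le hV p.2)).2
    set s := empiricalMean (fun x => f x - a) p.2
    have h3 : 0 ≤ 5 / 3 * ((p.1 : ℝ) ^ 2 - 2 * p.1 + 1) := by nlinarith [sq_nonneg ((p.1 : ℝ) - 1)]
    have h4 : 1 ≤ 5 / 2 * (p.1 : ℝ) ^ 2 + 5 / 3 * ((p.1 : ℝ) ^ 2 - 2 * p.1 + 1) := by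
      nlinarith [sq_nonneg ((p.1 : ℝ) - 2 / 5)]
    have h5 := mul_le_mul_of_nonneg_right h4 (sq_nonneg s)
    have h6 := mul_le_mul_of_nonneg_left h2 h3
    simp only
    linarith
  rw [e1]
  refine h1.trans (le_of_eq ?_)
  rw [integral_add (j1.const_mul _)
    (j3.const_mul _), integral_const_mul,
    integral_const_mul]
  rw [integral_add (f := fun p : ℝ≥0 × (Fin N → E) => (p.1 : ℝ) ^ 2 - 2 * p.1)
    (j2.sub (jz.const_mul 2)) (integrable_const 1), integral_sub j2 (jz.const_mul 2),
    integral_const_mul, hz]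
  simp only [secondMoment, empiricalMean_const, mul_one, integral_const, probReal_univ, smul_eq_mul]
  ring

/-- The numerical inequality that closes the estimate of the mean squared error for `β = y⁻⁴ ≥ 3`. -/
lemma mse_constant_le {y F W : ℝ} (hF : 0 ≤ F) (hFW : F ≤ W) :
    5 / 2 * ((1 - y ^ 4) / 2 * F + (y ^ 2 / 8 + y / 32) * W)
      + 5 / 3 * W * ((1 - y ^ 4) + (y ^ 2 / 8 + y / 32)) ≤ F + 2 * W := by
  have h1 : 0 ≤ 2 - 5 / 3 * (1 - y ^ 4) - 25 / 6 * (y ^ 2 / 8 + y / 32) := by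
    nlinarith [sq_nonneg (y ^ 2 - 1 / 8), sq_nonneg (y - 5 / 16)]
  have h2 : 0 ≤ 3 - 35 / 12 * (1 - y ^ 4) - 25 / 6 * (y ^ 2 / 8 + y / 32) := by
    nlinarith [sq_nonneg (y ^ 2 - 1 / 8), sq_nonneg (y - 5 / 16)]
  have h3 := mul_nonneg hF h2
  have h4 := mul_nonneg (sub_nonneg.2 hFW) h1
  linarith

/-- The numerical inequality that closes the estimate of the mean squared error for `2 ≤ y⁻⁴ ≤ 3`. -/
lemma mse_constant_le_of_le {y F W : ℝ} (hy : 0 ≤ y) (hy1 : y ^ 4 ≤ 1 / 2) (hy2 : 1 / 3 ≤ y ^ 4)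
    (hF : 0 ≤ F) (hFW : F ≤ W) :
    5 / 2 * (1 / 2 * F + (y ^ 2 / 8 + y / 32) * W)
      + 5 / 3 * W * ((1 - y ^ 4) + (y ^ 2 / 8 + y / 32)) ≤ F + 2 * W := by
  have hy3 : y ≤ 17 / 20 := by
    by_contra h
    have := pow_lt_pow_left₀ (not_le.1 h) (by norm_num) four_ne_zero
    norm_num at this
    linarith
  have hy4 : y ^ 2 ≤ (17 / 20) ^ 2 := pow_le_pow_left₀ hy hy3 2
  have hW : 0 ≤ W := hF.trans hFW
  have h1 : 0 ≤ W * (3 - 5 / 4 - 5 / 3 * (1 - y ^ 4) - 25 / 6 * (y ^ 2 / 8 + y / 32)) :=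
    mul_nonneg hW (by norm_num at hy4; linarith)
  linarith

/-- The bound for the mean squared error, in terms of the roots `G`, `R`, `b`, `δ` of
`error_term_le`. -/
lemma SMCContraction.smcMSE_le_ratio (hA : SMCContraction n μ P t γ α β r) (hn : 1 ≤ n)
    {G R b δ : ℝ} (hG : 1 ≤ G) (hR : 1 ≤ R) (hRb : R ≤ b) (hGγ : G ^ 8 = γ) (hRr : R ^ 8 = r)
    (hbβ : b ^ 8 = β) (hδ0 : 0 ≤ δ) (hδ : δ ^ 4 = β / (1 - α))
    (hN : (n / N : ℝ) * (8 * G ^ 27 * R * δ ^ 4 * b ^ 6) ≤ 1) {f : E → ℝ} (hf : BddMeasurable f)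
    {V : ℝ} (hV : ∀ x, |f x - ∫ y, f y ∂(μ n)| ≤ V) :
    smcMSE μ P t N n f ≤ (n / N : ℝ) * (γ * (β / (1 - α))) *
      (∫ x, (f x - ∫ y, f y ∂(μ n)) ^ 2 ∂(μ n) + 2 * V ^ 2) := by
  have hγ := hA.one_le
  have hα := hA.rate_pos
  have hα1 := hA.rate_lt_one
  have hβ := hA.two_le
  have h1α : 0 < 1 - α := by linarith
  have hb0 : 0 < b := by linarith
  have hγ0 : 0 < γ := by linarith
  have in' := hA.prob n hn le_rfl
  set a := ∫ y, f y ∂(μ n) with ha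
  set F := ∫ x, (f x - a) ^ 2 ∂(μ n) with hF
  have bu : BddMeasurable fun x => f x - a := ⟨hf.measurable.sub_const a, V, hV⟩
  have hF0 : 0 ≤ F := integral_nonneg fun _ => sq_nonneg _
  have hFV : F ≤ V ^ 2 := by
    refine (integral_mono ((bu.pow 2).integrable _) (integrable_const (V ^ 2)) fun x =>
      sq_le_sq' (abs_le.1 (hV x)).1 (abs_le.1 (hV x)).2).trans ?_
    simp
  have hu0 : ∫ x, (f x - a) ∂(μ n) = 0 := by
    rw [integral_sub (hf.integrable _) (integrable_const _)]
    simp [← ha]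
  have hτ0 : 0 ≤ (n / N : ℝ) := by positivity
  set D := β / (1 - α) with hDdef
  have hD0 : 0 < D := by positivity
  obtain ⟨k, hk⟩ : ∃ k, n = k + 1 := ⟨n - 1, by omega⟩
  -- the variable `y = β ^ (-1/4)` in which the constants are polynomials
  set y := 1 / b ^ 2 with hy
  have hy0 : 0 ≤ y := by positivity
  have hy4 : y ^ 4 = 1 / β := by rw [← hbβ, hy, div_pow, ← pow_mul, one_pow]
  have hK : (β - 1) / (1 - α) = D * (1 - y ^ 4) := by
    rw [hy4, hDdef]; field_simp
  have he : 1 / (8 * b ^ 4) + 1 / (32 * b ^ 2) = y ^ 2 / 8 + y / 32 := by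
    rw [hy]; field_simp
  have h1 : secondMoment μ P t N n (fun _ => 1) (fun _ => 1)
      ≤ 1 + (n / N : ℝ) * (γ * D) * ((1 - y ^ 4) + (y ^ 2 / 8 + y / 32)) := by
    have h2 := hA.secondMoment_self_le hG hR hRb hGγ hRr hbβ hδ0 hδ hN hk.symm
      (BddMeasurable.const (E := E) 1) (V := 1) (fun _ => by simp)
      (B := γ * (D * (1 - y ^ 4))) (by
        rw [hδ, one_pow, mul_one]
        have : 0 ≤ y ^ 4 := by positivity
        gcongr
        nlinarith) (fun d i hi hid => by
        have ij := hA.prob (k + 1) (by omega) (by omega)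
        have := hA.integral_transferIter_sq_le (BddMeasurable.const (E := E) 1)
          (by omega : k + 1 ≤ n) d i hi hid
        simpa [hK] using this)
    rw [← hk, hδ, he] at h2
    simp only [integral_const, probReal_univ, smul_eq_mul, mul_one, one_pow] at h2
    linarith
  have h3 : ∀ X : ℝ, 1 ≤ D * X → α * (D * X) + (β - 1) / 2 ≤ D * X → X ≤ 1 →
      secondMoment μ P t N n (fun x => f x - a) (fun x => f x - a)
      ≤ (n / N : ℝ) * (γ * D) * (X * F + (y ^ 2 / 8 + y / 32) * V ^ 2) := by
    intro X hX1 hX2 hX3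
    have h2 := hA.secondMoment_self_le hG hR hRb hGγ hRr hbβ hδ0 hδ hN hk.symm bu hV
      (B := γ * (D * X * F)) (by
        rw [hδ, mul_assoc γ D (V ^ 2), mul_assoc D X F]
        gcongr
        calc X * F ≤ 1 * F := by gcongr
          _ ≤ V ^ 2 := by rw [one_mul]; exact hFV) (fun d i hi hid => by
        have := hA.integral_transferIter_sq_le_of_integral_eq_zero bu (j := n) le_rfl hu0 hX1 hX2
          d i hi (by omega)
        exact this)
    rw [← hk, hu0, hδ, he] at h2
    refine h2.trans (le_of_eq (by ring))
  refine (hA.smcMSE_le hn hf hV).trans ?_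
  have h4 : 5 / 3 * V ^ 2 * (secondMoment μ P t N n (fun _ => 1) (fun _ => 1) - 1)
      ≤ (n / N : ℝ) * (γ * D) * (5 / 3 * V ^ 2 * ((1 - y ^ 4) + (y ^ 2 / 8 + y / 32))) := by
    calc _ ≤ 5 / 3 * V ^ 2 * ((n / N : ℝ) * (γ * D) * ((1 - y ^ 4) + (y ^ 2 / 8 + y / 32))) := by
          gcongr; linarith
      _ = _ := by ring
  have hc0 : 0 ≤ (n / N : ℝ) * (γ * D) := by positivity
  -- the admissible constant `X` for functions of mean zero: for `β < 3`, the fixed point of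
  -- `α * X + (β - 1) / 2 = X` may be less than `1`
  rcases le_or_gt 3 β with h | h
  · have h5 := h3 ((1 - y ^ 4) / 2) (by
        have : D * ((1 - y ^ 4) / 2) = (β - 1) / 2 / (1 - α) := by
          rw [mul_div_assoc', ← hK]; ring
        rw [this, le_div_iff₀ h1α]
        linarith) (by
        have : D * ((1 - y ^ 4) / 2) = (β - 1) / 2 / (1 - α) := by
          rw [mul_div_assoc', ← hK]; ring
        rw [this]
        exact (hA.ratio_fixed _).le) (by
        have : 0 ≤ y ^ 4 := by positivity
        linarith)
    have h6 := mul_le_mul_of_nonneg_left (mse_constant_le (y := y) hF0 hFV) hc0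
    linarith
  · have hDX : D * (1 / 2) = β / 2 / (1 - α) := by rw [hDdef]; ring
    have h5 := h3 (1 / 2) (by
        rw [hDX, le_div_iff₀ h1α]
        linarith) (by
        have := hA.ratio_fixed (β / 2)
        rw [hDX]
        linarith) (by norm_num)
    have h6 := mul_le_mul_of_nonneg_left (mse_constant_le_of_le hy0 (by
      rw [hy4]; exact one_div_le_one_div_of_le (by norm_num) hβ) (by
      rw [hy4]; exact one_div_le_one_div_of_le (by linarith) h.le) hF0 hFV) hc0
    linarith

end MeanSquaredError

/-! ### Numbers of particles and constants -/

section Assembly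

variable {E : Type*} [MeasurableSpace E] {n : ℕ} {μ : ℕ → Measure E} {P : ℕ → MarkovSemigroup E}
  {t : ℕ → ℝ≥0} {m : ℕ → ℕ} {w : (k : ℕ) → Fin (m k) → ℝ} {ν : (k : ℕ) → Fin (m k) → Measure E}
  {Q : (k : ℕ) → Fin (m k) → MarkovSemigroup E} {c : (k : ℕ) → Fin (m k) → ℝ} {γ : ℝ}

namespace SMCAssumption

lemma isProbabilityMeasure (hA : SMCAssumption n μ P m w ν Q c γ) {k : ℕ}
    (hk : k ∈ Set.Icc 1 n) : IsProbabilityMeasure (μ k) := by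
  constructor
  have := hA.component_prob k hk
  rw [hA.mixture k hk, Measure.coe_finsetSum, Finset.sum_apply]
  simp only [Measure.smul_apply, measure_univ, smul_eq_mul, mul_one]
  rw [← ENNReal.ofReal_sum_of_nonneg fun i _ => (hA.weight_pos k hk i).le, hA.weight_sum k hk,
    ENNReal.ofReal_one]

lemma weight_le_one (hA : SMCAssumption n μ P m w ν Q c γ) {k : ℕ} (hk : k ∈ Set.Icc 1 n)
    (i : Fin (m k)) : w k i ≤ 1 := by
  rw [← hA.weight_sum k hk]
  exact Finset.single_le_sum (fun j _ => (hA.weight_pos k hk j).le) (Finset.mem_univ i)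

lemma mixtureLevel (hA : SMCAssumption n μ P m w ν Q c γ) {k : ℕ} (hk : k ∈ Set.Icc 1 n) {C : ℝ}
    (hC : ∀ i, c k i ≤ C) : MixtureLevel (P k) (μ k) (w k) (ν k) C where
  stationary := hA.stationary k hk
  reversible := hA.reversible k hk
  weight_pos := hA.weight_pos k hk
  weight_sum := hA.weight_sum k hk
  mixture := hA.mixture k hk
  local_logSobolev := ⟨Q k, c k, fun i => ⟨hA.lsi_const_pos k hk i, hC i, hA.log_sobolev k hk i⟩,
    hA.decomposition k hk⟩

/-- Moves of length `t_k ≥ C_k γ / (2 α)` contract at rate `α / γ`; this is also long enough for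
hypercontractivity, as `α < 1 ≤ γ`. -/
lemma smcContraction (hA : SMCAssumption n μ P m w ν Q c γ) {C : ℕ → ℝ}
    (hC : ∀ k ∈ Set.Icc 1 n, IsGreatest (Set.range (c k)) (C k)) {α β r : ℝ} (hα : 0 < α)
    (hα1 : α < 1) (hβ : 2 ≤ β) (hr : 1 ≤ r) (hrβ : r ≤ β)
    (hwβ : ∀ k ∈ Set.Icc 1 n, ∑ i, 1 / w k i ≤ β - 1)
    (hwr : ∀ k ∈ Set.Icc 1 n, ∀ i, 1 / w k i ≤ r)
    (ht : ∀ k ∈ Set.Icc 1 n, C k / 2 * (γ / α) ≤ t k) : SMCContraction n μ P t γ α β r := by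
  have hγ := hA.one_le_ratio
  have hγ0 : 0 < γ := by linarith
  have hCpos : ∀ k ∈ Set.Icc 1 n, 0 < C k := fun k hk => by
    obtain ⟨i, hi⟩ := (hC k hk).1
    rw [← hi]; exact hA.lsi_const_pos k hk i
  have htpos : ∀ k ∈ Set.Icc 1 n, 0 < t k := fun k hk => by
    have := hCpos k hk
    exact NNReal.coe_pos.1 (lt_of_lt_of_le (by positivity) (ht k hk))
  have hL : ∀ k ∈ Set.Icc 1 n, MixtureLevel (P k) (μ k) (w k) (ν k) (C k) := fun k hk =>
    hA.mixtureLevel hk fun i => (hC k hk).2 ⟨i, rfl⟩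
  have hCt : ∀ k ∈ Set.Icc 1 n, ∀ S : ℝ, 0 ≤ S → C k * (S / (2 * t k)) ≤ α / γ * S := by
    intro k hk S hS
    have h1 := ht k hk
    have h2 : (0 : ℝ) < t k := htpos k hk
    have h3 : C k / (2 * t k) ≤ α / γ := by
      rw [div_le_div_iff₀ (by positivity) hγ0]
      have : C k / 2 * (γ / α) = C k * γ / (2 * α) := by ring
      rw [this, div_le_iff₀ (by positivity)] at h1
      linarith
    calc C k * (S / (2 * t k)) = C k / (2 * t k) * S := by ring
      _ ≤ _ := mul_le_mul_of_nonneg_right h3 hS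
  refine
    { prob := fun k h1 h2 => hA.isProbabilityMeasure ⟨h1, h2⟩
      one_le := hγ
      abs_cont := hA.abs_cont
      ratio_le := hA.ratio_le
      invariant := fun k h1 h2 s => (hA.stationary k ⟨h1, h2⟩).invariant s
      rate_pos := hα
      rate_lt_one := hα1
      two_le := hβ
      one_le_defect := hr
      defect_le := hrβ
      sq_le := fun k h1 h2 u hu => ?_
      sq_le_of_integral_eq_zero := fun k h1 h2 u hu h0 => ?_
      pow_four_le := fun k h1 h2 u hu => ?_ }
  all_goals
    have hk : k ∈ Set.Icc 1 n := ⟨h1, h2⟩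
    have := hA.isProbabilityMeasure hk
    have := hA.component_prob k hk
    obtain ⟨B, hB⟩ := hu.bdd
    have hS : 0 ≤ ∫ x, u x ^ 2 ∂(μ k) := integral_nonneg fun _ => sq_nonneg _
  · refine ((hL k hk).integral_act_sq_le (htpos k hk) hu.measurable hB).trans ?_
    have := hwβ k hk
    exact add_le_add (hCt k hk _ hS) (by gcongr)
  · refine ((hL k hk).integral_act_sq_le_of_integral_eq_zero (htpos k hk) hu.measurable hB
      h0).trans ?_
    have := hwβ k hk
    exact add_le_add (hCt k hk _ hS) (by gcongr)
  · refine (hL k hk).integral_act_pow_four_le (hwr k hk) (by linarith) (htpos k hk) ?_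
      hu.measurable hB
    refine le_trans ?_ (ht k hk)
    have h3 : 1 ≤ γ / α := (one_le_div hα).2 (by linarith)
    exact le_mul_of_one_le_right (by linarith [hCpos k hk]) h3

end SMCAssumption

lemma rpow_eighth_pow {x : ℝ} (hx : 0 ≤ x) (k : ℕ) : (x ^ (1 / 8 : ℝ)) ^ k = x ^ (k / 8 : ℝ) := by
  rw [← Real.rpow_natCast, ← Real.rpow_mul hx]
  congr 1
  ring

lemma SMCContraction.smcMSE_le_of_le {α β r : ℝ} {N : ℕ} (hA : SMCContraction n μ P t γ α β r)
    (hn : 1 ≤ n) (hN0 : N ≠ 0)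
    (hN : n * (8 * (γ ^ (1 / 8 : ℝ)) ^ 27 * r ^ (1 / 8 : ℝ) * (β / (1 - α)) *
      (β ^ (1 / 8 : ℝ)) ^ 6) ≤ N) {f : E → ℝ} (hf : BddMeasurable f)
    {V : ℝ} (hV : ∀ x, |f x - ∫ y, f y ∂(μ n)| ≤ V) :
    smcMSE μ P t N n f ≤ (n / N : ℝ) * (γ * (β / (1 - α))) *
      (∫ x, (f x - ∫ y, f y ∂(μ n)) ^ 2 ∂(μ n) + 2 * V ^ 2) := by
  have : NeZero N := ⟨hN0⟩
  have hγ := hA.one_le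
  have hr := hA.one_le_defect
  have hrβ := hA.defect_le
  have hβ := hA.two_le
  have hα1 := hA.rate_lt_one
  have hNpos : (0 : ℝ) < N := Nat.cast_pos.2 (Nat.pos_of_ne_zero hN0)
  have h8 : ∀ {x : ℝ}, 1 ≤ x → (x ^ (1 / 8 : ℝ)) ^ 8 = x := fun hx => by
    rw [rpow_eighth_pow (by linarith)]; norm_num
  have hD0 : 0 ≤ β / (1 - α) := div_nonneg (by linarith) (by linarith)
  have hδ : ((β / (1 - α)) ^ (1 / 4 : ℝ)) ^ 4 = β / (1 - α) := by
    rw [← Real.rpow_natCast, ← Real.rpow_mul hD0]; norm_num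
  refine hA.smcMSE_le_ratio hn (Real.one_le_rpow hγ (by norm_num))
    (Real.one_le_rpow hr (by norm_num))
    (Real.rpow_le_rpow (by linarith) hrβ (by norm_num)) (h8 hγ) (h8 hr) (h8 (by linarith))
    (Real.rpow_nonneg hD0 (1 / 4)) hδ ?_ hf hV
  rw [hδ, div_mul_eq_mul_div]
  exact (div_le_one hNpos).2 hN

lemma le_of_ratio_mul_le {N : ℕ} {A B ε x : ℝ} (hN : 0 < (N : ℝ))
    (hAB : A ≤ B) (hε : 0 < ε) (h : (n : ℝ) / ε * B ≤ N) (hx : x ≤ (n / N : ℝ) * A) : x ≤ ε := by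
  refine hx.trans ?_
  have h1 : (n : ℝ) * B ≤ N * ε := by
    rw [div_mul_eq_mul_div, div_le_iff₀ hε] at h
    exact h
  rw [div_mul_eq_mul_div, div_le_iff₀ hN]
  have : (n : ℝ) * A ≤ n * B := by gcongr
  linarith

lemma BddMeasurable.integral_pow_le {μ : Measure E} [IsProbabilityMeasure μ] (κ : ℕ) {g : E → ℝ}
    (hg : BddMeasurable g) (h0 : ∀ x, 0 ≤ g x) :
    (∫ x, g x ∂μ) ^ 2 ^ κ ≤ ∫ x, g x ^ 2 ^ κ ∂μ := by
  induction κ with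
  | zero => simp
  | succ κ ih =>
    have h1 := (hg.pow (2 ^ κ)).sq_integral_le μ
    simp_rw [← pow_mul, ← pow_succ] at h1
    refine le_trans ?_ h1
    rw [pow_succ, pow_mul]
    exact pow_le_pow_left₀ (pow_nonneg (integral_nonneg h0) _) ih 2

lemma BddMeasurable.integral_sq_le_rpow {μ : Measure E} [IsProbabilityMeasure μ] {κ : ℕ}
    (hκ : 1 < κ) {f : E → ℝ} (hf : BddMeasurable f) :
    ∫ x, f x ^ 2 ∂μ ≤ ((∫ x, |f x| ^ 2 ^ κ ∂μ) ^ (1 / ((2 ^ κ : ℕ) : ℝ))) ^ 2 := by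
  obtain ⟨l, rfl⟩ : ∃ l, κ = l + 1 := ⟨κ - 1, by omega⟩
  have h1 := (hf.pow 2).integral_pow_le (μ := μ) l fun x => sq_nonneg _
  have h2 : ∀ x, (f x ^ 2) ^ 2 ^ l = |f x| ^ 2 ^ (l + 1) := fun x => by
    rw [← sq_abs, ← pow_mul, pow_succ, mul_comm]
  simp_rw [h2] at h1
  have hA0 : 0 ≤ ∫ x, |f x| ^ 2 ^ (l + 1) ∂μ := integral_nonneg fun x => by positivity
  refine le_of_pow_le_pow_left₀ (n := 2 ^ l) (by positivity) (by positivity) (h1.trans (le_of_eq ?_))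
  rw [← pow_mul, show 2 * 2 ^ l = 2 ^ (l + 1) by rw [pow_succ, mul_comm], one_div,
    Real.rpow_inv_natCast_pow hA0 (by positivity)]

lemma integral_sub_sq_le {μ : Measure E} [IsProbabilityMeasure μ] {f : E → ℝ}
    (hf : BddMeasurable f) : ∫ x, (f x - ∫ y, f y ∂μ) ^ 2 ∂μ ≤ ∫ x, f x ^ 2 ∂μ := by
  set a := ∫ y, f y ∂μ with ha
  have i1 := hf.integrable μ
  have i2 := (hf.pow 2).integrable μ
  have e1 : ∀ x, (f x - a) ^ 2 = f x ^ 2 - 2 * a * f x + a ^ 2 := fun x => by ring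
  simp_rw [e1]
  rw [integral_add (f := fun x => f x ^ 2 - 2 * a * f x) (i2.sub (i1.const_mul _))
    (integrable_const _), integral_sub i2 (i1.const_mul _), integral_const_mul, ← ha]
  simp only [integral_const, probReal_univ, smul_eq_mul, one_mul]
  nlinarith [sq_nonneg a]

/-- The quantities `δ(q)² r^(1/q)` increase with `q`, so the assumption on the number of particles is
weakest for `p = 4`. -/
lemma smcDelta_sq_mul_rpow_le {α β γ r : ℝ} (hγ : 1 ≤ γ) (hr : 1 ≤ r) (hrβ : r ≤ β) {j : ℕ}
    (hα0 : 0 ≤ α) (hα : α * γ ^ (2 * 2 ^ j - 2) < 1) :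
    smcDelta α β γ j ^ 2 * r ^ (1 / 2 ^ j : ℝ)
      ≤ smcDelta α β γ (j + 1) ^ 2 * r ^ (1 / 2 ^ (j + 1) : ℝ) := by
  set Y := β * γ ^ (2 * 2 ^ j - 2) / (1 - α * γ ^ (2 * 2 ^ j - 2)) with hY
  have hγ1 : 1 ≤ γ ^ (2 * 2 ^ j - 2) := one_le_pow₀ hγ
  have hrY : r ≤ Y := by
    rw [hY, le_div_iff₀ (by linarith)]
    have h1 : 0 ≤ α * γ ^ (2 * 2 ^ j - 2) := by positivity
    nlinarith
  have hY0 : 0 ≤ Y := by linarith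
  have h1 : (Y ^ (1 / (2 * 2 ^ j) : ℝ)) ^ 2 = Y ^ (1 / 2 ^ j : ℝ) := by
    rw [← Real.rpow_natCast, ← Real.rpow_mul hY0]
    congr 1
    push_cast
    field_simp
  rw [smcDelta, mul_pow, h1, mul_assoc]
  refine mul_le_mul_of_nonneg_left ?_ (sq_nonneg _)
  have h2 : r ^ (1 / 2 ^ j : ℝ) ≤ Y ^ (1 / 2 ^ j : ℝ) :=
    Real.rpow_le_rpow (by linarith) hrY (by positivity)
  have h3 : 1 ≤ r ^ (1 / 2 ^ (j + 1) : ℝ) := Real.one_le_rpow hr (by positivity)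
  exact h2.trans (le_mul_of_one_le_right (Real.rpow_nonneg hY0 _) h3)

/-- A lower bound on `δ(8)²`, the case `p = 4` of `δ(2p)²`. -/
lemma smcDelta_three_sq_ge {α β γ : ℝ} (hγ : 1 ≤ γ) (hβ : 0 ≤ β) (hα0 : 0 ≤ α)
    (hα : α * γ ^ 6 < 1) :
    (γ ^ (1 / 8 : ℝ)) ^ 20 * (β / (1 - α)) * (β ^ (1 / 8 : ℝ)) ^ 6 ≤ smcDelta α β γ 3 ^ 2 := by
  have hγ0 : 0 ≤ γ := by linarith
  have h26 : γ ^ 2 ≤ γ ^ 6 := pow_le_pow_right₀ hγ (by norm_num)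
  have h06 : 1 ≤ γ ^ 6 := one_le_pow₀ hγ
  have hα2 : α * γ ^ 2 < 1 := lt_of_le_of_lt (by gcongr) hα
  have hα1 : α < 1 := lt_of_le_of_lt (le_mul_of_one_le_right hα0 h06) hα
  have e : smcDelta α β γ 3 = (β / (1 - α)) ^ (1 / 2 : ℝ) *
      (β * γ ^ 2 / (1 - α * γ ^ 2)) ^ (1 / 4 : ℝ) * (β * γ ^ 6 / (1 - α * γ ^ 6)) ^ (1 / 8 : ℝ) := by
    simp only [smcDelta]
    norm_num
  have hX0 : 0 ≤ β / (1 - α) := div_nonneg hβ (by linarith)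
  have h1 : ((β / (1 - α)) ^ (1 / 2 : ℝ)) ^ 2 = β / (1 - α) := by
    rw [← Real.rpow_natCast, ← Real.rpow_mul hX0]; norm_num
  have hge : ∀ k : ℕ, α * γ ^ k < 1 → β * γ ^ k ≤ β * γ ^ k / (1 - α * γ ^ k) := fun k hk => by
    have : 0 ≤ α * γ ^ k := by positivity
    exact le_div_self (by positivity) (by linarith) (by linarith)
  have h2 : (β ^ (1 / 8 : ℝ)) ^ 2 * (γ ^ (1 / 8 : ℝ)) ^ 4
      ≤ (β * γ ^ 2 / (1 - α * γ ^ 2)) ^ (1 / 4 : ℝ) := by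
    refine le_trans (le_of_eq ?_) (Real.rpow_le_rpow (by positivity) (hge 2 hα2) (by norm_num))
    rw [Real.mul_rpow hβ (by positivity), rpow_eighth_pow hβ, rpow_eighth_pow hγ0,
      ← Real.rpow_natCast γ 2, ← Real.rpow_mul hγ0]
    norm_num
  have h3 : β ^ (1 / 8 : ℝ) * (γ ^ (1 / 8 : ℝ)) ^ 6
      ≤ (β * γ ^ 6 / (1 - α * γ ^ 6)) ^ (1 / 8 : ℝ) := by
    refine le_trans (le_of_eq ?_) (Real.rpow_le_rpow (by positivity) (hge 6 hα) (by norm_num))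
    rw [Real.mul_rpow hβ (by positivity), rpow_eighth_pow hγ0,
      ← Real.rpow_natCast γ 6, ← Real.rpow_mul hγ0]
    norm_num
  rw [e, mul_pow, mul_pow, h1]
  calc _ = β / (1 - α) * ((β ^ (1 / 8 : ℝ)) ^ 2 * (γ ^ (1 / 8 : ℝ)) ^ 4) ^ 2 *
        (β ^ (1 / 8 : ℝ) * (γ ^ (1 / 8 : ℝ)) ^ 6) ^ 2 := by ring
    _ ≤ _ := by gcongr

/-- The assumption of the complete bound on the number of particles implies the one that the
estimate of the mean squared error needs. -/
lemma particle_number_le {α β γ wmin : ℝ} (hγ : 1 ≤ γ) (hw : 0 < wmin) (hr : 1 ≤ 1 / wmin)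
    (hrβ : 1 / wmin ≤ β) (hα0 : 0 < α) {κ p : ℕ} (hκ : 1 < κ) (hp : p = 2 ^ κ)
    (hα : α < 1 / γ ^ (2 * p - 2)) :
    n * (8 * (γ ^ (1 / 8 : ℝ)) ^ 27 * (1 / wmin) ^ (1 / 8 : ℝ) * (β / (1 - α)) *
      (β ^ (1 / 8 : ℝ)) ^ 6)
      ≤ 2 * n * (3 + γ) * γ ^ ((2 * p - 1) / (2 * p) : ℝ) * smcDelta α β γ (κ + 1) ^ 2
            * (1 / wmin ^ (1 / (2 * p) : ℝ)) := by
  have hγ0 : 0 < γ := by linarith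
  set r := 1 / wmin with hrdef
  have hβ0 : 0 ≤ β := by linarith
  have hαj : ∀ j ≤ κ, α * γ ^ (2 * 2 ^ j - 2) < 1 := fun j hj => by
    rw [lt_div_iff₀ (by positivity)] at hα
    refine lt_of_le_of_lt ?_ hα
    have h1 : 2 ^ j ≤ p := hp ▸ Nat.pow_le_pow_right (by norm_num) hj
    have : γ ^ (2 * 2 ^ j - 2) ≤ γ ^ (2 * p - 2) := pow_le_pow_right₀ hγ (by omega)
    gcongr
  have hα6 : α * γ ^ 6 < 1 := by
    have := hαj 2 (by omega)
    norm_num at this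
    exact this
  have hα1 : α < 1 := by
    have := hαj 0 (by omega)
    norm_num at this
    exact this
  have hmono : ∀ j, 3 ≤ j → j ≤ κ + 1 → smcDelta α β γ 3 ^ 2 * r ^ (1 / 2 ^ 3 : ℝ)
      ≤ smcDelta α β γ j ^ 2 * r ^ (1 / 2 ^ j : ℝ) := by
    intro j hj
    induction j, hj using Nat.le_induction with
    | base => exact fun _ => le_rfl
    | succ j hj ih =>
      intro hjκ
      exact (ih (by omega)).trans (smcDelta_sq_mul_rpow_le hγ hr hrβ hα0.le
        (hαj j (by omega)))
  have h1 := hmono (κ + 1) (by omega) le_rfl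
  have h2 := smcDelta_three_sq_ge hγ hβ0 hα0.le hα6
  have h4p : (4 : ℝ) ≤ p := by
    rw [hp]
    have : 2 ^ 2 ≤ 2 ^ κ := Nat.pow_le_pow_right (by norm_num) hκ
    exact_mod_cast this
  have h3 : (γ ^ (1 / 8 : ℝ)) ^ 7 ≤ γ ^ ((2 * p - 1) / (2 * p) : ℝ) := by
    rw [rpow_eighth_pow hγ0.le]
    refine Real.rpow_le_rpow_of_exponent_le hγ ?_
    rw [div_le_div_iff₀ (by norm_num) (by linarith)]
    push_cast
    linarith
  have h5 : 1 / wmin ^ (1 / (2 * p) : ℝ) = r ^ (1 / 2 ^ (κ + 1) : ℝ) := by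
    rw [hrdef, Real.div_rpow zero_le_one hw.le, Real.one_rpow, hp]
    congr 3
    push_cast
    ring
  have h6 : (r : ℝ) ^ (1 / 2 ^ 3 : ℝ) = r ^ (1 / 8 : ℝ) := by norm_num
  have hX0 : 0 ≤ β / (1 - α) := div_nonneg hβ0 (by linarith)
  rw [h5]
  rw [h6] at h1
  calc _ = 2 * n * 4 * (γ ^ (1 / 8 : ℝ)) ^ 7 * (((γ ^ (1 / 8 : ℝ)) ^ 20 * (β / (1 - α)) *
        (β ^ (1 / 8 : ℝ)) ^ 6) * r ^ (1 / 8 : ℝ)) := by ring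
    _ ≤ 2 * n * (3 + γ) * γ ^ ((2 * p - 1) / (2 * p) : ℝ) *
        (smcDelta α β γ (κ + 1) ^ 2 * r ^ (1 / 2 ^ (κ + 1) : ℝ)) := by
      refine mul_le_mul ?_ ((mul_le_mul_of_nonneg_right h2 (by positivity)).trans h1)
        (by positivity) (by positivity)
      have : (4 : ℝ) ≤ 3 + γ := by linarith
      gcongr
    _ = _ := by ring

/-- The assumption of the simplified bound on the number of particles, for `α = γ⁻⁶ / 4` and
`β = 1 + M r`. -/
lemma particle_number_le_simplified {γ r : ℝ} {M : ℕ} (hγ : 1 ≤ γ) (hr : 1 ≤ r) (hM : 1 ≤ M) :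
    8 * (γ ^ (1 / 8 : ℝ)) ^ 27 * r ^ (1 / 8 : ℝ) * ((1 + M * r) / (1 - 1 / (4 * γ ^ 6))) *
      ((1 + M * r) ^ (1 / 8 : ℝ)) ^ 6
      ≤ 128 * γ ^ (35 / 8 : ℝ) * (M : ℝ) ^ (7 / 4 : ℝ) * r ^ (15 / 8 : ℝ) := by
  have hM1 : (1 : ℝ) ≤ M := by exact_mod_cast hM
  have hγ0 : 0 ≤ γ := by linarith
  have hr0 : 0 ≤ r := by linarith
  have hMr : 1 ≤ M * r := one_le_mul_of_one_le_of_one_le hM1 hr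
  set G := γ ^ (1 / 8 : ℝ) with hG
  set R := r ^ (1 / 8 : ℝ) with hR
  set L := (M : ℝ) ^ (1 / 8 : ℝ) with hL
  set b := (1 + M * r) ^ (1 / 8 : ℝ) with hb
  have hG1 : 1 ≤ G := Real.one_le_rpow hγ (by norm_num)
  have hR0 : 0 ≤ R := Real.rpow_nonneg hr0 _
  have hL0 : 0 ≤ L := Real.rpow_nonneg (by linarith) _
  have eG : γ ^ (35 / 8 : ℝ) = G ^ 35 := by rw [hG, rpow_eighth_pow hγ0]; norm_num
  have eL : (M : ℝ) ^ (7 / 4 : ℝ) = L ^ 14 := by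
    rw [hL, rpow_eighth_pow (by linarith)]; norm_num
  have eR : r ^ (15 / 8 : ℝ) = R ^ 15 := by rw [hR, rpow_eighth_pow hr0]; norm_num
  have eR8 : R ^ 8 = r := by rw [hR, rpow_eighth_pow hr0]; norm_num
  have eL8 : L ^ 8 = M := by rw [hL, rpow_eighth_pow (by linarith)]; norm_num
  have eb8 : b ^ 8 = 1 + M * r := by rw [hb, rpow_eighth_pow (by linarith)]; norm_num
  have hb0 : 0 ≤ b := Real.rpow_nonneg (by linarith) _
  have hb8 : b ^ 8 ≤ 2 * (L * R) ^ 8 := by rw [eb8, mul_pow, eL8, eR8]; linarith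
  have hb6 : b ^ 6 ≤ 2 * (L * R) ^ 6 := by
    refine le_of_pow_le_pow_left₀ four_ne_zero (by positivity) ?_
    calc (b ^ 6) ^ 4 = (b ^ 8) ^ 3 := by ring
      _ ≤ (2 * (L * R) ^ 8) ^ 3 := by gcongr
      _ = 8 * (L * R) ^ 24 := by ring
      _ ≤ 16 * (L * R) ^ 24 := by gcongr; norm_num
      _ = _ := by ring
  have hD : (1 + M * r) / (1 - 1 / (4 * γ ^ 6)) ≤ 4 * (L ^ 8 * R ^ 8) := by
    have h1 : 1 / (4 * γ ^ 6) ≤ 1 / 4 := by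
      refine one_div_le_one_div_of_le (by norm_num) ?_
      linarith [one_le_pow₀ hγ (n := 6)]
    rw [div_le_iff₀ (by linarith), eL8, eR8]
    nlinarith
  have hD0 : 0 ≤ (1 + M * r) / (1 - 1 / (4 * γ ^ 6)) := by
    have h1 : 1 / (4 * γ ^ 6) ≤ 1 / 4 := by
      refine one_div_le_one_div_of_le (by norm_num) ?_
      linarith [one_le_pow₀ hγ (n := 6)]
    exact div_nonneg (by linarith) (by linarith)
  rw [eG, eL, eR]
  have hG35 : G ^ 27 ≤ G ^ 35 := pow_le_pow_right₀ hG1 (by norm_num)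
  calc _ ≤ 8 * G ^ 35 * R * (4 * (L ^ 8 * R ^ 8)) * (2 * (L * R) ^ 6) := by gcongr
    _ = 64 * (G ^ 35 * L ^ 14 * R ^ 15) := by ring
    _ ≤ 128 * (G ^ 35 * L ^ 14 * R ^ 15) := by gcongr; norm_num
    _ = _ := by ring

end Assembly

theorem theorem1 {E : Type*} [MeasurableSpace E] (n : ℕ) (hn : 1 ≤ n)
    (μ : ℕ → Measure E) (P : ℕ → MarkovSemigroup E) (t : ℕ → ℝ≥0)
    (m : ℕ → ℕ) (w : (k : ℕ) → Fin (m k) → ℝ) (ν : (k : ℕ) → Fin (m k) → Measure E)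
    (Q : (k : ℕ) → Fin (m k) → MarkovSemigroup E) (c : (k : ℕ) → Fin (m k) → ℝ) (γ : ℝ)
    (hA : SMCAssumption n μ P m w ν Q c γ)
    (M : ℕ) (hM : IsGreatest (m '' Set.Icc 1 n) M)
    (wmin : ℝ) (hw : IsLeast {x | ∃ k ∈ Set.Icc 1 n, ∃ i, x = w k i} wmin)
    (C : ℕ → ℝ) (hC : ∀ k ∈ Set.Icc 1 n, IsGreatest (Set.range (c k)) (C k))
    (f : E → ℝ) (hf : Measurable f) (hfb : ∃ B : ℝ, ∀ x, |f x| ≤ B)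
    (ε : ℝ) (hε : 0 < ε) :
    -- the simplified bound
    (∀ N : ℕ,
      (n : ℝ) * max
          (4 * γ * M / (wmin * ε) * (1 + 3 * (⨆ x, |f x - ∫ y, f y ∂(μ n)|) ^ 2))
          (128 * γ ^ (35 / 8 : ℝ) * (M : ℝ) ^ (7 / 4 : ℝ) / wmin ^ (15 / 8 : ℝ)) ≤ (N : ℝ) →
      (∀ k ∈ Set.Icc 1 n, 2 * C k * γ ^ 7 ≤ t k) →
      smcMSE μ P t N n f ≤ ε) ∧
    -- the complete bound, with `p = 2 ^ κ`
    (∀ (β : ℝ), IsGreatest ((fun k => 1 + ∑ i, 1 / w k i) '' Set.Icc 1 n) β →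
      ∀ (κ : ℕ), 1 < κ → ∀ (p : ℕ), p = 2 ^ κ →
      ∀ (α : ℝ), 0 < α → α < 1 / γ ^ (2 * p - 2) →
      ∀ N : ℕ,
      max
          ((n : ℝ) / ε * (γ * β / (1 - α)) *
            (1 + ((∫ x, |f x| ^ p ∂(μ n)) ^ (1 / p : ℝ)) ^ 2
              + 2 * (⨆ x, |f x - ∫ y, f y ∂(μ n)|) ^ 2))
          (2 * n * (3 + γ) * γ ^ ((2 * p - 1) / (2 * p) : ℝ) * smcDelta α β γ (κ + 1) ^ 2
            * (1 / wmin ^ (1 / (2 * p) : ℝ))) ≤ (N : ℝ) →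
      (∀ k ∈ Set.Icc 1 n,
        C k / 2 * max (γ / α) (Real.log ((p - 1) / (p / 2 - 1))) ≤ t k) →
      smcMSE μ P t N n f ≤ ε) := by
  have hγ := hA.one_le_ratio
  have hγ0 : 0 < γ := by linarith
  have hnI : n ∈ Set.Icc 1 n := ⟨hn, le_rfl⟩
  have hn0 : (0 : ℝ) < n := Nat.cast_pos.2 hn
  have hμn := hA.isProbabilityMeasure hnI
  have hfB : BddMeasurable f := ⟨hf, hfb⟩
  set V := ⨆ x, |f x - ∫ y, f y ∂(μ n)| with hVdef
  have hV : ∀ x, |f x - ∫ y, f y ∂(μ n)| ≤ V := by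
    obtain ⟨B, hB⟩ := hfb
    refine fun x => le_ciSup (f := fun x => |f x - ∫ y, f y ∂(μ n)|)
      ⟨B + |∫ y, f y ∂(μ n)|, ?_⟩ x
    rintro _ ⟨z, rfl⟩
    exact (abs_sub _ _).trans (by linarith [hB z])
  have hVF : ∫ x, (f x - ∫ y, f y ∂(μ n)) ^ 2 ∂(μ n) ≤ V ^ 2 := by
    have bu : BddMeasurable fun x => f x - ∫ y, f y ∂(μ n) := ⟨hf.sub_const _, V, hV⟩
    refine (integral_mono ((bu.pow 2).integrable _) (integrable_const (V ^ 2)) fun x =>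
      sq_le_sq' (abs_le.1 (hV x)).1 (abs_le.1 (hV x)).2).trans ?_
    simp
  obtain ⟨⟨k₀, hk₀, i₀, hi₀⟩, hwmin⟩ := hw
  have hwpos : 0 < wmin := hi₀ ▸ hA.weight_pos k₀ hk₀ i₀
  have hw1 : wmin ≤ 1 := hi₀ ▸ hA.weight_le_one hk₀ i₀
  have hr : 1 ≤ 1 / wmin := (one_le_div hwpos).2 hw1
  have hwr : ∀ k ∈ Set.Icc 1 n, ∀ i, 1 / w k i ≤ 1 / wmin := fun k hk i =>
    one_div_le_one_div_of_le hwpos (hwmin ⟨k, hk, i, rfl⟩)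
  have hCpos : ∀ k ∈ Set.Icc 1 n, 0 < C k := fun k hk => by
    obtain ⟨i, hi⟩ := (hC k hk).1
    rw [← hi]; exact hA.lsi_const_pos k hk i
  constructor
  · intro N hN ht
    have hM1 : 1 ≤ M := by
      refine le_trans ?_ (hM.2 ⟨n, hnI, rfl⟩)
      rw [Nat.one_le_iff_ne_zero]
      intro h0
      have h1 := hA.weight_sum n hnI
      have : IsEmpty (Fin (m n)) := by rw [h0]; infer_instance
      rw [Finset.univ_eq_empty, Finset.sum_empty] at h1
      exact zero_ne_one h1
    have hM1' : (1 : ℝ) ≤ M := by exact_mod_cast hM1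
    have hγ6 : 1 ≤ γ ^ 6 := one_le_pow₀ hγ
    -- for `α = 1 / (4 γ⁶)`, the required length `C_k γ / (2 α)` of the moves is `2 C_k γ⁷`
    have hα : 1 / (4 * γ ^ 6) ≤ 1 / 4 :=
      one_div_le_one_div_of_le (by norm_num) (by linarith)
    have hMr : 1 ≤ M * (1 / wmin) := one_le_mul_of_one_le_of_one_le hM1' hr
    have hS : SMCContraction n μ P t γ (1 / (4 * γ ^ 6)) (1 + M * (1 / wmin)) (1 / wmin) := by
      refine hA.smcContraction hC (by positivity) (by linarith) (by linarith) hr ?_ ?_ hwr ?_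
      · have : 1 / wmin ≤ M * (1 / wmin) := le_mul_of_one_le_left (by linarith) hM1'
        linarith
      · intro k hk
        refine (Finset.sum_le_sum fun i _ => hwr k hk i).trans ?_
        rw [Finset.sum_const, Finset.card_univ, Fintype.card_fin, nsmul_eq_mul, add_sub_cancel_left]
        have : (m k : ℝ) ≤ M := by exact_mod_cast hM.2 ⟨k, hk, rfl⟩
        gcongr
      · intro k hk
        refine le_trans (le_of_eq ?_) (ht k hk)
        field_simp
        ring
    have hN1 : (n : ℝ) * (4 * γ * M / (wmin * ε) * (1 + 3 * V ^ 2)) ≤ N :=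
      (mul_le_mul_of_nonneg_left (le_max_left _ _) hn0.le).trans hN
    have hN2 : (n : ℝ) * (128 * γ ^ (35 / 8 : ℝ) * (M : ℝ) ^ (7 / 4 : ℝ) / wmin ^ (15 / 8 : ℝ)) ≤ N :=
      (mul_le_mul_of_nonneg_left (le_max_right _ _) hn0.le).trans hN
    have hNpos : (0 : ℝ) < N := lt_of_lt_of_le (by positivity) hN1
    have hN0 : N ≠ 0 := by rintro rfl; simp at hNpos
    have hN3 := particle_number_le_simplified hγ hr hM1
    rw [Real.div_rpow zero_le_one hwpos.le (15 / 8), Real.one_rpow, ← div_eq_mul_one_div (128 * _ * _)]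
      at hN3
    have h := hS.smcMSE_le_of_le hn hN0 ((mul_le_mul_of_nonneg_left hN3 hn0.le).trans hN2) hfB hV
    rw [mul_assoc] at h
    refine le_of_ratio_mul_le (B := 4 * γ * M / wmin * (1 + 3 * V ^ 2)) hNpos ?_ hε ?_ h
    · have hD : (1 + M * (1 / wmin)) / (1 - 1 / (4 * γ ^ 6)) ≤ 8 / 3 * (M * (1 / wmin)) := by
        rw [div_le_iff₀ (by linarith)]
        nlinarith
      calc _ ≤ γ * (8 / 3 * (M * (1 / wmin))) * (V ^ 2 + 2 * V ^ 2) := by gcongr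
        _ = γ * M * (1 / wmin) * (8 * V ^ 2) := by ring
        _ ≤ γ * M * (1 / wmin) * (4 * (1 + 3 * V ^ 2)) := by
          refine mul_le_mul_of_nonneg_left ?_ (by positivity)
          linarith [sq_nonneg V]
        _ = _ := by ring
    · refine le_trans (le_of_eq ?_) hN1
      field_simp
  · intro β hβ κ hκ p hp α hα0 hα N hN ht
    have hγp : 1 ≤ γ ^ (2 * p - 2) := one_le_pow₀ hγ
    have hα1 : α < 1 := hα.trans_le ((div_le_one (by linarith)).2 hγp)
    have hwβ : ∀ k ∈ Set.Icc 1 n, ∑ i, 1 / w k i ≤ β - 1 := fun k hk => by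
      have := hβ.2 ⟨k, hk, rfl⟩
      simp only at this
      linarith
    have hrβ : 1 + 1 / wmin ≤ β := by
      have h1 : 1 / wmin ≤ ∑ i, 1 / w k₀ i := by
        rw [hi₀]
        exact Finset.single_le_sum (f := fun i => 1 / w k₀ i)
          (fun i _ => (one_div_pos.2 (hA.weight_pos k₀ hk₀ i)).le) (Finset.mem_univ i₀)
      linarith [hwβ k₀ hk₀]
    have hS : SMCContraction n μ P t γ α β (1 / wmin) := by
      refine hA.smcContraction hC hα0 hα1 (by linarith) hr (by linarith) hwβ hwr fun k hk => ?_
      refine le_trans ?_ (ht k hk)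
      have := hCpos k hk
      gcongr
      exact le_max_left _ _
    have hD0 : 0 < γ * β / (1 - α) := div_pos (mul_pos hγ0 (by linarith)) (by linarith)
    have hN1 := (le_max_left _ _).trans hN
    have hN2 := (le_max_right _ _).trans hN
    have hNpos : (0 : ℝ) < N := lt_of_lt_of_le (by positivity) hN1
    have hN0 : N ≠ 0 := by rintro rfl; simp at hNpos
    have h := hS.smcMSE_le_of_le hn hN0
      ((particle_number_le hγ hwpos hr (by linarith) hα0 hκ hp hα).trans hN2) hfB hV
    rw [mul_assoc] at h
    rw [mul_assoc] at hN1
    refine le_of_ratio_mul_le hNpos ?_ hε hN1 h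
    have h2 := (integral_sub_sq_le (μ := μ n) hfB).trans (hfB.integral_sq_le_rpow (μ := μ n) hκ)
    rw [mul_div_assoc]
    have h3 : 0 ≤ γ * (β / (1 - α)) := by rw [← mul_div_assoc]; exact hD0.le
    rw [hp]
    refine mul_le_mul_of_nonneg_left ?_ h3
    linarith
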